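/- Let $\mathcal{C}$ be a compact connected Riemann surface and let $f:\mathcal{C}\to\mathbb{CP}^1$ be a non-constant meromorphic function, i.e. a non-constant holomorphic map. Then there are a point $p\in\mathbb{CP}^2$ and a holomorphic map $\nu:\mathcal{C}\to\mathbb{CP}^2$ such that: 1. $\nu$ is birational onto its image, and the image is a plane curve: $\nu(\mathcal{C})$ is the zero set of an irreducible homogeneous polynomial in three variables; outside a finite subset of $\mathcal{C}$ each point $x$ is the only point of $\nu^{-1}(\nu(x))$; and every meromorphic function on $\mathcal{C}$ is the pullback under $\nu$ of a rational function on $\nu(\mathcal{C})$, so that $\nu$ induces an isomorphism of function fields. 2. $f=\pi_p\circ\nu$, where $\pi_p$ is the projection from $p$, which sends a point $q\neq p$ to the line through $p$ and $q$, and where the pencil of lines through $p$ is identified with $\mathbb{CP}^1$ by a suitable projective isomorphism. If $p\in\nu(\mathcal{C})$, the set $\nu^{-1}(p)$ is finite, the equality holds on its complement, and $f$ is the continuous extension of $\pi_p\circ\nu$ to $\mathcal{C}$. -/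

import Mathlib

open scoped Manifold ContDiff

/-- Complex projective `n`-space, as the set of lines through the origin in `ℂ ^ (n + 1)`. -/
abbrev CP (n : ℕ) : Type := Projectivization ℂ (Fin (n + 1) → ℂ)

/-- A map from a complex manifold of dimension one to `CP n` is holomorphic if near every point
it is given by homogeneous coordinates that are holomorphic and have no common zero. For `n = 1`
these maps are the meromorphic functions on `C` (together with the constant `∞`). -/
def IsHolomorphicToCP {C : Type*} [TopologicalSpace C] [ChartedSpace ℂ C] {n : ℕ}
    (g : C → CP n) : Prop :=
  ∀ x : C, ∃ U : Set C, IsOpen U ∧ x ∈ U ∧ ∃ s : C → (Fin (n + 1) → ℂ),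
    MDifferentiableOn 𝓘(ℂ, ℂ) 𝓘(ℂ, Fin (n + 1) → ℂ) s U ∧
      ∀ y ∈ U, ∃ hy : s y ≠ 0, g y = Projectivization.mk ℂ (s y) hy

/-- The zero set in `CP 2` of a polynomial in three variables (meaningful for homogeneous ones). -/
def planeZeroLocus (F : MvPolynomial (Fin 3) ℂ) : Set (CP 2) :=
  {q | MvPolynomial.eval q.rep F = 0}

/-- `X` is an irreducible algebraic curve in `CP 2`. -/
def IsIrreduciblePlaneCurve (X : Set (CP 2)) : Prop :=
  ∃ (d : ℕ) (F : MvPolynomial (Fin 3) ℂ), F.IsHomogeneous d ∧ Irreducible F ∧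
    X = planeZeroLocus F

/-- The meromorphic function `h` agrees, outside a finite set, with the pullback under `ν` of the
rational function `P / Q`; its value at `x` is `[P(ν x) : Q(ν x)]`, with `∞ = [1 : 0]`. -/
def IsPullbackOfRational {C : Type*} (ν : C → CP 2) (h : C → CP 1) : Prop :=
  ∃ (d : ℕ) (P Q : MvPolynomial (Fin 3) ℂ), P.IsHomogeneous d ∧ Q.IsHomogeneous d ∧
    ∃ S : Set C, S.Finite ∧ ∀ x ∉ S,
      ∃ hx : ![MvPolynomial.eval (ν x).rep P, MvPolynomial.eval (ν x).rep Q] ≠ 0,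
        h x = Projectivization.mk ℂ _ hx

/-- `ν` is a birational map from the compact Riemann surface `C` onto its image, a plane curve:
it is holomorphic, its image is an irreducible algebraic curve, it is one-to-one outside a
finite set, and every meromorphic function on `C` is the pullback of a rational function on the
image curve, i.e. pullback along `ν` is an isomorphism of function fields (it is always
injective). -/
structure IsBirationalOntoPlaneCurve {C : Type*} [TopologicalSpace C] [ChartedSpace ℂ C]
    (ν : C → CP 2) : Prop where
  holomorphic : IsHolomorphicToCP ν
  image_curve : IsIrreduciblePlaneCurve (Set.range ν)
  generically_injective : ∃ S : Set C, S.Finite ∧ ∀ x ∉ S, ∀ y, ν y = ν x → y = x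
  function_field : ∀ h : C → CP 1, IsHolomorphicToCP h → IsPullbackOfRational ν h

theorem mkQ_rep_ne_zero {p q : CP 2} (hq : q ≠ p) : p.submodule.mkQ q.rep ≠ 0 := by
  intro h
  rw [Submodule.mkQ_apply, Submodule.Quotient.mk_eq_zero, Projectivization.submodule_eq,
    Submodule.mem_span_singleton] at h
  obtain ⟨a, ha⟩ := h
  apply hq
  rw [← q.mk_rep, ← p.mk_rep, Projectivization.mk_eq_mk_iff']
  exact ⟨a, ha⟩

/-- Projection from `p`: the point `q ≠ p` goes to the line `pq`, a point of the pencil of lines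
through `p`. Lines through `p` are planes in `ℂ ^ 3` that contain the line `p`, i.e. lines in the
quotient `ℂ ^ 3 / p`, so the pencil is the projectivization of that quotient. -/
noncomputable def projectFrom (p q : CP 2) (hq : q ≠ p) :
    Projectivization ℂ ((Fin 3 → ℂ) ⧸ p.submodule) :=
  Projectivization.mk ℂ (p.submodule.mkQ q.rep) (mkQ_rep_ne_zero hq)

/-- `f = π_p ∘ ν`, for an identification of the pencil of lines through `p` with `CP 1` by a
projective isomorphism. The composition is defined outside the set `ν ⁻¹ {p}`, which has
to be finite, and a holomorphic `f` is then its unique continuous extension to all of `C`. -/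
def FactorsThroughProjection {C : Type*} (f : C → CP 1) (p : CP 2) (ν : C → CP 2) : Prop :=
  (ν ⁻¹' {p}).Finite ∧
    ∃ φ : ((Fin 3 → ℂ) ⧸ p.submodule) ≃ₗ[ℂ] (Fin 2 → ℂ),
      ∀ (x : C) (hx : ν x ≠ p),
        f x = Projectivization.map φ.toLinearMap φ.injective (projectFrom p (ν x) hx)

/-! Write `z` for the affine value of `f`. It suffices to find a second meromorphic function `g`
which separates the points of a general fibre of `f`, has no poles outside those of `f`, and has
poles of higher order than `f` there. Then `ν = [g : f : 1]` and `p = [1 : 0 : 0]` work: forgetting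
the first coordinate is the projection from `p`, and by the pole orders the curve meets the line at
infinity only in `p`.

The existence of `g` is the analytic core (`exists_dipole`, `exists_separating`). The function `z`
presents `C` as a branched covering, so functions on unramified sheets can be integrated against the
area measure pulled back from the plane. Integration by parts shows that `∂ψ/∂z` and `∂ψ/∂z̄` have
the same `L²` norm for test functions `ψ`. Hence `∂ψ/∂z̄ ↦ ∫ β ∂ψ/∂z` is bounded, and it extends by
Hahn–Banach; this replaces Dirichlet's principle. Take `β = ∂q/∂z̄`, where `q` is a truncation of `1
/ (w - b)` on one sheet. Subtracting the extension from `ψ ↦ ∫ (∂q/∂z) ψ` leaves a functional that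
kills every `∂ψ/∂z̄` away from `b`. Weyl's lemma, proved by testing on radial mollifiers, turns it
into a holomorphic function with a double pole at one chosen point over `b`. The `L²` bound controls
its growth near branch values and at infinity. A combination of such functions with distinct
coefficients separates the fibres near `b`; a polynomial in `z` removes the singularities over
finite values, and a power of `z` is added to create the required poles.

The rest is algebra. Symmetric functions of the values of `g` on the fibres are holomorphic off a
finite set and of polynomial growth, hence polynomials in `z` (`exists_polynomial_of_growth`). This
gives a monic equation `p (z, g) = 0`. It shows through a discriminant that separating one fibre
means separating almost all (`exists_discriminant`), and it expresses every meromorphic function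
rationally in `z` and `g` by Lagrange interpolation (`exists_interpolation_coeff`). If `p` factors,
one factor vanishes identically on `C` by the identity theorem and so already has all the roots over
a general point; thus `p` is irreducible, and so is its homogenization, whose zero set is the image
of `ν`. -/

/-- The Wirtinger derivative `∂φ/∂z`. -/
noncomputable def dz (φ : ℂ → ℂ) (w : ℂ) : ℂ :=
  (1 / 2) * (fderiv ℝ φ w 1 - Complex.I * fderiv ℝ φ w Complex.I)

/-- The Wirtinger derivative `∂φ/∂z̄`. -/
noncomputable def dzb (φ : ℂ → ℂ) (w : ℂ) : ℂ :=
  (1 / 2) * (fderiv ℝ φ w 1 + Complex.I * fderiv ℝ φ w Complex.I)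

/-! ### Wirtinger calculus and integration by parts in the plane. -/

section Wirtinger

open MeasureTheory Complex

theorem fderiv_apply_eq_dz_dzb (φ : ℂ → ℂ) (w η : ℂ) :
    fderiv ℝ φ w η = dz φ w * η + dzb φ w * (starRingEnd ℂ) η := by
  have h : η = (η.re : ℝ) • (1 : ℂ) + (η.im : ℝ) • I := by
    apply Complex.ext <;> simp
  have h1 : fderiv ℝ φ w η = η.re * fderiv ℝ φ w 1 + η.im * fderiv ℝ φ w I := by
    conv_lhs => rw [h]
    rw [map_add, map_smul, map_smul]
    simp
  have h2 : η = η.re + η.im * I := (Complex.re_add_im η).symm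
  have h3 : (starRingEnd ℂ) η = η.re - η.im * I := by
    apply Complex.ext <;> simp
  rw [h1, h3]
  conv_rhs => rw [h2]
  simp only [dz, dzb, Complex.add_re, Complex.add_im, Complex.ofReal_re, Complex.mul_re,
    Complex.ofReal_im, Complex.I_re, Complex.I_im, Complex.mul_im]
  push_cast
  linear_combination ((η.im : ℂ) * fderiv ℝ φ w I) * Complex.I_mul_I

theorem fderiv_star_comp {φ : ℂ → ℂ} {w : ℂ} (h : DifferentiableAt ℝ φ w) (v : ℂ) :
    fderiv ℝ (fun x => (starRingEnd ℂ) (φ x)) w v = (starRingEnd ℂ) (fderiv ℝ φ w v) := by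
  have : HasFDerivAt (fun x => (starRingEnd ℂ) (φ x))
      ((Complex.conjCLE : ℂ →L[ℝ] ℂ).comp (fderiv ℝ φ w)) w :=
    (Complex.conjCLE : ℂ →L[ℝ] ℂ).hasFDerivAt.comp w h.hasFDerivAt
  rw [this.fderiv]; simp

theorem conj_dz {φ : ℂ → ℂ} {w : ℂ} (h : DifferentiableAt ℝ φ w) :
    (starRingEnd ℂ) (dz φ w) = dzb (fun x => (starRingEnd ℂ) (φ x)) w := by
  simp only [dz, dzb, fderiv_star_comp h, map_mul, map_sub, Complex.conj_I,
    map_div₀, map_one, map_ofNat]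
  ring

theorem conj_dzb {φ : ℂ → ℂ} {w : ℂ} (h : DifferentiableAt ℝ φ w) :
    (starRingEnd ℂ) (dzb φ w) = dz (fun x => (starRingEnd ℂ) (φ x)) w := by
  simp only [dz, dzb, fderiv_star_comp h, map_mul, map_add, Complex.conj_I,
    map_div₀, map_one, map_ofNat]
  ring

theorem DifferentiableAt.dzb_eq_zero {φ : ℂ → ℂ} {w : ℂ} (h : DifferentiableAt ℂ φ w) :
    dzb φ w = 0 := by
  have : fderiv ℝ φ w = (fderiv ℂ φ w).restrictScalars ℝ :=
    (h.hasFDerivAt.restrictScalars ℝ).fderiv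
  have h2 : fderiv ℂ φ w I = I * fderiv ℂ φ w 1 := by
    rw [← smul_eq_mul, ← map_smul]; simp
  simp only [dzb, this, ContinuousLinearMap.coe_restrictScalars', h2]
  linear_combination (1/2 * fderiv ℂ φ w 1) * Complex.I_mul_I

theorem DifferentiableAt.dz_eq_deriv {φ : ℂ → ℂ} {w : ℂ} (h : DifferentiableAt ℂ φ w) :
    dz φ w = deriv φ w := by
  have : fderiv ℝ φ w = (fderiv ℂ φ w).restrictScalars ℝ :=
    (h.hasFDerivAt.restrictScalars ℝ).fderiv
  have h2 : fderiv ℂ φ w I = I * fderiv ℂ φ w 1 := by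
    rw [← smul_eq_mul, ← map_smul]; simp
  have h3 : fderiv ℂ φ w 1 = deriv φ w := by simp
  simp only [dz, this, ContinuousLinearMap.coe_restrictScalars', h2, h3]
  linear_combination (-1/2 * deriv φ w) * Complex.I_mul_I

theorem dz_eq_zero_of_notMem {φ : ℂ → ℂ} {w : ℂ} (h : w ∉ tsupport φ) : dz φ w = 0 := by
  have h' : w ∉ tsupport (fderiv ℝ φ) := fun h2 => h (tsupport_fderiv_subset ℝ h2)
  simp [dz, image_eq_zero_of_notMem_tsupport h']

theorem dzb_eq_zero_of_notMem {φ : ℂ → ℂ} {w : ℂ} (h : w ∉ tsupport φ) : dzb φ w = 0 := by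
  have h' : w ∉ tsupport (fderiv ℝ φ) := fun h2 => h (tsupport_fderiv_subset ℝ h2)
  simp [dzb, image_eq_zero_of_notMem_tsupport h']

theorem tsupport_dz_subset (φ : ℂ → ℂ) : tsupport (dz φ) ⊆ tsupport φ :=
  closure_minimal (fun _ hw => by_contra fun h => hw (dz_eq_zero_of_notMem h)) (isClosed_tsupport φ)

theorem tsupport_dzb_subset (φ : ℂ → ℂ) : tsupport (dzb φ) ⊆ tsupport φ :=
  closure_minimal (fun _ hw => by_contra fun h => hw (dzb_eq_zero_of_notMem h))
    (isClosed_tsupport φ)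

theorem ContDiffAt.fderiv_apply_const {φ : ℂ → ℂ} {w : ℂ} (h : ContDiffAt ℝ ∞ φ w) (v : ℂ) :
    ContDiffAt ℝ ∞ (fun x => fderiv ℝ φ x v) w :=
  (h.fderiv_right (m := ∞) (by simp)).clm_apply contDiffAt_const

theorem ContDiff.dz {φ : ℂ → ℂ} (h : ContDiff ℝ ∞ φ) : ContDiff ℝ ∞ (dz φ) := by
  rw [contDiff_iff_contDiffAt]
  intro w
  exact contDiffAt_const.mul ((h.contDiffAt.fderiv_apply_const 1).sub
    (contDiffAt_const.mul (h.contDiffAt.fderiv_apply_const I)))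

theorem ContDiff.dzb {φ : ℂ → ℂ} (h : ContDiff ℝ ∞ φ) : ContDiff ℝ ∞ (dzb φ) := by
  rw [contDiff_iff_contDiffAt]
  intro w
  exact contDiffAt_const.mul ((h.contDiffAt.fderiv_apply_const 1).add
    (contDiffAt_const.mul (h.contDiffAt.fderiv_apply_const I)))

/-- A product is integrable if the first factor is smooth with compact support and the second one
is continuous on that support. -/
theorem integrable_mul_of_tsupport {φ χ : ℂ → ℂ} (hφ : Continuous φ) (hc : HasCompactSupport φ)
    (hχ : ∀ w ∈ tsupport φ, ContinuousAt χ w) : Integrable (fun w => φ w * χ w) := by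
  have hsub : tsupport (fun w => φ w * χ w) ⊆ tsupport φ := tsupport_mul_subset_left
  refine Continuous.integrable_of_hasCompactSupport ?_ ?_
  · exact continuous_of_tsupport fun w hw => hφ.continuousAt.mul (hχ w (hsub hw))
  · exact HasCompactSupport.mul_right hc

/-- Moving the derivative off `φ` produces a second derivative of `χ`, which is symmetric.
Smoothness of `χ` is asked only on the support of `φ` because `χ` will later have a pole elsewhere.
-/
theorem integral_fderiv_mul_fderiv_comm {φ χ : ℂ → ℂ} (hφ : ContDiff ℝ ∞ φ)
    (hc : HasCompactSupport φ) (hχ : ∀ w ∈ tsupport φ, ContDiffAt ℝ ∞ χ w) (u v : ℂ) :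
    ∫ w, fderiv ℝ φ w u * fderiv ℝ χ w v = ∫ w, fderiv ℝ φ w v * fderiv ℝ χ w u := by
  have key : ∀ u v : ℂ, ∫ w, fderiv ℝ φ w u * fderiv ℝ χ w v =
      -∫ w, φ w * fderiv ℝ (fun x => fderiv ℝ χ x v) w u := by
    intro u v
    have hsub := tsupport_fderiv_apply_subset (f := φ) ℝ u
    rw [integral_mul_fderiv_eq_neg_fderiv_mul_of_integrable (f := φ)
      (g := fun x => fderiv ℝ χ x v) (v := u), neg_neg]
    · refine integrable_mul_of_tsupport
        ((contDiff_iff_contDiffAt.2 fun w => hφ.contDiffAt.fderiv_apply_const u).continuous)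
        (hc.of_isClosed_subset (isClosed_tsupport _) hsub)
        fun w hw => ((hχ w (hsub hw)).fderiv_apply_const v).continuousAt
    · exact integrable_mul_of_tsupport hφ.continuous hc fun w hw =>
        (((hχ w hw).fderiv_apply_const v).fderiv_apply_const u).continuousAt
    · exact integrable_mul_of_tsupport hφ.continuous hc fun w hw =>
        ((hχ w hw).fderiv_apply_const v).continuousAt
    · exact fun w _ => (hφ.differentiable (by simp)).differentiableAt
    · exact fun w hw => ((hχ w hw).fderiv_apply_const v).differentiableAt (by simp)
  rw [key u v, key v u]
  congr 1
  refine integral_congr_ae (Filter.Eventually.of_forall fun w => ?_)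
  by_cases hw : w ∈ tsupport φ
  · have hd : DifferentiableAt ℝ (fderiv ℝ χ) w :=
      ((hχ w hw).fderiv_right (m := ∞) (by simp)).differentiableAt (by simp)
    have h2 : ∀ a b : ℂ, fderiv ℝ (fun x => fderiv ℝ χ x a) w b = fderiv ℝ (fderiv ℝ χ) w b a := by
      intro a b
      rw [fderiv_clm_apply hd (by fun_prop)]
      simp
    have hs : IsSymmSndFDerivAt ℝ χ w := (hχ w hw).isSymmSndFDerivAt (by simp; exact ENat.LEInfty.out)
    simp only [h2, hs.eq u v]
  · simp [image_eq_zero_of_notMem_tsupport hw]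

/-- Integrating by parts twice exchanges the two Wirtinger derivatives. -/
theorem integral_dz_mul_dzb {φ χ : ℂ → ℂ} (hφ : ContDiff ℝ ∞ φ)
    (hc : HasCompactSupport φ) (hχ : ∀ w ∈ tsupport φ, ContDiffAt ℝ ∞ χ w) :
    ∫ w, dz φ w * dzb χ w = ∫ w, dzb φ w * dz χ w := by
  have hint : ∀ u v : ℂ, Integrable (fun w => fderiv ℝ φ w u * fderiv ℝ χ w v) := by
    intro u v
    have hsub := tsupport_fderiv_apply_subset (f := φ) ℝ u
    exact integrable_mul_of_tsupport
      ((contDiff_iff_contDiffAt.2 fun w => hφ.contDiffAt.fderiv_apply_const u).continuous)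
      (hc.of_isClosed_subset (isClosed_tsupport _) hsub)
      fun w hw => ((hχ w (hsub hw)).fderiv_apply_const v).continuousAt
  have e : ∀ w, dz φ w * dzb χ w = dzb φ w * dz χ w + (I / 2) *
      (fderiv ℝ φ w 1 * fderiv ℝ χ w I - fderiv ℝ φ w I * fderiv ℝ χ w 1) := by
    intro w; simp only [dz, dzb]; ring
  have hi : Integrable (fun w => dzb φ w * dz χ w) := by
    have : (fun w => dzb φ w * dz χ w) = fun w => (1 / 4 : ℂ) * (fderiv ℝ φ w 1 * fderiv ℝ χ w 1)
        + (-I / 4) * (fderiv ℝ φ w 1 * fderiv ℝ χ w I) + (I / 4) * (fderiv ℝ φ w I * fderiv ℝ χ w 1)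
        + (1 / 4 : ℂ) * (fderiv ℝ φ w I * fderiv ℝ χ w I) := by
      ext w; simp only [dz, dzb]
      linear_combination (- fderiv ℝ φ w I * fderiv ℝ χ w I / 4) * Complex.I_mul_I
    rw [this]
    exact ((((hint _ _).const_mul _).add ((hint _ _).const_mul _)).add ((hint _ _).const_mul _)).add
      ((hint _ _).const_mul _)
  simp_rw [e]
  have hi2 : Integrable fun w => (I / 2) *
      (fderiv ℝ φ w 1 * fderiv ℝ χ w I - fderiv ℝ φ w I * fderiv ℝ χ w 1) :=
    ((hint 1 I).sub (hint I 1)).const_mul _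
  rw [integral_add hi hi2, integral_const_mul,
    integral_sub (hint _ _) (hint _ _), integral_fderiv_mul_fderiv_comm hφ hc hχ I 1]
  simp

/-- In `L²` terms, `∂ψ/∂z̄ ↦ ∂ψ/∂z` is an isometry on test functions (the Beurling transform). It is
the source of the boundedness in the construction of dipoles. -/
theorem integral_conj_dz_mul_dz {φ χ : ℂ → ℂ} (hφ : ContDiff ℝ ∞ φ)
    (hc : HasCompactSupport φ) (hχ : ContDiff ℝ ∞ χ) :
    ∫ w, (starRingEnd ℂ) (dz φ w) * dz χ w = ∫ w, (starRingEnd ℂ) (dzb φ w) * dzb χ w := by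
  have hd : ∀ w, DifferentiableAt ℝ φ w := fun w => (hφ.differentiable (by simp)) w
  simp_rw [fun w => conj_dz (hd w), fun w => conj_dzb (hd w)]
  refine (integral_dz_mul_dzb ?_ ?_ fun w _ => hχ.contDiffAt).symm
  · exact (Complex.conjCLE : ℂ →L[ℝ] ℂ).contDiff.comp hφ
  · exact hc.comp_left (g := starRingEnd ℂ) (map_zero _)

end Wirtinger

/-! ### Weyl's lemma for functionals, by radial mollifiers. -/

section Mollifier

open MeasureTheory Complex Filter Topology Metric Asymptotics

/-- A smooth radial bump function supported in the closed unit disc. -/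
noncomputable def radialBump (w : ℂ) : ℂ := (expNegInvGlue (1 - Complex.normSq w) : ℝ)

/-- The rescaled bump function supported in the closed disc around `a` of radius `ε`. -/
noncomputable def mollifier (a : ℂ) (ε : ℝ) (w : ℂ) : ℂ :=
  ((ε : ℂ) ^ 2)⁻¹ * radialBump ((w - a) / ε)

theorem contDiff_normSq : ContDiff ℝ ∞ Complex.normSq := by
  have : (Complex.normSq : ℂ → ℝ) = fun w => ‖w‖ ^ 2 := by
    ext w; rw [Complex.normSq_eq_norm_sq]
  rw [this]
  exact contDiff_norm_sq ℝ

theorem contDiff_radialBump : ContDiff ℝ ∞ radialBump :=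
  Complex.ofRealCLM.contDiff.comp
    (expNegInvGlue.contDiff.comp (contDiff_const.sub contDiff_normSq))

theorem radialBump_eq_zero {w : ℂ} (h : 1 ≤ ‖w‖) : radialBump w = 0 := by
  rw [radialBump, expNegInvGlue.zero_of_nonpos, Complex.ofReal_zero]
  rw [Complex.normSq_eq_norm_sq]; nlinarith

theorem expNegInvGlue_le_one (x : ℝ) : expNegInvGlue x ≤ 1 := by
  unfold expNegInvGlue
  split_ifs with h
  · exact zero_le_one
  · rw [Real.exp_le_one_iff]
    have := inv_pos.2 (not_le.1 h)
    linarith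

theorem norm_radialBump_le (w : ℂ) : ‖radialBump w‖ ≤ 1 := by
  rw [radialBump, Complex.norm_real, Real.norm_of_nonneg (expNegInvGlue.nonneg _)]
  exact expNegInvGlue_le_one _

theorem contDiff_mollifier (a : ℂ) (ε : ℝ) : ContDiff ℝ ∞ (mollifier a ε) :=
  contDiff_const.mul (contDiff_radialBump.comp ((contDiff_id.sub contDiff_const).div_const _))

theorem mollifier_eq_zero {a : ℂ} {ε : ℝ} (hε : 0 < ε) {w : ℂ} (h : ε ≤ ‖w - a‖) :
    mollifier a ε w = 0 := by
  rw [mollifier, radialBump_eq_zero, mul_zero]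
  rw [norm_div, Complex.norm_real, Real.norm_of_nonneg hε.le, le_div_iff₀ hε]
  linarith

theorem norm_mollifier_le (a : ℂ) (ε : ℝ) (w : ℂ) : ‖mollifier a ε w‖ ≤ (ε ^ 2)⁻¹ := by
  rw [mollifier, norm_mul, norm_inv, norm_pow, Complex.norm_real, Real.norm_eq_abs, sq_abs]
  exact mul_le_of_le_one_right (by positivity) (norm_radialBump_le _)

theorem tsupport_mollifier_subset {a : ℂ} {ε : ℝ} (hε : 0 < ε) :
    tsupport (mollifier a ε) ⊆ closedBall a ε := by
  refine closure_minimal (fun w hw => ?_) isClosed_closedBall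
  by_contra h
  rw [mem_closedBall, dist_eq_norm, not_le] at h
  exact hw (mollifier_eq_zero hε h.le)

theorem hasCompactSupport_mollifier {a : ℂ} {ε : ℝ} (hε : 0 < ε) :
    HasCompactSupport (mollifier a ε) :=
  (isCompact_closedBall a ε).of_isClosed_subset (isClosed_tsupport _)
    (tsupport_mollifier_subset hε)

/-- The total mass of the bump function. -/
noncomputable def bumpMass : ℝ := ∫ w : ℂ, expNegInvGlue (1 - Complex.normSq w)

theorem bumpMass_pos : 0 < bumpMass := by
  have hc : Continuous fun w : ℂ => expNegInvGlue (1 - Complex.normSq w) :=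
    expNegInvGlue.contDiff (n := 0) |>.continuous.comp
      (continuous_const.sub contDiff_normSq.continuous)
  refine hc.integral_pos_of_hasCompactSupport_nonneg_nonzero ?_
    (fun w => expNegInvGlue.nonneg _) (x := 0) ?_
  · refine HasCompactSupport.intro (isCompact_closedBall (0 : ℂ) 1) fun w hw => ?_
    have := radialBump_eq_zero (w := w) (by
      rw [mem_closedBall, dist_zero_right, not_le] at hw; exact hw.le)
    exact Complex.ofReal_eq_zero.1 this
  · simp only [map_zero, sub_zero]
    exact (expNegInvGlue.pos_of_pos one_pos).ne'

theorem integral_radialBump : ∫ w, radialBump w = bumpMass := by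
  unfold radialBump bumpMass
  exact integral_ofReal

theorem integral_mollifier (a : ℂ) {ε : ℝ} (hε : 0 < ε) : ∫ w, mollifier a ε w = bumpMass := by
  unfold mollifier
  rw [integral_const_mul]
  rw [integral_sub_right_eq_self (fun w => radialBump (w / ε)) a]
  have : ∀ w : ℂ, radialBump (w / ε) = radialBump (ε⁻¹ • w) := by
    intro w; congr 1; rw [Complex.real_smul, div_eq_inv_mul]; push_cast; rfl
  simp_rw [this]
  rw [Measure.integral_comp_inv_smul, integral_radialBump, Complex.finrank_real_complex,
    abs_of_pos (by positivity), Complex.real_smul]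
  push_cast
  have : (ε : ℂ) ≠ 0 := by exact_mod_cast hε.ne'
  field_simp

/-- Differentiation under a functional that is bounded in the supremum norm on functions supported
in a fixed compact set. -/
theorem functional_sub_isLittleO {P : Type*} [NormedAddCommGroup P] [NormedSpace ℝ P]
    (L : (ℂ → ℂ) →ₗ[ℂ] ℂ) {K : Set ℂ} (hK : IsCompact K) {C : ℝ}
    (hL : ∀ ψ : ℂ → ℂ, Continuous ψ → (∀ w ∉ K, ψ w = 0) → ∀ M, (∀ w, ‖ψ w‖ ≤ M) →
      ‖L ψ‖ ≤ C * M)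
    {Φ : P → ℂ → ℂ} {D : P → ℂ → P →L[ℝ] ℂ} {p₀ : P} {δ : ℝ} (hδ : 0 < δ)
    (hΦc : ∀ p ∈ ball p₀ δ, Continuous (Φ p))
    (hD : ∀ p ∈ ball p₀ δ, ∀ w, HasFDerivAt (fun q => Φ q w) (D p w) p)
    (hDc : ContinuousOn (fun x : P × ℂ => D x.1 x.2) (ball p₀ δ ×ˢ Set.univ))
    (hsupp : ∀ p ∈ ball p₀ δ, ∀ w ∉ K, Φ p w = 0) :
    (fun p => L (Φ p) - L (Φ p₀) - L (fun w => D p₀ w (p - p₀))) =o[𝓝 p₀] fun p => p - p₀ := by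
  have hp₀ : p₀ ∈ ball p₀ δ := mem_ball_self hδ
  have hD0 : ∀ w ∉ K, D p₀ w = 0 := by
    intro w hw
    have h1 := hD p₀ hp₀ w
    have h2 : HasFDerivAt (fun q => Φ q w) (0 : P →L[ℝ] ℂ) p₀ := by
      refine (hasFDerivAt_const (0 : ℂ) p₀).congr_of_eventuallyEq ?_
      filter_upwards [ball_mem_nhds p₀ hδ] with p hp using hsupp p hp w hw
    exact h1.unique h2
  rw [isLittleO_iff]
  intro η hη
  have hC : 0 < |C| + 1 := by positivity
  -- Compactness of `K` makes `D p w` close to `D p₀ w` uniformly in `w`, so the mean value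
  -- inequality bounds the Taylor remainder in the supremum norm. The `+ 1` keeps the denominator
  -- positive.
  obtain ⟨v, hv, hvb⟩ := hK.mem_uniformity_of_prod (f := fun p w => D p w) (s := ball p₀ δ)
    (hDc.mono (Set.prod_mono subset_rfl (Set.subset_univ _))) hp₀
    (dist_mem_uniformity (show 0 < η / (|C| + 1) by positivity))
  rw [isOpen_ball.nhdsWithin_eq hp₀] at hv
  obtain ⟨δ', hδ', hsub⟩ := Metric.mem_nhds_iff.1 hv
  filter_upwards [ball_mem_nhds p₀ (lt_min hδ hδ')] with p hp
  have hsegδ : ball p₀ (min δ δ') ⊆ ball p₀ δ := ball_subset_ball (min_le_left _ _)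
  have hsegδ' : ball p₀ (min δ δ') ⊆ v := (ball_subset_ball (min_le_right _ _)).trans hsub
  set R : ℂ → ℂ := fun w => Φ p w - Φ p₀ w - D p₀ w (p - p₀) with hR
  have hRL : L R = L (Φ p) - L (Φ p₀) - L (fun w => D p₀ w (p - p₀)) := by
    rw [← map_sub, ← map_sub]; rfl
  have hRc : Continuous R := by
    have h3 : Continuous fun w => D p₀ w := by
      rw [← continuousOn_univ]
      exact hDc.comp (f := fun w : ℂ => (p₀, w)) (by fun_prop) fun w _ => ⟨hp₀, Set.mem_univ _⟩
    exact ((hΦc p (hsegδ hp)).sub (hΦc p₀ hp₀)).sub (h3.clm_apply continuous_const)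
  have hRs : ∀ w ∉ K, R w = 0 := by
    intro w hw
    simp [hR, hsupp p (hsegδ hp) w hw, hsupp p₀ hp₀ w hw, hD0 w hw]
  have hRb : ∀ w, ‖R w‖ ≤ η / (|C| + 1) * ‖p - p₀‖ := by
    intro w
    by_cases hw : w ∈ K
    · refine (convex_ball p₀ (min δ δ')).norm_image_sub_le_of_norm_hasFDerivWithin_le'
        (f := fun q => Φ q w) (f' := fun q => D q w)
        (fun q hq => (hD q (hsegδ hq) w).hasFDerivWithinAt) (fun q hq => ?_)
        (mem_ball_self (lt_min hδ hδ')) hp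
      have := hvb q (hsegδ' hq) w hw
      rw [Set.mem_ofPred_eq, dist_eq_norm] at this
      exact this.le
    · rw [hRs w hw, norm_zero]; positivity
  rw [← hRL]
  calc ‖L R‖ ≤ C * (η / (|C| + 1) * ‖p - p₀‖) := hL R hRc hRs _ hRb
    _ ≤ (|C| + 1) * (η / (|C| + 1) * ‖p - p₀‖) := by
        gcongr
        linarith [le_abs_self C]
    _ = η * ‖p - p₀‖ := by field_simp

/-- A linear functional on functions of one complex variable that on the open set `D` is continuous
of order zero and annihilates all `∂ψ/∂z̄`. -/
structure IsWeaklyHolomorphicOn (L : (ℂ → ℂ) →ₗ[ℂ] ℂ) (D : Set ℂ) : Prop where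
  bound : ∀ K ⊆ D, IsCompact K → ∃ C, ∀ ψ : ℂ → ℂ, Continuous ψ → (∀ w ∉ K, ψ w = 0) →
    ∀ M, (∀ w, ‖ψ w‖ ≤ M) → ‖L ψ‖ ≤ C * M
  dzb_eq_zero : ∀ ψ : ℂ → ℂ, ContDiff ℝ ∞ ψ → HasCompactSupport ψ → tsupport ψ ⊆ D → L (dzb ψ) = 0

/-- Moving the centre by `η` changes the mollifier to first order by minus `∂/∂z` times `η` and
minus `∂/∂z̄` times the conjugate of `η`. The functional kills the second term, so the real
derivative of the pairing is complex linear. -/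
theorem IsWeaklyHolomorphicOn.differentiableAt {L : (ℂ → ℂ) →ₗ[ℂ] ℂ} {D : Set ℂ}
    (hL : IsWeaklyHolomorphicOn L D) {a : ℂ} {ε : ℝ} (hε : 0 < ε) {ε' : ℝ} (hε' : ε < ε')
    (ha : closedBall a ε' ⊆ D) :
    DifferentiableAt ℂ (fun b => L (mollifier b ε)) a := by
  obtain ⟨C, hC⟩ := hL.bound _ ha (isCompact_closedBall a ε')
  have hsm : ∀ w : ℂ, DifferentiableAt ℝ (mollifier 0 ε) w := fun w =>
    ((contDiff_mollifier 0 ε).differentiable (by simp)) w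
  have hshift : ∀ b w, mollifier b ε w = mollifier 0 ε (w - b) := by
    intro b w; simp [mollifier]
  have hfd : ∀ w, fderiv ℝ (mollifier 0 ε) (w - a) = fderiv ℝ (mollifier a ε) w := by
    intro w
    have : mollifier a ε = fun w => mollifier 0 ε (w - a) := by ext w; exact hshift a w
    rw [this, fderiv_comp_sub]
  have key := functional_sub_isLittleO L (isCompact_closedBall a ε') hC
    (Φ := fun b w => mollifier b ε w) (D := fun b w => -(fderiv ℝ (mollifier 0 ε) (w - b)))
    (p₀ := a) (δ := ε' - ε) (by linarith)
    (fun p _ => (contDiff_mollifier p ε).continuous)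
    (fun p _ w => by
      have h1 : HasFDerivAt (fun q : ℂ => w - q) (-(ContinuousLinearMap.id ℝ ℂ)) p :=
        (hasFDerivAt_id p).const_sub w
      have h2 := ((hsm (w - p)).hasFDerivAt).comp p h1
      have h3 : (fderiv ℝ (mollifier 0 ε) (w - p)).comp (-(ContinuousLinearMap.id ℝ ℂ)) =
          -(fderiv ℝ (mollifier 0 ε) (w - p)) := by ext v; simp
      rw [h3] at h2
      exact h2.congr_of_eventuallyEq (Eventually.of_forall fun q => hshift q w))
    (by
      have : Continuous (fderiv ℝ (mollifier 0 ε)) :=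
        (contDiff_mollifier 0 ε).continuous_fderiv (by simp)
      exact (this.comp (by fun_prop)).neg.continuousOn)
    (fun p hp w hw => by
      refine mollifier_eq_zero hε ?_
      rw [mem_closedBall, not_le, dist_eq_norm] at hw
      rw [mem_ball, dist_eq_norm] at hp
      have : ‖w - a‖ ≤ ‖w - p‖ + ‖p - a‖ := by
        have := norm_add_le (w - p) (p - a); simpa using this
      linarith)
  have hsub : tsupport (mollifier a ε) ⊆ D :=
    (tsupport_mollifier_subset hε).trans ((closedBall_subset_closedBall hε'.le).trans ha)
  have hz := hL.dzb_eq_zero _ (contDiff_mollifier a ε) (hasCompactSupport_mollifier hε) hsub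
  refine (hasDerivAt_iff_isLittleO.2 ?_ : HasDerivAt _ (-(L (dz (mollifier a ε)))) a).differentiableAt
  refine key.congr_left fun b => ?_
  congr 1
  have : (fun w => (-(fderiv ℝ (mollifier 0 ε) (w - a))) (b - a)) =
      (-(b - a)) • dz (mollifier a ε) + (-(starRingEnd ℂ) (b - a)) • dzb (mollifier a ε) := by
    ext w
    simp only [neg_apply, hfd, fderiv_apply_eq_dz_dzb, Pi.add_apply, Pi.smul_apply, smul_eq_mul]
    ring
  rw [this, map_add, map_smul, map_smul, hz]
  simp only [smul_eq_mul]
  ring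

/-- The total mass does not depend on the scale, so the scale derivative is a divergence, namely
that of `-(w - a) ε⁻³` times the bump. The bump being real and radial, this divergence is also a
`∂/∂z̄` of a function with compact support, on which a weakly holomorphic functional vanishes. -/
theorem hasDerivAt_mollifier_scale (a w : ℂ) {ε : ℝ} (hε : 0 < ε) :
    HasDerivAt (fun t : ℝ => mollifier a t w)
      (dzb (fun x => -2 * ((ε : ℂ) ^ 3)⁻¹ * ((starRingEnd ℂ) (x - a) * radialBump ((x - a) / ε))) w)
      ε := by
  have hε0 : (ε : ℂ) ≠ 0 := by exact_mod_cast hε.ne'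
  set u : ℂ := (w - a) / ε with hu
  set s : ℝ := 1 - Complex.normSq u with hs
  have hg : Differentiable ℝ expNegInvGlue := (expNegInvGlue.contDiff (n := 1)).differentiable (by simp)
  set g' : ℝ := deriv expNegInvGlue s with hg'
  have hns : ∀ v : ℂ, ∀ η : ℂ, HasFDerivAt (fun x : ℂ => radialBump x) (fderiv ℝ radialBump v) v :=
    fun v η => ((contDiff_radialBump.differentiable (by simp)) v).hasFDerivAt
  have hnsq : HasFDerivAt (fun x : ℂ => Complex.normSq x)
      (2 • (innerSL ℝ u)) u := by
    have h := (hasStrictFDerivAt_norm_sq u).hasFDerivAt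
    refine h.congr_of_eventuallyEq (Eventually.of_forall fun x => ?_)
    simp [Complex.normSq_eq_norm_sq]
  have hrb : HasFDerivAt radialBump
      (Complex.ofRealCLM.comp (g' • (-(2 • (innerSL ℝ u))))) u := by
    have h1 : HasFDerivAt (fun x : ℂ => 1 - Complex.normSq x) (-(2 • (innerSL ℝ u))) u :=
      hnsq.const_sub 1
    have h2 := ((hg s).hasDerivAt).comp_hasFDerivAt u h1
    exact Complex.ofRealCLM.hasFDerivAt.comp u h2
  have hval : ∀ η : ℂ, fderiv ℝ radialBump u η = -2 * g' * (u.re * η.re + u.im * η.im) := by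
    intro η
    rw [hrb.fderiv]
    simp [Complex.inner]
    ring
  -- the derivative in the scale
  have h1 : HasDerivAt (fun t : ℝ => (w - a) / (t : ℂ)) (-(w - a) / (ε : ℂ) ^ 2) ε := by
    have : HasDerivAt (fun t : ℝ => (t : ℂ)) 1 ε := Complex.ofRealCLM.hasDerivAt
    have := (hasDerivAt_const ε (w - a)).fun_div this hε0
    convert! this using 1
    simp
  have h2 : HasDerivAt (fun t : ℝ => radialBump ((w - a) / (t : ℂ)))
      (fderiv ℝ radialBump u (-(w - a) / (ε : ℂ) ^ 2)) ε :=
    HasFDerivAt.comp_hasDerivAt (f := fun t : ℝ => (w - a) / (t : ℂ)) ε (hns u 0) h1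
  have h3 : HasDerivAt (fun t : ℝ => ((t : ℂ) ^ 2)⁻¹) (-(2 * (ε : ℂ)) / ((ε : ℂ) ^ 2) ^ 2) ε := by
    have : HasDerivAt (fun t : ℝ => (t : ℂ)) 1 ε := Complex.ofRealCLM.hasDerivAt
    convert! (this.fun_pow 2).fun_inv (pow_ne_zero 2 hε0) using 1
    simp
  have h4 := h3.fun_mul h2
  -- the Wirtinger derivative
  have h5 : HasFDerivAt (fun x : ℂ => radialBump ((x - a) / ε))
      ((fderiv ℝ radialBump u).comp ((ε⁻¹ : ℝ) • ContinuousLinearMap.id ℝ ℂ)) w := by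
    have : HasFDerivAt (fun x : ℂ => (x - a) / (ε : ℂ)) ((ε⁻¹ : ℝ) • ContinuousLinearMap.id ℝ ℂ) w := by
      have := ((hasFDerivAt_id (𝕜 := ℝ) w).sub_const a).const_smul (ε⁻¹ : ℝ)
      refine this.congr_of_eventuallyEq (Eventually.of_forall fun x => ?_)
      simp [div_eq_inv_mul]
    exact (hns u 0).comp w this
  have h6 : HasFDerivAt (fun x : ℂ => (starRingEnd ℂ) (x - a)) (Complex.conjCLE : ℂ →L[ℝ] ℂ) w := by
    exact (Complex.conjCLE : ℂ →L[ℝ] ℂ).hasFDerivAt.comp w ((hasFDerivAt_id (𝕜 := ℝ) w).sub_const a)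
  have h7 := (h6.fun_mul h5).const_mul (-2 * ((ε : ℂ) ^ 3)⁻¹)
  have hw : w - a = ε * u := by rw [hu]; field_simp
  convert! h4 using 1
  rw [dzb, h7.fderiv]
  have e1 : -(w - a) / (ε : ℂ) ^ 2 = ((-ε⁻¹ : ℝ) : ℂ) * u := by
    rw [hw]; push_cast; field_simp
  have e2 : ((-ε⁻¹ : ℝ) : ℂ) * u = (-ε⁻¹ : ℝ) • u := (Complex.real_smul).symm
  rw [e1, e2, map_smul]
  simp only [add_apply, smul_apply, ContinuousLinearMap.comp_apply, ContinuousLinearMap.id_apply,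
    hval, hw, ContinuousLinearEquiv.coe_coe, Complex.conjCLE_apply, map_one,
    Complex.conj_I, Complex.real_smul, smul_eq_mul, map_mul, Complex.conj_ofReal]
  have hu2 : u = u.re + u.im * I := (Complex.re_add_im u).symm
  have hu3 : (starRingEnd ℂ) u = u.re - u.im * I := by
    apply Complex.ext <;> simp
  rw [hu3]
  simp only [Complex.re_ofReal_mul, Complex.im_ofReal_mul, Complex.one_re, Complex.one_im,
    Complex.I_re, Complex.I_im]
  push_cast
  field_simp
  ring_nf
  simp only [Complex.I_sq]
  ring

/-- The same derivative in a form whose joint continuity in scale and point can be read off. -/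
theorem hasDerivAt_mollifier_scale' (a w : ℂ) {ε : ℝ} (hε : 0 < ε) :
    HasDerivAt (fun t : ℝ => mollifier a t w)
      (-(2 * (ε : ℂ)) / ((ε : ℂ) ^ 2) ^ 2 * radialBump ((w - a) / ε) +
        ((ε : ℂ) ^ 2)⁻¹ * (fderiv ℝ radialBump ((w - a) / ε) (-(w - a) / (ε : ℂ) ^ 2))) ε := by
  have hε0 : (ε : ℂ) ≠ 0 := by exact_mod_cast hε.ne'
  have h0 : HasDerivAt (fun t : ℝ => (t : ℂ)) 1 ε := Complex.ofRealCLM.hasDerivAt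
  have h1 : HasDerivAt (fun t : ℝ => (w - a) / (t : ℂ)) (-(w - a) / (ε : ℂ) ^ 2) ε := by
    convert! (hasDerivAt_const ε (w - a)).fun_div h0 hε0 using 1
    simp
  have h2 : HasDerivAt (fun t : ℝ => radialBump ((w - a) / (t : ℂ)))
      (fderiv ℝ radialBump ((w - a) / ε) (-(w - a) / (ε : ℂ) ^ 2)) ε :=
    HasFDerivAt.comp_hasDerivAt (f := fun t : ℝ => (w - a) / (t : ℂ)) ε
      ((contDiff_radialBump.differentiable (by simp)) _).hasFDerivAt h1
  have h3 : HasDerivAt (fun t : ℝ => ((t : ℂ) ^ 2)⁻¹) (-(2 * (ε : ℂ)) / ((ε : ℂ) ^ 2) ^ 2) ε := by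
    convert! (h0.fun_pow 2).fun_inv (pow_ne_zero 2 hε0) using 1
    simp
  exact h3.fun_mul h2

/-- The mean value property: the scale derivative of the pairing is zero. It allows the pairing with
a mollifier of any small radius to serve as the value of the functional at `a`. -/
theorem IsWeaklyHolomorphicOn.mollifier_eq {L : (ℂ → ℂ) →ₗ[ℂ] ℂ} {D : Set ℂ}
    (hL : IsWeaklyHolomorphicOn L D) {a : ℂ} {R : ℝ} (ha : closedBall a R ⊆ D) {ε ε' : ℝ}
    (hε : ε ∈ Set.Ioo 0 R) (hε' : ε' ∈ Set.Ioo 0 R) :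
    L (mollifier a ε) = L (mollifier a ε') := by
  obtain ⟨C, hC⟩ := hL.bound _ ha (isCompact_closedBall a R)
  have hder : ∀ t ∈ Set.Ioo 0 R, HasDerivAt (fun s : ℝ => L (mollifier a s)) 0 t := by
    intro t ht
    have hball : ball t (min t (R - t)) ⊆ Set.Ioo 0 R := by
      intro s hs
      rw [mem_ball, Real.dist_eq, abs_lt, lt_min_iff] at hs
      have h1 := hs.1
      have h2 : -t ≤ -min t (R - t) := neg_le_neg (min_le_left _ _)
      exact ⟨by linarith, by linarith [hs.2.2]⟩
    have key := functional_sub_isLittleO L (isCompact_closedBall a R) hC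
      (Φ := fun s w => mollifier a s w)
      (D := fun t w => ContinuousLinearMap.toSpanSingleton ℝ
        (-(2 * (t : ℂ)) / ((t : ℂ) ^ 2) ^ 2 * radialBump ((w - a) / t) +
        ((t : ℂ) ^ 2)⁻¹ * (fderiv ℝ radialBump ((w - a) / t) (-(w - a) / (t : ℂ) ^ 2))))
      (p₀ := t) (δ := min t (R - t)) (lt_min ht.1 (by linarith [ht.2]))
      (fun p _ => (contDiff_mollifier a p).continuous)
      (fun p hp w => (hasDerivAt_mollifier_scale' a w (hball hp).1).hasFDerivAt)
      (by
        have h1 : Continuous (fderiv ℝ radialBump) :=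
          contDiff_radialBump.continuous_fderiv (by simp)
        have h2 := contDiff_radialBump.continuous
        have h3 : ∀ x ∈ ball t (min t (R - t)) ×ˢ (Set.univ : Set ℂ), ((x.1 : ℝ) : ℂ) ≠ 0 := by
          intro x hx
          exact_mod_cast (hball hx.1).1.ne'
        have hc : ContinuousOn (fun x : ℝ × ℂ => ((x.1 : ℝ) : ℂ))
            (ball t (min t (R - t)) ×ˢ Set.univ) := by fun_prop
        have hq : ContinuousOn (fun x : ℝ × ℂ => (x.2 - a) / ((x.1 : ℝ) : ℂ))
            (ball t (min t (R - t)) ×ˢ Set.univ) :=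
          ContinuousOn.div (by fun_prop) hc h3
        have hq2 : ContinuousOn (fun x : ℝ × ℂ => -(x.2 - a) / ((x.1 : ℝ) : ℂ) ^ 2)
            (ball t (min t (R - t)) ×ˢ Set.univ) :=
          ContinuousOn.div (by fun_prop) (hc.pow 2) fun x hx => pow_ne_zero 2 (h3 x hx)
        have hs : ContinuousOn (fun x : ℝ × ℂ =>
            (-(2 * (x.1 : ℂ)) / ((x.1 : ℂ) ^ 2) ^ 2 * radialBump ((x.2 - a) / x.1) +
            ((x.1 : ℂ) ^ 2)⁻¹ *
              (fderiv ℝ radialBump ((x.2 - a) / x.1) (-(x.2 - a) / (x.1 : ℂ) ^ 2))))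
            (ball t (min t (R - t)) ×ˢ Set.univ) := by
          refine ContinuousOn.add (ContinuousOn.mul (ContinuousOn.div (by fun_prop)
            ((hc.pow 2).pow 2) fun x hx => pow_ne_zero 2 (pow_ne_zero 2 (h3 x hx)))
            (h2.comp_continuousOn hq)) (ContinuousOn.mul ((hc.pow 2).inv₀ fun x hx =>
              pow_ne_zero 2 (h3 x hx)) ((h1.comp_continuousOn hq).clm_apply hq2))
        exact (ContinuousLinearMap.toSpanSingletonCLE (𝕜 := ℝ) (E := ℂ)).continuous.comp_continuousOn hs)
      (fun p hp w hw => by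
        refine mollifier_eq_zero (hball hp).1 ?_
        rw [mem_closedBall, not_le, dist_eq_norm] at hw
        linarith [(hball hp).2])
    rw [hasDerivAt_iff_isLittleO]
    refine key.congr_left fun b => ?_
    congr 1
    set u : ℂ → ℂ := fun x => -2 * ((t : ℂ) ^ 3)⁻¹ *
      ((starRingEnd ℂ) (x - a) * radialBump ((x - a) / t)) with hu
    have hue : ∀ w, w ∉ closedBall a t → u w = 0 := by
      intro w hw
      have : radialBump ((w - a) / t) = 0 := by
        refine radialBump_eq_zero ?_
        rw [mem_closedBall, not_le, dist_eq_norm] at hw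
        rw [norm_div, Complex.norm_real, Real.norm_of_nonneg ht.1.le, le_div_iff₀ ht.1]
        linarith
      simp [hu, this]
    have hts : tsupport u ⊆ closedBall a t :=
      closure_minimal (fun w hw => by_contra fun h => hw (hue w h)) isClosed_closedBall
    have hz : L (dzb u) = 0 := by
      refine hL.dzb_eq_zero u ?_ ?_ ?_
      · refine contDiff_const.mul (ContDiff.mul ?_ (contDiff_radialBump.comp
          ((contDiff_id.sub contDiff_const).div_const _)))
        exact (Complex.conjCLE : ℂ →L[ℝ] ℂ).contDiff.comp (contDiff_id.sub contDiff_const)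
      · exact (isCompact_closedBall a t).of_isClosed_subset (isClosed_tsupport _) hts
      · exact hts.trans ((closedBall_subset_closedBall ht.2.le).trans ha)
    have : (fun w => (ContinuousLinearMap.toSpanSingleton ℝ
        (-(2 * (t : ℂ)) / ((t : ℂ) ^ 2) ^ 2 * radialBump ((w - a) / t) +
        ((t : ℂ) ^ 2)⁻¹ * (fderiv ℝ radialBump ((w - a) / t) (-(w - a) / (t : ℂ) ^ 2)))) (b - t)) =
        ((b - t : ℝ) : ℂ) • dzb u := by
      ext w
      rw [(hasDerivAt_mollifier_scale' a w ht.1).unique (hasDerivAt_mollifier_scale a w ht.1)]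
      simp [hu]
    rw [this, map_smul, hz, smul_zero, smul_zero]
  refine isOpen_Ioo.is_const_of_deriv_eq_zero isPreconnected_Ioo
    (fun t ht => (hder t ht).differentiableAt.differentiableWithinAt)
    (fun t ht => (hder t ht).deriv) hε hε'

end Mollifier

/-! ### Sheets of the covering, integration over them, and the Hahn–Banach extension. -/

section Sheets

open MeasureTheory Complex Filter Topology Metric

/-- `σ` is a continuous section of `z` on the convex open set `D`, through points near which `z` is
injective. -/
structure IsSheet {C : Type*} [TopologicalSpace C] (z : C → ℂ) (D : Set ℂ) (σ : ℂ → C) : Prop where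
  isOpen : IsOpen D
  convex : Convex ℝ D
  cont : ContinuousOn σ D
  sec : ∀ w ∈ D, z (σ w) = w
  inj : ∀ w ∈ D, ∃ U ∈ 𝓝 (σ w), Set.InjOn z U

open Classical in
/-- The function `φ ∘ z` on the sheet `σ D`, extended by zero. -/
noncomputable def sheetLift {C : Type*} (z : C → ℂ) (D : Set ℂ) (σ : ℂ → C) :
    (ℂ → ℂ) →ₗ[ℂ] (C → ℂ) where
  toFun φ y := if z y ∈ D ∧ σ (z y) = y then φ (z y) else 0
  map_add' φ ψ := by ext y; simp only [Pi.add_apply]; split_ifs <;> simp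
  map_smul' c φ := by
    ext y; simp only [Pi.smul_apply, RingHom.id_apply]; split_ifs <;> simp

open Classical in
theorem sheetLift_apply {C : Type*} (z : C → ℂ) (D : Set ℂ) (σ : ℂ → C) (φ : ℂ → ℂ) (y : C) :
    sheetLift z D σ φ y = if z y ∈ D ∧ σ (z y) = y then φ (z y) else 0 := rfl

variable {C : Type*} [TopologicalSpace C] {z : C → ℂ}

theorem IsSheet.mono {D D' : Set ℂ} {σ : ℂ → C} (h : IsSheet z D σ) (ho : IsOpen D')
    (hc : Convex ℝ D') (hsub : D' ⊆ D) : IsSheet z D' σ :=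
  ⟨ho, hc, h.cont.mono hsub, fun w hw => h.sec w (hsub hw), fun w hw => h.inj w (hsub hw)⟩

/-- Uniqueness of lifts: local injectivity of `z` makes the locus of agreement open, the Hausdorff
property makes it closed, and convexity makes `D ∩ D'` connected. -/
theorem IsSheet.agree [T2Space C] {D D' : Set ℂ} {σ σ' : ℂ → C} (h : IsSheet z D σ)
    (h' : IsSheet z D' σ') {w₀ : ℂ} (hw₀ : w₀ ∈ D ∩ D') (he : σ w₀ = σ' w₀) :
    ∀ w ∈ D ∩ D', σ w = σ' w := by
  classical
  have hpre : IsPreconnected (D ∩ D') := (h.convex.inter h'.convex).isPreconnected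
  have hopen : IsOpen (D ∩ D') := h.isOpen.inter h'.isOpen
  have hcont : ContinuousOn (fun w => decide (σ w = σ' w)) (D ∩ D') := by
    intro w hw
    have hσ : ContinuousAt σ w := (h.cont).continuousAt (h.isOpen.mem_nhds hw.1)
    have hσ' : ContinuousAt σ' w := (h'.cont).continuousAt (h'.isOpen.mem_nhds hw.2)
    have : (fun w => decide (σ w = σ' w)) =ᶠ[𝓝 w] fun _ => decide (σ w = σ' w) := by
      by_cases hww : σ w = σ' w
      · obtain ⟨U, hU, hinj⟩ := h.inj w hw.1
        have hU' : U ∈ 𝓝 (σ' w) := hww ▸ hU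
        filter_upwards [hσ hU, hσ' hU', hopen.mem_nhds hw] with v h1 h2 h3
        have : σ v = σ' v := hinj h1 h2 (by rw [h.sec v h3.1, h'.sec v h3.2])
        simp [this, hww]
      · obtain ⟨U, V, hU, hV, hσU, hσV, hd⟩ := t2_separation hww
        filter_upwards [hσ (hU.mem_nhds hσU), hσ' (hV.mem_nhds hσV)] with v h1 h2
        have : σ v ≠ σ' v := fun h3 => hd.le_bot ⟨h1, by rw [h3]; exact h2⟩
        simp [this, hww]
    exact (continuousAt_const.congr this.symm).continuousWithinAt
  intro w hw
  have := hpre.constant hcont hw hw₀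
  simpa [he] using this

/-- Sum of a function over the fibre of `z`. -/
noncomputable def fiberSum (hfin : ∀ w, (z ⁻¹' {w}).Finite) (F : C → ℂ) (w : ℂ) : ℂ :=
  ∑ y ∈ (hfin w).toFinset, F y

variable (hfin : ∀ w, (z ⁻¹' {w}).Finite)

open Classical in
theorem IsSheet.fiberSum_mul {D : Set ℂ} {σ : ℂ → C} (h : IsSheet z D σ) (φ : ℂ → ℂ) (G : C → ℂ)
    (w : ℂ) : fiberSum hfin (fun y => sheetLift z D σ φ y * G y) w =
      if w ∈ D then φ w * G (σ w) else 0 := by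
  rw [fiberSum]
  split_ifs with hw
  · rw [Finset.sum_eq_single (σ w)]
    · simp [sheetLift_apply, h.sec w hw, hw]
    · intro y hy hne
      have hy' : z y = w := by simpa using hy
      rw [sheetLift_apply, if_neg, zero_mul]
      rintro ⟨-, h2⟩
      exact hne (by rw [← h2, hy'])
    · intro hn
      exact absurd (by simpa using h.sec w hw) hn
  · refine Finset.sum_eq_zero fun y hy => ?_
    have hy' : z y = w := by simpa using hy
    rw [sheetLift_apply, if_neg, zero_mul]
    rintro ⟨h1, -⟩
    exact hw (hy' ▸ h1)

open Classical in
/-- `1` if the two sheets share a point and `0` otherwise. -/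
noncomputable def overlap (D D' : Set ℂ) (σ σ' : ℂ → C) : ℂ :=
  if ∃ w ∈ D ∩ D', σ w = σ' w then 1 else 0

/-- Two sheets coincide or are disjoint over all of `D ∩ D'`, so every pairing of lifts is a plane
integral times a constant `0` or `1`. -/
theorem IsSheet.fiberSum_mul_sheetLift [T2Space C] {D D' : Set ℂ} {σ σ' : ℂ → C}
    (h : IsSheet z D σ) (h' : IsSheet z D' σ') {φ φ' : ℂ → ℂ}
    (hφ : ∀ w ∉ D, φ w = 0) (hφ' : ∀ w ∉ D', φ' w = 0) (w : ℂ) :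
    fiberSum hfin (fun y => sheetLift z D σ φ y * sheetLift z D' σ' φ' y) w =
      overlap D D' σ σ' * (φ w * φ' w) := by
  classical
  rw [h.fiberSum_mul]
  by_cases hw : w ∈ D
  · by_cases hw' : w ∈ D'
    · rw [if_pos hw, sheetLift_apply, h.sec w hw]
      by_cases he : σ' w = σ w
      · rw [if_pos ⟨hw', he⟩, overlap, if_pos ⟨w, ⟨hw, hw'⟩, he.symm⟩, one_mul]
      · rw [if_neg (fun h => he h.2), overlap, if_neg, zero_mul, mul_zero]
        rintro ⟨v, hv, hve⟩
        exact he (h.agree h' hv hve w ⟨hw, hw'⟩).symm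
    · rw [if_pos hw, sheetLift_apply, h.sec w hw, if_neg (fun h => hw' h.1), hφ' w hw']
      simp
  · rw [if_neg hw, hφ w hw]; simp

theorem sheetLift_congr [T2Space C] {D D' : Set ℂ} {σ σ' : ℂ → C}
    (h : IsSheet z D σ) (h' : IsSheet z D' σ') {w₀ : ℂ} (hw₀ : w₀ ∈ D ∩ D') (he : σ w₀ = σ' w₀)
    {φ : ℂ → ℂ} (hφ : ∀ w ∉ D ∩ D', φ w = 0) : sheetLift z D σ φ = sheetLift z D' σ' φ := by
  classical
  ext y
  rw [sheetLift_apply, sheetLift_apply]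
  by_cases hy : z y ∈ D ∩ D'
  · simp [hy.1, hy.2, h.agree h' hw₀ he _ hy]
  · simp [hφ _ hy]

theorem conj_sheetLift {C : Type*} {z : C → ℂ} {D : Set ℂ} {σ : ℂ → C} (φ : ℂ → ℂ) (y : C) :
    (starRingEnd ℂ) (sheetLift z D σ φ y) =
      sheetLift z D σ (fun w => (starRingEnd ℂ) (φ w)) y := by
  classical
  rw [sheetLift_apply, sheetLift_apply]
  split_ifs <;> simp

variable (z) in
/-- Lifts to sheets of continuous functions with compact support. -/
def sheetFunctions : Set (C → ℂ) :=
  {F | ∃ D σ φ, IsSheet z D σ ∧ Continuous φ ∧ HasCompactSupport φ ∧ tsupport φ ⊆ D ∧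
    F = sheetLift z D σ φ}

variable (z) in
/-- The space spanned by lifts of compactly supported continuous functions. -/
def sheetSpace : Submodule ℂ (C → ℂ) := Submodule.span ℂ (sheetFunctions z)

theorem mem_sheetSpace {D : Set ℂ} {σ : ℂ → C} {φ : ℂ → ℂ} (h : IsSheet z D σ) (hφ : Continuous φ)
    (hc : HasCompactSupport φ) (hs : tsupport φ ⊆ D) : sheetLift z D σ φ ∈ sheetSpace z :=
  Submodule.subset_span ⟨D, σ, φ, h, hφ, hc, hs, rfl⟩

/-- The `L²` pairing of functions on the total space of `z`. -/
noncomputable def sheetInner (F G : C → ℂ) : ℂ :=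
  ∫ w, fiberSum hfin (fun y => (starRingEnd ℂ) (F y) * G y) w

theorem eq_zero_of_tsupport_subset {D : Set ℂ} {φ : ℂ → ℂ} (hs : tsupport φ ⊆ D) :
    ∀ w ∉ D, φ w = 0 := fun _ hw => image_eq_zero_of_notMem_tsupport fun h => hw (hs h)

theorem sheetInner_sheetLift [T2Space C] {D D' : Set ℂ} {σ σ' : ℂ → C}
    (h : IsSheet z D σ) (h' : IsSheet z D' σ') {φ φ' : ℂ → ℂ}
    (hφ : ∀ w ∉ D, φ w = 0) (hφ' : ∀ w ∉ D', φ' w = 0) :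
    sheetInner hfin (sheetLift z D σ φ) (sheetLift z D' σ' φ') =
      overlap D D' σ σ' * ∫ w, (starRingEnd ℂ) (φ w) * φ' w := by
  rw [sheetInner, ← integral_const_mul]
  refine integral_congr_ae (Eventually.of_forall fun w => ?_)
  simp_rw [conj_sheetLift]
  exact h.fiberSum_mul_sheetLift hfin h' (fun w hw => by simp [hφ w hw]) hφ' w

theorem integrable_fiberSum [T2Space C] {F G : C → ℂ} (hF : F ∈ sheetSpace z)
    (hG : G ∈ sheetSpace z) :
    Integrable (fiberSum hfin fun y => (starRingEnd ℂ) (F y) * G y) := by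
  induction hF, hG using Submodule.span_induction₂ with
  | mem_mem F G hF hG =>
    obtain ⟨D, σ, φ, h, hφ, hc, hs, rfl⟩ := hF
    obtain ⟨D', σ', φ', h', hφ', hc', hs', rfl⟩ := hG
    have : (fiberSum hfin fun y => (starRingEnd ℂ) (sheetLift z D σ φ y) *
        sheetLift z D' σ' φ' y) = fun w => overlap D D' σ σ' *
          ((starRingEnd ℂ) (φ w) * φ' w) := by
      ext w
      simp_rw [conj_sheetLift]
      exact h.fiberSum_mul_sheetLift hfin h' (fun w hw => by
        simp [eq_zero_of_tsupport_subset hs w hw]) (eq_zero_of_tsupport_subset hs') w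
    rw [this]
    refine Integrable.const_mul (Continuous.integrable_of_hasCompactSupport ?_ ?_) _
    · exact (Complex.continuous_conj.comp hφ).mul hφ'
    · exact HasCompactSupport.mul_left hc'
  | zero_left G hG =>
    refine (integrable_zero ℂ ℂ volume).congr (Eventually.of_forall fun w => ?_)
    simp [fiberSum]
  | zero_right F hF =>
    refine (integrable_zero ℂ ℂ volume).congr (Eventually.of_forall fun w => ?_)
    simp [fiberSum]
  | add_left F F' G hF hF' hG h1 h2 =>
    refine (h1.add h2).congr (Eventually.of_forall fun w => ?_)
    simp [fiberSum, add_mul, Finset.sum_add_distrib]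
  | add_right F G G' hF hG hG' h1 h2 =>
    refine (h1.add h2).congr (Eventually.of_forall fun w => ?_)
    simp [fiberSum, mul_add, Finset.sum_add_distrib]
  | smul_left r F G hF hG h1 =>
    refine (h1.const_mul ((starRingEnd ℂ) r)).congr (Eventually.of_forall fun w => ?_)
    simp [fiberSum, mul_assoc, Finset.mul_sum]
  | smul_right r F G hF hG h1 =>
    refine (h1.const_mul r).congr (Eventually.of_forall fun w => ?_)
    simp only [fiberSum, Finset.mul_sum, Pi.smul_apply, smul_eq_mul]
    exact Finset.sum_congr rfl fun y _ => by ring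

/-- The `L²` pre-inner product on the span of the sheet functions. -/
@[reducible] noncomputable def sheetCore [T2Space C] : PreInnerProductSpace.Core ℂ (sheetSpace z) where
  inner F G := sheetInner hfin F G
  conj_inner_symm F G := by
    simp only [sheetInner]
    rw [← integral_conj]
    refine integral_congr_ae (Eventually.of_forall fun w => ?_)
    simp [fiberSum, mul_comm]
  re_inner_nonneg F := by
    simp only [sheetInner]
    rw [← integral_re (integrable_fiberSum hfin F.2 F.2)]
    refine integral_nonneg fun w => ?_
    simp only [fiberSum, map_sum, Pi.zero_apply]
    refine Finset.sum_nonneg fun y _ => ?_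
    rw [Complex.conj_mul', RCLike.re_to_complex, ← Complex.ofReal_pow, Complex.ofReal_re]
    positivity
  add_left F F' G := by
    simp only [sheetInner]
    rw [← integral_add (integrable_fiberSum hfin F.2 G.2) (integrable_fiberSum hfin F'.2 G.2)]
    refine integral_congr_ae (Eventually.of_forall fun w => ?_)
    simp [fiberSum, add_mul, Finset.sum_add_distrib]
  smul_left F G r := by
    simp only [sheetInner]
    rw [← integral_const_mul]
    refine integral_congr_ae (Eventually.of_forall fun w => ?_)
    simp [fiberSum, mul_assoc, Finset.mul_sum]

/-- If two families of vectors have the same Gram matrix, then a functional which on the second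
family is the inner product with `β` can be transported to the first family. -/
theorem exists_functional_of_inner_eq {E : Type*} [SeminormedAddCommGroup E]
    [InnerProductSpace ℂ E] {ι : Type*} (a a' : ι → E)
    (h : ∀ i j, inner ℂ (a i) (a j) = inner ℂ (a' i) (a' j)) (β : E) :
    ∃ k : E →ₗ[ℂ] ℂ, (∀ i, k (a i) = inner ℂ β (a' i)) ∧ ∀ x, ‖k x‖ ≤ ‖β‖ * ‖x‖ := by
  set P : (ι →₀ ℂ) →ₗ[ℂ] E := Finsupp.linearCombination ℂ a with hP
  set Q : (ι →₀ ℂ) →ₗ[ℂ] E := Finsupp.linearCombination ℂ a' with hQ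
  -- Equal Gram matrices give equal seminorms, so `q` is bounded by `P` and descends to the range of
  -- `P`. Only a seminorm and Hahn–Banach are used; no completion is needed.
  have hnorm : ∀ v, ‖P v‖ = ‖Q v‖ := by
    intro v
    have : inner ℂ (P v) (P v) = inner ℂ (Q v) (Q v) := by
      simp only [hP, hQ, Finsupp.linearCombination_apply, Finsupp.sum, sum_inner, inner_sum,
        inner_smul_left, inner_smul_right, h]
    rw [@norm_eq_sqrt_re_inner ℂ, this, ← @norm_eq_sqrt_re_inner ℂ]
  set q : (ι →₀ ℂ) →ₗ[ℂ] ℂ := (innerSL ℂ β).toLinearMap.comp Q with hq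
  have hqb : ∀ v, ‖q v‖ ≤ ‖β‖ * ‖P v‖ := by
    intro v
    rw [hnorm]
    exact norm_inner_le_norm β (Q v)
  obtain ⟨g, hg⟩ := P.rangeRestrict.exists_rightInverse_of_surjective
    (LinearMap.range_eq_top.2 P.surjective_rangeRestrict)
  have hgP : ∀ x : LinearMap.range P, P (g x) = x := fun x =>
    congrArg Subtype.val (LinearMap.congr_fun hg x)
  have hp : ∀ x : LinearMap.range P, ‖(q.comp g) x‖ ≤ (‖β‖₊ • normSeminorm ℂ E) (x : E) := by
    intro x
    have := hqb (g x)
    rw [hgP] at this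
    exact this
  obtain ⟨k, hk, hkb⟩ := Module.Dual.exists_extension_of_le_seminorm (LinearMap.range P)
    (q.comp g) hp
  refine ⟨k, fun i => ?_, fun x => hkb x⟩
  have e1 : P (Finsupp.single i 1) = a i := by simp [hP]
  have e2 : Q (Finsupp.single i 1) = a' i := by simp [hQ]
  have h1 := hk ⟨P (Finsupp.single i 1), LinearMap.mem_range_self P _⟩
  simp only [e1] at h1
  rw [h1]
  set x : LinearMap.range P := ⟨a i, _⟩
  -- The section `g` need not return the basis vector, but the difference has `P`-norm zero, where
  -- the bound on `q` forces it to vanish.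
  have h2 : q (g x - Finsupp.single i 1) = 0 := by
    have := hqb (g x - Finsupp.single i 1)
    rw [map_sub P, hgP, e1] at this
    simpa [x] using this
  rw [map_sub, sub_eq_zero] at h2
  rw [LinearMap.comp_apply, h2, hq, LinearMap.comp_apply, e2]
  rfl

/-- Hahn–Banach: the map `∂ψ/∂z̄ ↦ ∫ β ∂ψ/∂z` extends to an `L²`-bounded functional. -/
theorem exists_sheet_functional [T2Space C] {β : C → ℂ} (hβ : β ∈ sheetSpace z) :
    ∃ (k : (C → ℂ) →ₗ[ℂ] ℂ) (M : ℝ), 0 ≤ M ∧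
      (∀ D σ ψ, IsSheet z D σ → ContDiff ℝ ∞ ψ → HasCompactSupport ψ → tsupport ψ ⊆ D →
        k (sheetLift z D σ (dzb ψ)) = sheetInner hfin β (sheetLift z D σ (dz ψ))) ∧
      ∀ D σ ψ, IsSheet z D σ → Continuous ψ → HasCompactSupport ψ → tsupport ψ ⊆ D →
        ‖k (sheetLift z D σ ψ)‖ ≤ M * Real.sqrt (∫ w, ‖ψ w‖ ^ 2) := by
  let ι := {t : Set ℂ × (ℂ → C) × (ℂ → ℂ) // IsSheet z t.1 t.2.1 ∧ ContDiff ℝ ∞ t.2.2 ∧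
    HasCompactSupport t.2.2 ∧ tsupport t.2.2 ⊆ t.1}
  let core := sheetCore hfin
  let _ : SeminormedAddCommGroup (sheetSpace z) :=
    @InnerProductSpace.Core.toSeminormedAddCommGroup ℂ _ _ _ _ core
  let _ : InnerProductSpace ℂ (sheetSpace z) := InnerProductSpace.ofCore core
  have hinner : ∀ F G : sheetSpace z, inner ℂ F G = sheetInner hfin F G := fun F G => rfl
  have hz1 : ∀ t : ι, sheetLift z t.1.1 t.1.2.1 (dzb t.1.2.2) ∈ sheetSpace z := fun t =>
    mem_sheetSpace t.2.1 t.2.2.1.dzb.continuous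
      (t.2.2.2.1.of_isClosed_subset (isClosed_tsupport _) (tsupport_dzb_subset _))
      ((tsupport_dzb_subset _).trans t.2.2.2.2)
  have hz2 : ∀ t : ι, sheetLift z t.1.1 t.1.2.1 (dz t.1.2.2) ∈ sheetSpace z := fun t =>
    mem_sheetSpace t.2.1 t.2.2.1.dz.continuous
      (t.2.2.2.1.of_isClosed_subset (isClosed_tsupport _) (tsupport_dz_subset _))
      ((tsupport_dz_subset _).trans t.2.2.2.2)
  obtain ⟨k, hk, hkb⟩ := exists_functional_of_inner_eq (E := sheetSpace z)
    (fun t : ι => ⟨_, hz1 t⟩) (fun t : ι => ⟨_, hz2 t⟩) (fun i j => by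
      rw [hinner, hinner]
      have v1 := fun t : ι =>
        eq_zero_of_tsupport_subset ((tsupport_dzb_subset _).trans t.2.2.2.2)
      have v2 := fun t : ι =>
        eq_zero_of_tsupport_subset ((tsupport_dz_subset _).trans t.2.2.2.2)
      -- Both Gram matrices carry the same overlap factor, which leaves the identity in the plane.
      rw [sheetInner_sheetLift hfin i.2.1 j.2.1 (v1 i) (v1 j),
        sheetInner_sheetLift hfin i.2.1 j.2.1 (v2 i) (v2 j),
        integral_conj_dz_mul_dz i.2.2.1 i.2.2.2.1 j.2.2.1]) ⟨β, hβ⟩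
  -- A purely algebraic extension; only its values on `sheetSpace z` are ever used.
  obtain ⟨k', hk'⟩ := LinearMap.exists_extend k
  have hkk : ∀ (F : C → ℂ) (hF : F ∈ sheetSpace z), k' F = k ⟨F, hF⟩ := fun F hF =>
    LinearMap.congr_fun hk' ⟨F, hF⟩
  refine ⟨k', ‖(⟨β, hβ⟩ : sheetSpace z)‖, norm_nonneg _, ?_, ?_⟩
  · intro D σ ψ h h1 h2 h3
    let t : ι := ⟨(D, σ, ψ), h, h1, h2, h3⟩
    rw [hkk _ (hz1 t)]
    exact hk t
  · intro D σ ψ h h1 h2 h3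
    have hm := mem_sheetSpace h h1 h2 h3
    rw [hkk _ hm]
    refine (hkb _).trans (mul_le_mul_of_nonneg_left ?_ (norm_nonneg _))
    rw [@norm_eq_sqrt_re_inner ℂ, hinner]
    refine Real.sqrt_le_sqrt ?_
    have hv := eq_zero_of_tsupport_subset h3
    rw [sheetInner_sheetLift hfin h h hv hv]
    have e : ∫ w, (starRingEnd ℂ) (ψ w) * ψ w = ((∫ w, ‖ψ w‖ ^ 2 : ℝ) : ℂ) := by
      refine Eq.trans ?_ (integral_ofReal (𝕜 := ℂ) (f := fun w => ‖ψ w‖ ^ 2))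
      refine integral_congr_ae (Eventually.of_forall fun w => ?_)
      simp [Complex.conj_mul']
    have hnn : 0 ≤ ∫ w, ‖ψ w‖ ^ 2 := integral_nonneg fun w => by positivity
    rw [e, overlap]
    split_ifs
    · simp
    · simpa using hnn

end Sheets

/-! ### The weakly holomorphic functional with a dipole singularity. -/

section Kernel

open MeasureTheory Complex Filter Topology Metric

/-- A truncation of the function `1 / (w - b)`. -/
theorem exists_truncated_inv (b : ℂ) {r : ℝ} (hr : 0 < r) : ∃ q : ℂ → ℂ,
    (∀ w ≠ b, ContDiffAt ℝ ∞ q w) ∧ (∀ w ∈ ball b (r / 2), q w = (w - b)⁻¹) ∧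
      ∀ w ∉ ball b r, q w = 0 := by
  let χ : ContDiffBump b := ⟨r / 2, r, by linarith, by linarith⟩
  refine ⟨fun w => (χ w : ℂ) * (w - b)⁻¹, fun w hw => ?_, fun w hw => ?_, fun w hw => ?_⟩
  · refine ContDiffAt.mul (Complex.ofRealCLM.contDiff.contDiffAt.comp w χ.contDiffAt) ?_
    exact ContDiffAt.inv (by fun_prop) (sub_ne_zero.2 hw)
  · have : χ w = 1 := χ.one_of_mem_closedBall (ball_subset_closedBall hw)
    simp [this]
  · have : χ w = 0 := χ.zero_of_le_dist (by simpa using hw)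
    simp [this]

theorem dzb_truncated_inv {b : ℂ} {r : ℝ} {q : ℂ → ℂ}
    (hq : ∀ w ∈ ball b (r / 2), q w = (w - b)⁻¹) {w : ℂ} (hw : w ∈ ball b (r / 2)) :
    dzb q w = 0 := by
  have he : q =ᶠ[𝓝 w] fun w => (w - b)⁻¹ := by
    filter_upwards [isOpen_ball.mem_nhds hw] with v hv using hq v hv
  by_cases hb : w = b
  -- At `b` the function `q` is not even continuous, so `fderiv` takes its default value `0`. This
  -- is the value that makes `dzb q` continuous there.
  · have : ¬ DifferentiableAt ℝ q w := by
      intro h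
      have h1 := h.continuousAt
      have h2 : Tendsto (fun v => ‖q v‖) (𝓝[≠] w) (𝓝 ‖q w‖) :=
        (h1.norm.tendsto).mono_left nhdsWithin_le_nhds
      have h3 : Tendsto (fun v => ‖q v‖) (𝓝[≠] w) atTop := by
        have h4 : Tendsto (fun v : ℂ => ‖(v - b)⁻¹‖) (𝓝[≠] w) atTop := by
          subst hb
          have h5 : Tendsto (fun v : ℂ => v - w) (𝓝[≠] w) (𝓝[≠] 0) := by
            refine tendsto_nhdsWithin_iff.2 ⟨?_, ?_⟩
            · have : Tendsto (fun v : ℂ => v - w) (𝓝 w) (𝓝 (w - w)) :=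
                (continuous_id.sub continuous_const).tendsto w
              rw [sub_self] at this
              exact this.mono_left nhdsWithin_le_nhds
            · filter_upwards [self_mem_nhdsWithin] with v hv
              exact sub_ne_zero.2 hv
          exact (tendsto_norm_inv_nhdsNE_zero_atTop).comp h5
        refine h4.congr' ?_
        filter_upwards [he.filter_mono nhdsWithin_le_nhds] with v hv
        rw [hv]
      exact not_tendsto_nhds_of_tendsto_atTop h3 _ h2
    simp [dzb, fderiv_zero_of_not_differentiableAt this]
  · have h1 : fderiv ℝ q w = fderiv ℝ (fun w => (w - b)⁻¹) w := he.fderiv_eq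
    have h2 : dzb q w = dzb (fun w => (w - b)⁻¹) w := by simp only [dzb, h1]
    rw [h2]
    exact DifferentiableAt.dzb_eq_zero (((differentiableAt_id).sub_const b).inv (sub_ne_zero.2 hb))

theorem dz_truncated_inv {b : ℂ} {r : ℝ} {q : ℂ → ℂ}
    (hq : ∀ w ∈ ball b (r / 2), q w = (w - b)⁻¹) {w : ℂ} (hw : w ∈ ball b (r / 2)) (hb : w ≠ b) :
    dz q w = -((w - b) ^ 2)⁻¹ := by
  have he : q =ᶠ[𝓝 w] fun w => (w - b)⁻¹ := by
    filter_upwards [isOpen_ball.mem_nhds hw] with v hv using hq v hv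
  have h1 : fderiv ℝ q w = fderiv ℝ (fun w => (w - b)⁻¹) w := he.fderiv_eq
  have h2 : dz q w = dz (fun w => (w - b)⁻¹) w := by simp only [dz, h1]
  have hd : HasDerivAt (fun w : ℂ => (w - b)⁻¹) (-1 / (w - b) ^ 2) w :=
    ((hasDerivAt_id w).sub_const b).fun_inv (sub_ne_zero.2 hb)
  rw [h2, DifferentiableAt.dz_eq_deriv hd.differentiableAt, hd.deriv]
  ring

theorem ContDiffAt.dz {φ : ℂ → ℂ} {w : ℂ} (h : ContDiffAt ℝ ∞ φ w) : ContDiffAt ℝ ∞ (dz φ) w :=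
  contDiffAt_const.mul ((h.fderiv_apply_const 1).sub
    (contDiffAt_const.mul (h.fderiv_apply_const I)))

theorem ContDiffAt.dzb {φ : ℂ → ℂ} {w : ℂ} (h : ContDiffAt ℝ ∞ φ w) : ContDiffAt ℝ ∞ (dzb φ) w :=
  contDiffAt_const.mul ((h.fderiv_apply_const 1).add
    (contDiffAt_const.mul (h.fderiv_apply_const I)))

theorem integral_norm_sq_le {K : Set ℂ} (hK : IsCompact K) {ψ : ℂ → ℂ}
    (hs : ∀ w ∉ K, ψ w = 0) {M : ℝ} (hM : ∀ w, ‖ψ w‖ ≤ M) :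
    ∫ w, ‖ψ w‖ ^ 2 ≤ volume.real K * M ^ 2 := by
  have hM0 : 0 ≤ M := (norm_nonneg _).trans (hM 0)
  have h1 : ∫ w, ‖ψ w‖ ^ 2 = ∫ w in K, ‖ψ w‖ ^ 2 := by
    refine (setIntegral_eq_integral_of_forall_compl_eq_zero fun w hw => ?_).symm
    simp [hs w hw]
  rw [h1]
  refine (le_abs_self _).trans ?_
  have := norm_setIntegral_le_of_norm_le_const (μ := volume) (s := K) (f := fun w => ‖ψ w‖ ^ 2)
    (C := M ^ 2) hK.measure_lt_top (fun w _ => by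
      rw [Real.norm_of_nonneg (by positivity)]
      exact pow_le_pow_left₀ (norm_nonneg _) (hM w) 2)
  rw [Real.norm_eq_abs] at this
  linarith

theorem norm_integral_mul_le {K : Set ℂ} (hK : IsCompact K) {h₀ ψ : ℂ → ℂ}
    (hs : ∀ w ∉ K, ψ w = 0) {M N : ℝ} (hN : ∀ w ∈ K, ‖h₀ w‖ ≤ N) (hM : ∀ w, ‖ψ w‖ ≤ M) :
    ‖∫ w, h₀ w * ψ w‖ ≤ volume.real K * N * M := by
  have hM0 : 0 ≤ M := (norm_nonneg _).trans (hM 0)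
  have h1 : ∫ w, h₀ w * ψ w = ∫ w in K, h₀ w * ψ w := by
    refine (setIntegral_eq_integral_of_forall_compl_eq_zero fun w hw => ?_).symm
    simp [hs w hw]
  rw [h1]
  have := norm_setIntegral_le_of_norm_le_const (μ := volume) (s := K) (f := fun w => h₀ w * ψ w)
    (C := N * M) hK.measure_lt_top (fun w hw => by
      rw [norm_mul]
      exact mul_le_mul (hN w hw) (hM w) (norm_nonneg _) ((norm_nonneg _).trans (hN w hw)))
  linarith

variable {C : Type*} [TopologicalSpace C] [T2Space C] {z : C → ℂ}

/-- Integration against `h₀` over the sheet `σ₁`. Since `h₀` may fail to be integrable at `b`, it is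
first defined on the span of lifts from sheets whose base avoids `b`, then extended algebraically.
-/
theorem exists_integral_functional (hfin : ∀ w, (z ⁻¹' {w}).Finite) {b : ℂ} {D₁ : Set ℂ}
    {σ₁ : ℂ → C} (h₁ : IsSheet z D₁ σ₁) {h₀ : ℂ → ℂ} (hc : ContinuousOn h₀ {b}ᶜ)
    (hs₀ : ∀ w ∉ D₁, h₀ w = 0) :
    ∃ J : (C → ℂ) →ₗ[ℂ] ℂ, ∀ D σ ψ, IsSheet z D σ → b ∉ D → Continuous ψ → HasCompactSupport ψ →
      tsupport ψ ⊆ D →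
      J (sheetLift z D σ ψ) = overlap D₁ D σ₁ σ * ∫ w, h₀ w * ψ w := by
  set W : Submodule ℂ (C → ℂ) := Submodule.span ℂ {F | ∃ D σ ψ, IsSheet z D σ ∧ b ∉ D ∧
    Continuous ψ ∧ HasCompactSupport ψ ∧ tsupport ψ ⊆ D ∧ F = sheetLift z D σ ψ} with hW
  have hpt : ∀ D σ ψ, IsSheet z D σ → tsupport ψ ⊆ D → ∀ w,
      fiberSum hfin (fun y => sheetLift z D₁ σ₁ h₀ y * sheetLift z D σ ψ y) w =
        overlap D₁ D σ₁ σ * (h₀ w * ψ w) := fun D σ ψ h hs w =>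
    h₁.fiberSum_mul_sheetLift hfin h hs₀ (eq_zero_of_tsupport_subset hs) w
  have hint : ∀ F ∈ W, Integrable (fiberSum hfin fun y => sheetLift z D₁ σ₁ h₀ y * F y) := by
    intro F hF
    induction hF using Submodule.span_induction with
    | mem F hF =>
      obtain ⟨D, σ, ψ, h, hb, hψ, hcs, hs, rfl⟩ := hF
      refine Integrable.congr ?_ (Eventually.of_forall fun w => (hpt D σ ψ h hs w).symm)
      refine Integrable.const_mul ?_ _
      refine (integrable_mul_of_tsupport (χ := h₀) hψ hcs fun w hw => ?_).congr
        (Eventually.of_forall fun w => mul_comm _ _)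
      exact hc.continuousAt (isOpen_compl_singleton.mem_nhds fun h => hb (h ▸ hs hw))
    | zero =>
      refine (integrable_zero ℂ ℂ volume).congr (Eventually.of_forall fun w => ?_)
      simp [fiberSum]
    | add F G hF hG h1 h2 =>
      refine (h1.add h2).congr (Eventually.of_forall fun w => ?_)
      simp [fiberSum, mul_add, Finset.sum_add_distrib]
    | smul c F hF h1 =>
      refine (h1.const_mul c).congr (Eventually.of_forall fun w => ?_)
      simp only [fiberSum, Finset.mul_sum, Pi.smul_apply, smul_eq_mul]
      exact Finset.sum_congr rfl fun y _ => by ring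
  let J₀ : W →ₗ[ℂ] ℂ :=
    { toFun := fun F => ∫ w, fiberSum hfin (fun y => sheetLift z D₁ σ₁ h₀ y * (F : C → ℂ) y) w
      map_add' := fun F G => by
        rw [← integral_add (hint F F.2) (hint G G.2)]
        refine integral_congr_ae (Eventually.of_forall fun w => ?_)
        simp [fiberSum, mul_add, Finset.sum_add_distrib]
      map_smul' := fun c F => by
        rw [RingHom.id_apply, smul_eq_mul, ← integral_const_mul]
        refine integral_congr_ae (Eventually.of_forall fun w => ?_)
        simp only [fiberSum, Finset.mul_sum, Submodule.coe_smul, Pi.smul_apply, smul_eq_mul]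
        exact Finset.sum_congr rfl fun y _ => by ring }
  obtain ⟨J, hJ⟩ := LinearMap.exists_extend J₀
  refine ⟨J, fun D σ ψ h hb hψ hcs hs => ?_⟩
  have hm : sheetLift z D σ ψ ∈ W := Submodule.subset_span ⟨D, σ, ψ, h, hb, hψ, hcs, hs, rfl⟩
  have e := LinearMap.congr_fun hJ ⟨_, hm⟩
  rw [LinearMap.comp_apply, Submodule.subtype_apply] at e
  rw [e, ← integral_const_mul]
  exact integral_congr_ae (Eventually.of_forall fun w => hpt D σ ψ h hs w)

/-- Existence of a weakly holomorphic functional with a prescribed double pole. -/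
theorem exists_dipole_functional (hfin : ∀ w, (z ⁻¹' {w}).Finite) {b : ℂ} {D₁ : Set ℂ}
    {σ₁ : ℂ → C} (h₁ : IsSheet z D₁ σ₁) {r : ℝ} (hr : 0 < r) (hD₁ : closedBall b r ⊆ D₁) :
    ∃ (H : (C → ℂ) →ₗ[ℂ] ℂ) (h₀ : ℂ → ℂ) (M : ℝ), 0 ≤ M ∧
      (∀ D σ, IsSheet z D σ → b ∉ D → IsWeaklyHolomorphicOn (H ∘ₗ sheetLift z D σ) D) ∧
      (∀ D σ ψ, IsSheet z D σ → b ∉ D → Continuous ψ → HasCompactSupport ψ → tsupport ψ ⊆ D →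
        ‖H (sheetLift z D σ ψ) - overlap D₁ D σ₁ σ * ∫ w, h₀ w * ψ w‖ ≤
          M * Real.sqrt (∫ w, ‖ψ w‖ ^ 2)) ∧
      (∀ w ≠ b, ‖h₀ w‖ ≤ M / ‖w - b‖ ^ 2) ∧ ContinuousOn h₀ {b}ᶜ ∧
      ∀ w ∈ ball b (r / 2), w ≠ b → h₀ w = -((w - b) ^ 2)⁻¹ := by
  obtain ⟨q, hq1, hq2, hq3⟩ := exists_truncated_inv b hr
  have hqts : tsupport q ⊆ closedBall b r :=
    closure_minimal (fun w hw => by_contra fun h => hw (hq3 w fun h' =>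
      h (ball_subset_closedBall h'))) isClosed_closedBall
  have hcb : IsCompact (closedBall b r) := isCompact_closedBall b r
  have hβc : Continuous (dzb q) := by
    rw [continuous_iff_continuousAt]
    intro w
    by_cases hw : w ∈ ball b (r / 2)
    · refine (continuousAt_const (y := (0 : ℂ))).congr ?_
      filter_upwards [isOpen_ball.mem_nhds hw] with v hv using
        (dzb_truncated_inv hq2 hv).symm
    · exact (hq1 w (fun h => hw (h ▸ mem_ball_self (by linarith)))).dzb.continuousAt
  have hβts : tsupport (dzb q) ⊆ closedBall b r := (tsupport_dzb_subset q).trans hqts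
  have hβcs : HasCompactSupport (dzb q) := hcb.of_isClosed_subset (isClosed_tsupport _) hβts
  have hh₀c : ContinuousOn (dz q) {b}ᶜ := fun w hw => (hq1 w hw).dz.continuousAt.continuousWithinAt
  have hh₀s : ∀ w ∉ D₁, dz q w = 0 :=
    eq_zero_of_tsupport_subset ((tsupport_dz_subset q).trans (hqts.trans hD₁))
  -- The pairing conjugates its first argument, so the conjugate of `dzb q` is used to obtain `∫ dzb
  -- q * dz ψ`.
  have hβconj : sheetLift z D₁ σ₁ (fun w => (starRingEnd ℂ) (dzb q w)) ∈ sheetSpace z := by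
    have hts : tsupport (fun w => (starRingEnd ℂ) (dzb q w)) ⊆ tsupport (dzb q) :=
      tsupport_comp_subset (g := starRingEnd ℂ) (map_zero _) _
    exact mem_sheetSpace h₁ (Complex.continuous_conj.comp hβc)
      (hβcs.of_isClosed_subset (isClosed_tsupport _) hts) (hts.trans (hβts.trans hD₁))
  obtain ⟨k, M₁, hM₁, hk, hkb⟩ := exists_sheet_functional hfin hβconj
  obtain ⟨J, hJ⟩ := exists_integral_functional hfin h₁ hh₀c hh₀s
  -- a bound for `dz q`
  obtain ⟨N, hN⟩ : ∃ N, ∀ w ∈ closedBall b r \ ball b (r / 2), ‖dz q w‖ ≤ N := by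
    refine (hcb.diff isOpen_ball).exists_bound_of_continuousOn (hh₀c.mono fun w hw h => hw.2 ?_)
    rw [Set.mem_singleton_iff] at h
    rw [h]
    exact mem_ball_self (by linarith)
  have hh₀b : ∀ w ≠ b, ‖dz q w‖ ≤ (1 + |N| * r ^ 2) / ‖w - b‖ ^ 2 := by
    intro w hw
    have hpos : 0 < ‖w - b‖ := norm_pos_iff.2 (sub_ne_zero.2 hw)
    rw [le_div_iff₀ (by positivity)]
    by_cases h1 : w ∈ ball b (r / 2)
    · rw [dz_truncated_inv hq2 h1 hw, norm_neg, norm_inv, norm_pow, inv_mul_cancel₀ (by positivity)]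
      have : 0 ≤ |N| * r ^ 2 := by positivity
      linarith
    · by_cases h2 : w ∈ closedBall b r
      · have h3 : ‖w - b‖ ≤ r := by simpa [dist_eq_norm] using h2
        have h4 := (hN w ⟨h2, h1⟩).trans (le_abs_self N)
        have : ‖dz q w‖ * ‖w - b‖ ^ 2 ≤ |N| * r ^ 2 :=
          mul_le_mul h4 (pow_le_pow_left₀ hpos.le h3 2) (by positivity) (abs_nonneg _)
        linarith
      · have : dz q w = 0 :=
          dz_eq_zero_of_notMem fun h => h2 (hqts h)
        rw [this, norm_zero, zero_mul]
        positivity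
  set M := max M₁ (1 + |N| * r ^ 2) with hM
  have hbound : ∀ D σ ψ, IsSheet z D σ → b ∉ D → Continuous ψ → HasCompactSupport ψ →
      tsupport ψ ⊆ D → ‖(J - k) (sheetLift z D σ ψ) - overlap D₁ D σ₁ σ * ∫ w, dz q w * ψ w‖ ≤
          M₁ * Real.sqrt (∫ w, ‖ψ w‖ ^ 2) := by
    intro D σ ψ h hb h1 h2 h3
    rw [LinearMap.sub_apply, hJ D σ ψ h hb h1 h2 h3, sub_sub_cancel_left, norm_neg]
    exact hkb D σ ψ h h1 h2 h3
  -- On `dzb ψ` the functional `J` gives `∫ dz q * dzb ψ` and `k` gives `∫ dzb q * dz ψ`, up to the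
  -- same overlap factor. Away from `b`, where `q` is smooth, these agree by parts, so `J - k` is
  -- weakly holomorphic.
  refine ⟨J - k, dz q, M, hM₁.trans (le_max_left _ _), ?_, ?_, ?_, hh₀c,
    fun w hw hb => dz_truncated_inv hq2 hw hb⟩
  · intro D σ h hb
    refine ⟨fun K hKD hK => ?_, fun ψ hψ hcs hts => ?_⟩
    · obtain ⟨N', hN'⟩ := hK.exists_bound_of_continuousOn (hh₀c.mono fun w hw h =>
        hb (Set.mem_singleton_iff.1 h ▸ hKD hw))
      refine ⟨M₁ * Real.sqrt (volume.real K) + volume.real K * N', fun ψ hψ hsK B hB => ?_⟩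
      have hB0 : 0 ≤ B := (norm_nonneg _).trans (hB 0)
      have hts : tsupport ψ ⊆ K :=
        closure_minimal (fun w hw => by_contra fun h => hw (hsK w h)) hK.isClosed
      have e1 := hbound D σ ψ h hb hψ (hK.of_isClosed_subset (isClosed_tsupport _) hts)
        (hts.trans hKD)
      have e2 := integral_norm_sq_le hK hsK hB
      have e3 : Real.sqrt (∫ w, ‖ψ w‖ ^ 2) ≤ Real.sqrt (volume.real K) * B := by
        rw [Real.sqrt_le_left (by positivity), mul_pow, Real.sq_sqrt measureReal_nonneg]
        exact e2
      have e4 := norm_integral_mul_le hK hsK hN' hB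
      have e5 : ‖overlap D₁ D σ₁ σ‖ ≤ 1 := by
        rw [overlap]; split_ifs <;> simp
      have e6 : ‖overlap D₁ D σ₁ σ * ∫ w, dz q w * ψ w‖ ≤ volume.real K * N' * B := by
        rw [norm_mul]
        calc _ ≤ 1 * ‖∫ w, dz q w * ψ w‖ := by gcongr
          _ ≤ _ := by rw [one_mul]; exact e4
      have e7 : M₁ * Real.sqrt (∫ w, ‖ψ w‖ ^ 2) ≤ M₁ * (Real.sqrt (volume.real K) * B) := by
        gcongr
      calc ‖((J - k) ∘ₗ sheetLift z D σ) ψ‖ = ‖(J - k) (sheetLift z D σ ψ)‖ := rfl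
        _ ≤ ‖(J - k) (sheetLift z D σ ψ) - overlap D₁ D σ₁ σ * ∫ w, dz q w * ψ w‖ +
            ‖overlap D₁ D σ₁ σ * ∫ w, dz q w * ψ w‖ := by
              simpa using norm_add_le ((J - k) (sheetLift z D σ ψ) -
                overlap D₁ D σ₁ σ * ∫ w, dz q w * ψ w) (overlap D₁ D σ₁ σ * ∫ w, dz q w * ψ w)
        _ ≤ _ := by linarith
    · have v1 : tsupport (dzb ψ) ⊆ D := (tsupport_dzb_subset ψ).trans hts
      have v2 : tsupport (dz ψ) ⊆ D := (tsupport_dz_subset ψ).trans hts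
      rw [LinearMap.comp_apply, LinearMap.sub_apply, hk D σ ψ h hψ hcs hts,
        hJ D σ _ h hb hψ.dzb.continuous (hcs.of_isClosed_subset (isClosed_tsupport _)
          (tsupport_dzb_subset ψ)) v1, sheetInner_sheetLift hfin h₁ h
          (fun w hw => by
            rw [eq_zero_of_tsupport_subset (hβts.trans hD₁) w hw, map_zero])
          (eq_zero_of_tsupport_subset v2), ← mul_sub]
      have := integral_dz_mul_dzb (χ := q) hψ hcs fun w hw => hq1 w fun h' => hb (h' ▸ hts hw)
      simp_rw [Complex.conj_conj, mul_comm (dz q _), mul_comm (dzb q _)]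
      rw [this, sub_self, mul_zero]
  · intro D σ ψ h hb h1 h2 h3
    refine (hbound D σ ψ h hb h1 h2 h3).trans ?_
    exact mul_le_mul_of_nonneg_right (le_max_left _ _) (Real.sqrt_nonneg _)
  · intro w hw
    refine (hh₀b w hw).trans ?_
    exact div_le_div_of_nonneg_right (le_max_right _ _) (by positivity)

end Kernel

/-! ### From the functional to a function on the surface. -/

section Dipole

open MeasureTheory Complex Filter Topology Metric

theorem volume_real_closedBall_complex (a : ℂ) {ε : ℝ} (hε : 0 ≤ ε) :
    volume.real (closedBall a ε) = ε ^ 2 * Real.pi := by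
  rw [measureReal_def, Complex.volume_closedBall]
  simp [ENNReal.toReal_ofReal hε]

/-- Height at most `ε⁻²` on a disc of area `π ε²`. An `L²`-bounded functional therefore contributes
only `O(1 / ε)` to pointwise values, which is negligible against a double pole. -/
theorem sqrt_integral_mollifier_sq_le (a : ℂ) {ε : ℝ} (hε : 0 < ε) :
    Real.sqrt (∫ w, ‖mollifier a ε w‖ ^ 2) ≤ 2 / ε := by
  have h1 := integral_norm_sq_le (isCompact_closedBall a ε) (ψ := mollifier a ε) (M := (ε ^ 2)⁻¹)
    (eq_zero_of_tsupport_subset (tsupport_mollifier_subset hε)) (norm_mollifier_le a ε)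
  rw [volume_real_closedBall_complex a hε.le] at h1
  rw [Real.sqrt_le_left (by positivity)]
  refine h1.trans ?_
  have : ε ^ 2 * Real.pi * (ε ^ 2)⁻¹ ^ 2 = Real.pi / ε ^ 2 := by field_simp
  rw [this, div_pow]
  exact div_le_div_of_nonneg_right (by nlinarith [Real.pi_le_four]) (by positivity)

theorem norm_integral_mul_mollifier_le {a : ℂ} {ε : ℝ} (hε : 0 < ε) {h₀ : ℂ → ℂ} {N : ℝ}
    (hN : ∀ w ∈ closedBall a ε, ‖h₀ w‖ ≤ N) :
    ‖∫ w, h₀ w * mollifier a ε w‖ ≤ Real.pi * N := by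
  have h1 := norm_integral_mul_le (isCompact_closedBall a ε) (ψ := mollifier a ε) (M := (ε ^ 2)⁻¹)
    (eq_zero_of_tsupport_subset (tsupport_mollifier_subset hε)) hN (norm_mollifier_le a ε)
  rw [volume_real_closedBall_complex a hε.le] at h1
  refine h1.trans (le_of_eq ?_)
  field_simp

variable {C : Type*} [TopologicalSpace C] [T2Space C] {z : C → ℂ}

/-- Meromorphic functions with a prescribed double pole, holomorphic wherever `z` is unramified. -/
theorem exists_dipole (hfin : ∀ w, (z ⁻¹' {w}).Finite) {b : ℂ} {D₁ : Set ℂ}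
    {σ₁ : ℂ → C} (h₁ : IsSheet z D₁ σ₁) {r : ℝ} (hr : 0 < r) (hD₁ : closedBall b r ⊆ D₁) :
    ∃ (h : C → ℂ) (M : ℝ), 0 ≤ M ∧
      (∀ D σ, IsSheet z D σ → b ∉ D → DifferentiableOn ℂ (fun w => h (σ w)) D) ∧
      (∀ D σ, IsSheet z D σ → b ∉ D → ∀ a R, 0 < R → ball a R ⊆ D →
        ‖h (σ a)‖ ≤ M * (R⁻¹ + (R ^ 2)⁻¹)) ∧
      Tendsto (fun w => (w - b) ^ 2 * h (σ₁ w)) (𝓝[≠] b) (𝓝 (-bumpMass)) ∧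
      ∀ D σ, IsSheet z D σ → b ∈ D → σ b ≠ σ₁ b →
        Tendsto (fun w => (w - b) ^ 2 * h (σ w)) (𝓝[≠] b) (𝓝 0) := by
  classical
  obtain ⟨H, h₀, M, hM, hweak, hbound, hh₀b, hh₀c, hh₀⟩ := exists_dipole_functional hfin h₁ hr hD₁
  let P : C → Set ℂ × (ℂ → C) × ℝ → Prop := fun y t => IsSheet z t.1 t.2.1 ∧ b ∉ t.1 ∧
    t.2.1 (z y) = y ∧ 0 < t.2.2 ∧ ∃ R, t.2.2 < R ∧ closedBall (z y) R ⊆ t.1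
  let val : C → Set ℂ × (ℂ → C) × ℝ → ℂ := fun y t =>
    H (sheetLift z t.1 t.2.1 (mollifier (z y) t.2.2))
  have hval : ∀ y t t', P y t → P y t' → val y t = val y t' := by
    rintro y ⟨D, σ, ε⟩ ⟨D', σ', ε'⟩ ⟨hs, hb, hy, hε, R, hR, hRD⟩ ⟨hs', hb', hy', hε', R', hR', hRD'⟩
    dsimp only at hs hb hy hε hR hRD hs' hb' hy' hε' hR' hRD'
    have hR0 : 0 < min R R' := lt_min (hε.trans hR) (hε'.trans hR')
    have e1 := (hweak D σ hs hb).mollifier_eq hRD ⟨hε, hR⟩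
      (ε' := min R R' / 2) ⟨by linarith, by linarith [min_le_left R R']⟩
    have e2 := (hweak D' σ' hs' hb').mollifier_eq hRD' ⟨hε', hR'⟩
      (ε' := min R R' / 2) ⟨by linarith, by linarith [min_le_right R R']⟩
    simp only [LinearMap.comp_apply] at e1 e2
    simp only [val]
    rw [e1, e2]
    congr 1
    have hz1 : z y ∈ D := hRD (mem_closedBall_self (hε.trans hR).le)
    have hz2 : z y ∈ D' := hRD' (mem_closedBall_self (hε'.trans hR').le)
    refine sheetLift_congr hs hs' ⟨hz1, hz2⟩ (hy.trans hy'.symm) ?_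
    refine eq_zero_of_tsupport_subset ((tsupport_mollifier_subset (by linarith)).trans ?_)
    exact Set.subset_inter
      ((closedBall_subset_closedBall (by linarith [min_le_left R R'])).trans hRD)
      ((closedBall_subset_closedBall (by linarith [min_le_right R R'])).trans hRD')
  -- The value comes from any sheet through `y` and any small radius; `hval` shows that the choice
  -- does not matter. The default `0` is taken where no admissible sheet exists, for instance over
  -- `b`.
  let h : C → ℂ := fun y => if hy : ∃ t, P y t then val y hy.choose else 0
  have hh : ∀ D σ, IsSheet z D σ → b ∉ D → ∀ a ε R, 0 < ε → ε < R → closedBall a R ⊆ D →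
      h (σ a) = H (sheetLift z D σ (mollifier a ε)) := by
    intro D σ hs hb a ε R hε hεR hR
    have ha : a ∈ D := hR (mem_closedBall_self (hε.trans hεR).le)
    have hza : z (σ a) = a := hs.sec a ha
    have hP : P (σ a) (D, σ, ε) := ⟨hs, hb, by rw [hza], hε, R, hεR, by rw [hza]; exact hR⟩
    have hex : ∃ t, P (σ a) t := ⟨_, hP⟩
    simp only [h]
    rw [dif_pos hex, hval _ _ _ hex.choose_spec hP]
    simp only [val, hza]
  have hest : ∀ D σ, IsSheet z D σ → b ∉ D → ∀ a R ε, ball a R ⊆ D → 0 < ε → ε < R →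
      ‖h (σ a) - overlap D₁ D σ₁ σ * ∫ w, h₀ w * mollifier a ε w‖ ≤ M * (2 / ε) := by
    intro D σ hs hb a R ε hR hε hεR
    have hcl : closedBall a ((ε + R) / 2) ⊆ D := (closedBall_subset_ball (by linarith)).trans hR
    rw [hh D σ hs hb a ε ((ε + R) / 2) hε (by linarith) hcl]
    refine (hbound D σ _ hs hb (contDiff_mollifier a ε).continuous (hasCompactSupport_mollifier hε)
      ((tsupport_mollifier_subset hε).trans ((closedBall_subset_ball hεR).trans hR))).trans ?_
    exact mul_le_mul_of_nonneg_left (sqrt_integral_mollifier_sq_le a hε) hM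
  have hov : ∀ D D' : Set ℂ, ∀ σ σ' : ℂ → C, ‖overlap D D' σ σ'‖ ≤ 1 := by
    intro D D' σ σ'; rw [overlap]; split_ifs <;> simp
  have hnb : ∀ a : ℂ, b ∉ ball a ‖a - b‖ := by
    intro a h
    rw [mem_ball, dist_comm, dist_eq_norm] at h
    exact lt_irrefl _ h
  -- With mollifiers of radius `R / 2` the `L²` term gives `4 M / R` and the integral of `h₀` gives
  -- `4 π M / R²`; `20` exceeds both constants.
  refine ⟨h, 20 * M, by positivity, ?_, ?_, ?_, ?_⟩
  · intro D σ hs hb a ha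
    obtain ⟨R, hR, hRD⟩ := Metric.isOpen_iff.1 hs.isOpen a ha
    have hd := (hweak D σ hs hb).differentiableAt (a := a) (ε := R / 4) (ε' := R / 2) (by linarith)
      (by linarith) ((closedBall_subset_ball (by linarith)).trans hRD)
    refine (hd.congr_of_eventuallyEq ?_).differentiableWithinAt
    filter_upwards [ball_mem_nhds a (show 0 < R / 4 by linarith)] with v hv
    refine hh D σ hs hb v (R / 4) (R / 2) (by linarith) (by linarith) ?_
    refine (closedBall_subset_ball' ?_).trans hRD
    rw [mem_ball] at hv
    linarith
  · intro D σ hs hb a R hR hRD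
    have h1 := hest D σ hs hb a R (R / 2) hRD (by linarith) (by linarith)
    have h2 : ‖∫ w, h₀ w * mollifier a (R / 2) w‖ ≤ Real.pi * (4 * M / R ^ 2) := by
      refine norm_integral_mul_mollifier_le (by linarith) fun w hw => ?_
      have hbR : R ≤ ‖a - b‖ := by
        by_contra hlt
        refine hb (hRD ?_)
        rw [mem_ball, dist_comm, dist_eq_norm]
        linarith
      have hwa : ‖a - w‖ ≤ R / 2 := by rw [← dist_eq_norm, dist_comm]; exact hw
      have hwb : R / 2 ≤ ‖w - b‖ := by
        have := norm_add_le (a - w) (w - b)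
        rw [sub_add_sub_cancel] at this
        linarith
      have hne : w ≠ b := by
        rintro rfl
        rw [sub_self, norm_zero] at hwb
        linarith
      refine (hh₀b w hne).trans ?_
      have : (R / 2) ^ 2 ≤ ‖w - b‖ ^ 2 := pow_le_pow_left₀ (by linarith) hwb 2
      calc M / ‖w - b‖ ^ 2 ≤ M / (R / 2) ^ 2 := div_le_div_of_nonneg_left hM (by positivity) this
        _ = 4 * M / R ^ 2 := by field_simp; norm_num
    have h3 : ‖overlap D₁ D σ₁ σ * ∫ w, h₀ w * mollifier a (R / 2) w‖ ≤
        Real.pi * (4 * M / R ^ 2) := by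
      rw [norm_mul]
      calc _ ≤ 1 * ‖∫ w, h₀ w * mollifier a (R / 2) w‖ := by gcongr; exact hov _ _ _ _
        _ ≤ _ := by rw [one_mul]; exact h2
    have h4 : ‖h (σ a)‖ ≤ M * (2 / (R / 2)) + Real.pi * (4 * M / R ^ 2) := by
      have := norm_add_le (h (σ a) - overlap D₁ D σ₁ σ * ∫ w, h₀ w * mollifier a (R / 2) w)
        (overlap D₁ D σ₁ σ * ∫ w, h₀ w * mollifier a (R / 2) w)
      rw [sub_add_cancel] at this
      linarith
    refine h4.trans ?_
    have e1 : M * (2 / (R / 2)) = 4 * (M * R⁻¹) := by field_simp; norm_num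
    have e2 : Real.pi * (4 * M / R ^ 2) = (4 * Real.pi) * (M * (R ^ 2)⁻¹) := by field_simp
    rw [e1, e2]
    have p1 : 0 ≤ M * R⁻¹ := by positivity
    have p2 : 0 ≤ M * (R ^ 2)⁻¹ := by positivity
    have p3 : 4 * Real.pi ≤ 20 := by linarith [Real.pi_le_four]
    nlinarith
  · -- the double pole
    rw [tendsto_iff_norm_sub_tendsto_zero]
    have hlim : Tendsto (fun a : ℂ => (10 * Real.pi + 2 * M) * Real.sqrt ‖a - b‖) (𝓝[≠] b) (𝓝 0) := by
      have : Tendsto (fun a : ℂ => (10 * Real.pi + 2 * M) * Real.sqrt ‖a - b‖) (𝓝 b)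
          (𝓝 ((10 * Real.pi + 2 * M) * Real.sqrt ‖b - b‖)) := by
        apply Continuous.tendsto
        fun_prop
      simp only [sub_self, norm_zero, Real.sqrt_zero, mul_zero] at this
      exact this.mono_left nhdsWithin_le_nhds
    refine squeeze_zero' (Eventually.of_forall fun _ => norm_nonneg _) ?_ hlim
    have hev : ∀ᶠ a in 𝓝[≠] b, a ∈ ball b (min (r / 4) (1 / 4)) :=
      nhdsWithin_le_nhds (ball_mem_nhds b (by positivity))
    filter_upwards [hev, self_mem_nhdsWithin] with a ha hab
    have hab' : a ≠ b := hab
    set ρ := ‖a - b‖ with hρ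
    have hρ0 : 0 < ρ := norm_pos_iff.2 (sub_ne_zero.2 hab')
    rw [mem_ball, dist_eq_norm, ← hρ, lt_min_iff] at ha
    -- At distance `ρ` from `b` the mollifier has radius `ρ ^ (3 / 2)`. After multiplication by `ρ²`
    -- the `L²` error is `2 M √ρ`; the relative variation of `h₀` on so small a disc is also
    -- `O(√ρ)`. Both tend to `0`.
    set t := Real.sqrt ρ with ht
    have ht0 : 0 < t := Real.sqrt_pos.2 hρ0
    have htt : t * t = ρ := Real.mul_self_sqrt hρ0.le
    have ht2 : t < 1 / 2 := by nlinarith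
    have hsub : ball a ρ ⊆ ball b (r / 2) := ball_subset_ball' (by
      rw [dist_eq_norm, ← hρ]; linarith)
    have hsubD : ball a ρ ⊆ D₁ :=
      hsub.trans ((ball_subset_ball (by linarith)).trans (ball_subset_closedBall.trans hD₁))
    have hs := h₁.mono isOpen_ball (convex_ball a ρ) hsubD
    have haa : a ∈ ball a ρ := mem_ball_self hρ0
    have hov1 : overlap D₁ (ball a ρ) σ₁ σ₁ = 1 := by
      rw [overlap, if_pos]
      exact ⟨a, ⟨hsubD haa, haa⟩, rfl⟩
    have hε : 0 < t * ρ := by positivity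
    have hερ : t * ρ < ρ := by nlinarith
    have e1 := hest _ σ₁ hs (hnb a) a ρ (t * ρ) subset_rfl hε hερ
    rw [hov1, one_mul] at e1
    have hcl : closedBall a (t * ρ) ⊆ ball a ρ := closedBall_subset_ball hερ
    have e2 : ‖∫ w, ((a - b) ^ 2 * h₀ w + 1) * mollifier a (t * ρ) w‖ ≤ Real.pi * (10 * t) := by
      refine norm_integral_mul_mollifier_le hε fun w hw => ?_
      have hwb : w ≠ b := by
        intro h
        have := hcl hw
        rw [h] at this
        exact hnb a this
      have hwb' : w - b ≠ 0 := sub_ne_zero.2 hwb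
      rw [hh₀ w (hsub (hcl hw)) hwb]
      have hwa : ‖w - a‖ ≤ t * ρ := by rw [← dist_eq_norm]; exact hw
      have e : (a - b) ^ 2 * -((w - b) ^ 2)⁻¹ + 1 = (w - a) * (2 * (a - b) + (w - a)) / (w - b) ^ 2 := by
        field_simp; ring
      have hlow : ρ / 2 ≤ ‖w - b‖ := by
        have := norm_add_le (w - b) (a - w)
        rw [sub_add_sub_cancel', norm_sub_rev a w, ← hρ] at this
        nlinarith
      have hup : ‖2 * (a - b) + (w - a)‖ ≤ 5 / 2 * ρ := by
        have := norm_add_le (2 * (a - b)) (w - a)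
        rw [norm_mul, Complex.norm_ofNat, ← hρ] at this
        nlinarith
      rw [e, norm_div, norm_mul, norm_pow, div_le_iff₀ (by positivity)]
      have h5 : (ρ / 2) ^ 2 ≤ ‖w - b‖ ^ 2 := pow_le_pow_left₀ (by positivity) hlow 2
      calc ‖w - a‖ * ‖2 * (a - b) + (w - a)‖ ≤ (t * ρ) * (5 / 2 * ρ) := by gcongr
        _ = 10 * t * (ρ / 2) ^ 2 := by ring
        _ ≤ 10 * t * ‖w - b‖ ^ 2 := by gcongr
    have i1 : Integrable (fun w => h₀ w * mollifier a (t * ρ) w) := by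
      refine (integrable_mul_of_tsupport (χ := h₀) (contDiff_mollifier a (t * ρ)).continuous
        (hasCompactSupport_mollifier hε) fun w hw => ?_).congr
        (Eventually.of_forall fun w => mul_comm _ _)
      refine hh₀c.continuousAt (isOpen_compl_singleton.mem_nhds fun h => ?_)
      have := hcl (tsupport_mollifier_subset hε hw)
      rw [Set.mem_singleton_iff.1 h] at this
      exact hnb a this
    have i2 : Integrable (mollifier a (t * ρ)) :=
      (contDiff_mollifier a (t * ρ)).continuous.integrable_of_hasCompactSupport
        (hasCompactSupport_mollifier hε)
    have e3 : ∫ w, ((a - b) ^ 2 * h₀ w + 1) * mollifier a (t * ρ) w =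
        (a - b) ^ 2 * (∫ w, h₀ w * mollifier a (t * ρ) w) + bumpMass := by
      rw [← integral_mollifier a hε, ← integral_const_mul, ← integral_add (i1.const_mul _) i2]
      refine integral_congr_ae (Eventually.of_forall fun w => ?_)
      ring
    rw [e3] at e2
    have e4 : (a - b) ^ 2 * h (σ₁ a) - -(bumpMass : ℂ) =
        (a - b) ^ 2 * (h (σ₁ a) - ∫ w, h₀ w * mollifier a (t * ρ) w) +
        ((a - b) ^ 2 * (∫ w, h₀ w * mollifier a (t * ρ) w) + bumpMass) := by ring
    rw [e4]
    refine (norm_add_le _ _).trans ?_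
    rw [norm_mul, norm_pow, ← hρ]
    have e5 : ρ ^ 2 * (M * (2 / (t * ρ))) = 2 * M * t := by
      rw [← htt]; field_simp
    have e6 : ρ ^ 2 * ‖h (σ₁ a) - ∫ w, h₀ w * mollifier a (t * ρ) w‖ ≤ 2 * M * t := by
      rw [← e5]; gcongr
    linarith
  · intro D σ hs hbD hne
    obtain ⟨R, hR, hRD⟩ := Metric.isOpen_iff.1 hs.isOpen b hbD
    rw [tendsto_zero_iff_norm_tendsto_zero]
    have hlim : Tendsto (fun a : ℂ => (4 * M) * ‖a - b‖) (𝓝[≠] b) (𝓝 0) := by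
      have : Tendsto (fun a : ℂ => (4 * M) * ‖a - b‖) (𝓝 b) (𝓝 ((4 * M) * ‖b - b‖)) := by
        apply Continuous.tendsto
        fun_prop
      simp only [sub_self, norm_zero, mul_zero] at this
      exact this.mono_left nhdsWithin_le_nhds
    refine squeeze_zero' (Eventually.of_forall fun _ => norm_nonneg _) ?_ hlim
    have hev : ∀ᶠ a in 𝓝[≠] b, a ∈ ball b (R / 2) :=
      nhdsWithin_le_nhds (ball_mem_nhds b (by positivity))
    filter_upwards [hev, self_mem_nhdsWithin] with a ha hab
    have hab' : a ≠ b := hab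
    set ρ := ‖a - b‖ with hρ
    have hρ0 : 0 < ρ := norm_pos_iff.2 (sub_ne_zero.2 hab')
    rw [mem_ball, dist_eq_norm, ← hρ] at ha
    have hsubD : ball a ρ ⊆ D := (ball_subset_ball' (by
      rw [dist_eq_norm, ← hρ]; linarith)).trans hRD
    have hs' := hs.mono isOpen_ball (convex_ball a ρ) hsubD
    have hov0 : overlap D₁ (ball a ρ) σ₁ σ = 0 := by
      rw [overlap, if_neg]
      rintro ⟨w, hw, hwe⟩
      exact hne (h₁.agree hs ⟨hw.1, hsubD hw.2⟩ hwe b ⟨hD₁ (mem_closedBall_self hr.le), hbD⟩).symm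
    -- A sheet disjoint from `σ₁` sees only the `L²` error, of size `O(1 / ρ)`.
    have e1 := hest _ σ hs' (hnb a) a ρ (ρ / 2) subset_rfl (by linarith) (by linarith)
    rw [hov0, zero_mul, sub_zero] at e1
    rw [norm_mul, norm_pow, ← hρ]
    calc ρ ^ 2 * ‖h (σ a)‖ ≤ ρ ^ 2 * (M * (2 / (ρ / 2))) := by gcongr
      _ = 4 * M * ρ := by field_simp; ring

end Dipole

/-! ### Functions of polynomial growth, and separation of one fibre. -/

section Tempered

open Filter Topology Metric Polynomial

/-- Over every disc that avoids `B` the map `z` is a trivial covering with finitely many sheets. -/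
def IsEvenlyCoveredOff {C : Type*} [TopologicalSpace C] (z : C → ℂ) (B : Set ℂ) : Prop :=
  ∀ c r, 0 < r → Disjoint (ball c r) B → ∃ (n : ℕ) (σ : Fin n → ℂ → C),
    (∀ i, IsSheet z (ball c r) (σ i)) ∧ (∀ w ∈ ball c r, ∀ y, z y = w → ∃ i, σ i w = y) ∧
      ∀ w ∈ ball c r, Function.Injective fun i => σ i w

/-- `u` is holomorphic over the complement of `B`, of polynomial growth in `z`. -/
structure IsTempered {C : Type*} [TopologicalSpace C] (z : C → ℂ) (B : Set ℂ) (u : C → ℂ) :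
    Prop where
  diff : ∀ D σ, IsSheet z D σ → Disjoint D B → DifferentiableOn ℂ (fun w => u (σ w)) D
  bound : ∃ (K : ℝ) (N : ℕ), ∀ x, z x ∉ B → ‖u x‖ ≤ K * (1 + ‖z x‖) ^ N

variable {C : Type*} [TopologicalSpace C] {z : C → ℂ} {B : Set ℂ}

theorem IsEvenlyCoveredOff.mono {B' : Set ℂ} (h : IsEvenlyCoveredOff z B) (hB : B ⊆ B') :
    IsEvenlyCoveredOff z B' := fun c r hr hd => h c r hr (hd.mono_right hB)

theorem Polynomial.exists_norm_eval_le (p : ℂ[X]) :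
    ∃ K : ℝ, 0 ≤ K ∧ ∀ w, ‖p.eval w‖ ≤ K * (1 + ‖w‖) ^ p.natDegree := by
  refine ⟨∑ i ∈ Finset.range (p.natDegree + 1), ‖p.coeff i‖,
    Finset.sum_nonneg fun _ _ => norm_nonneg _, fun w => ?_⟩
  rw [eval_eq_sum_range, Finset.sum_mul]
  refine (norm_sum_le _ _).trans (Finset.sum_le_sum fun i hi => ?_)
  rw [norm_mul, norm_pow]
  refine mul_le_mul_of_nonneg_left ?_ (norm_nonneg _)
  have h1 : (1 : ℝ) ≤ 1 + ‖w‖ := by linarith [norm_nonneg w]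
  calc ‖w‖ ^ i ≤ (1 + ‖w‖) ^ i := pow_le_pow_left₀ (norm_nonneg _) (by linarith) i
    _ ≤ _ := pow_le_pow_right₀ h1 (by simpa [Nat.lt_succ_iff] using hi)

theorem IsTempered.mono {u : C → ℂ} {B' : Set ℂ} (h : IsTempered z B u) (hB : B ⊆ B') :
    IsTempered z B' u :=
  ⟨fun D σ hs hd => h.diff D σ hs (hd.mono_right hB), by
    obtain ⟨K, N, hK⟩ := h.bound
    exact ⟨K, N, fun x hx => hK x fun h => hx (hB h)⟩⟩

theorem IsTempered.add {u v : C → ℂ} (hu : IsTempered z B u) (hv : IsTempered z B v) :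
    IsTempered z B fun x => u x + v x := by
  refine ⟨fun D σ hs hd => (hu.diff D σ hs hd).add (hv.diff D σ hs hd), ?_⟩
  obtain ⟨K, N, hK⟩ := hu.bound
  obtain ⟨K', N', hK'⟩ := hv.bound
  refine ⟨|K| + |K'|, max N N', fun x hx => ?_⟩
  have h1 : (1 : ℝ) ≤ 1 + ‖z x‖ := by linarith [norm_nonneg (z x)]
  calc ‖u x + v x‖ ≤ ‖u x‖ + ‖v x‖ := norm_add_le _ _
    _ ≤ |K| * (1 + ‖z x‖) ^ max N N' + |K'| * (1 + ‖z x‖) ^ max N N' := by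
      refine add_le_add ((hK x hx).trans ?_) ((hK' x hx).trans ?_)
      · exact mul_le_mul (le_abs_self K) (pow_le_pow_right₀ h1 (le_max_left _ _))
          (by positivity) (abs_nonneg _)
      · exact mul_le_mul (le_abs_self K') (pow_le_pow_right₀ h1 (le_max_right _ _))
          (by positivity) (abs_nonneg _)
    _ = _ := by ring

theorem IsTempered.mul {u v : C → ℂ} (hu : IsTempered z B u) (hv : IsTempered z B v) :
    IsTempered z B fun x => u x * v x := by
  refine ⟨fun D σ hs hd => (hu.diff D σ hs hd).mul (hv.diff D σ hs hd), ?_⟩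
  obtain ⟨K, N, hK⟩ := hu.bound
  obtain ⟨K', N', hK'⟩ := hv.bound
  refine ⟨K * K', N + N', fun x hx => ?_⟩
  rw [norm_mul]
  calc ‖u x‖ * ‖v x‖ ≤ (K * (1 + ‖z x‖) ^ N) * (K' * (1 + ‖z x‖) ^ N') :=
        mul_le_mul (hK x hx) (hK' x hx) (norm_nonneg _) ((norm_nonneg _).trans (hK x hx))
    _ = _ := by ring

theorem isTempered_eval (p : ℂ[X]) : IsTempered z B fun x => p.eval (z x) := by
  refine ⟨fun D σ hs _ => ?_, ?_⟩
  · refine p.differentiable.differentiableOn.congr fun w hw => ?_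
    rw [hs.sec w hw]
  · obtain ⟨K, -, hK⟩ := p.exists_norm_eval_le
    exact ⟨K, _, fun x _ => hK (z x)⟩

theorem isTempered_const (a : ℂ) : IsTempered z B fun _ => a := by
  simpa using isTempered_eval (z := z) (B := B) (Polynomial.C a)

theorem IsTempered.sum {ι : Type*} {s : Finset ι} {u : ι → C → ℂ}
    (h : ∀ i ∈ s, IsTempered z B (u i)) : IsTempered z B fun x => ∑ i ∈ s, u i x := by
  classical
  induction s using Finset.induction_on with
  | empty => simpa using isTempered_const 0
  | insert a s ha ih =>
    simp_rw [Finset.sum_insert ha]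
    exact (h a (by simp)).add (ih fun i hi => h i (by simp [hi]))

theorem IsTempered.pow {u : C → ℂ} (h : IsTempered z B u) (n : ℕ) :
    IsTempered z B fun x => u x ^ n := by
  induction n with
  | zero => simpa using isTempered_const 1
  | succ n ih => simpa [pow_succ] using ih.mul h

/-- There are functions of polynomial growth that separate some fibre. -/
theorem exists_separating [T2Space C] (hfin : ∀ w, (z ⁻¹' {w}).Finite) (hB : B.Finite)
    (hB0 : B.Nonempty) (hz : IsEvenlyCoveredOff z B) :
    ∃ (g : C → ℂ) (B' : Set ℂ), B'.Finite ∧ B ⊆ B' ∧ IsTempered z B' g ∧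
      (∀ x, z x ∈ B' → g x = 0) ∧
      (∀ β ∈ B', ∃ (K δ : ℝ), 0 < δ ∧ ∀ x, ‖z x - β‖ < δ → ‖g x‖ ≤ K * ‖z x - β‖) ∧
      ∃ w ∉ B', Set.InjOn g (z ⁻¹' {w}) := by
  classical
  obtain ⟨b, hb⟩ : ∃ b, b ∉ B := hB.infinite_compl.nonempty
  have hBcl : IsClosed B := hB.isClosed
  set r := infDist b B with hr
  have hr0 : 0 < r := (hBcl.notMem_iff_infDist_pos hB0).1 hb
  obtain ⟨n, σ, hσ, hσsurj, hσinj⟩ := hz b r hr0 disjoint_ball_infDist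
  have hbb : b ∈ ball b r := mem_ball_self hr0
  choose h M hM hdiff hbound hpole hzero using fun i =>
    exists_dipole hfin (hσ i) (half_pos hr0) (closedBall_subset_ball (half_lt_self hr0))
  set B' : Set ℂ := insert b B with hB'
  have hB'fin : B'.Finite := hB.insert b
  have hB'cl : IsClosed B' := hB'fin.isClosed
  have hB'ne : B'.Nonempty := ⟨b, Set.mem_insert _ _⟩
  -- The dipoles are `O(ρ⁻²)` at distance `ρ` from `B'` as `ρ` tends to `0`; the exponent `3` leaves
  -- one spare factor `ρ`, so the product vanishes over `B'`.
  set Q : ℂ[X] := ∏ β ∈ hB'fin.toFinset, (X - Polynomial.C β) ^ 3 with hQ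
  have hQeval : ∀ w, Q.eval w = ∏ β ∈ hB'fin.toFinset, (w - β) ^ 3 := by
    intro w; rw [hQ, eval_prod]; simp
  -- There is one dipole for each point over `b`. The distinct coefficients give the double poles at
  -- these points distinct leading coefficients, so `u` takes different values on different sheets
  -- near `b`.
  set u : C → ℂ := fun x => ∑ i : Fin n, ((i : ℕ) : ℂ) * h i x with hu
  set MM : ℝ := ∑ i : Fin n, (i : ℝ) * M i with hMM
  have hMM0 : 0 ≤ MM := Finset.sum_nonneg fun i _ => mul_nonneg (by positivity) (hM i)
  have hub : ∀ x, z x ∉ B' → ‖u x‖ ≤ MM * ((infDist (z x) B')⁻¹ + (infDist (z x) B' ^ 2)⁻¹) := by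
    intro x hx
    have hρ : 0 < infDist (z x) B' := (hB'cl.notMem_iff_infDist_pos hB'ne).1 hx
    have hdisj : Disjoint (ball (z x) (infDist (z x) B')) B' := disjoint_ball_infDist
    obtain ⟨m, τ, hτ, hτs, -⟩ := (hz.mono (Set.subset_insert b B)) (z x) _ hρ hdisj
    obtain ⟨j, hj⟩ := hτs (z x) (mem_ball_self hρ) x rfl
    rw [hu, hMM, Finset.sum_mul]
    refine (norm_sum_le _ _).trans (Finset.sum_le_sum fun i _ => ?_)
    have := hbound i _ (τ j) (hτ j)
      (fun hb' => hdisj.le_bot ⟨hb', Set.mem_insert _ _⟩) (z x) _ hρ subset_rfl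
    rw [hj] at this
    rw [norm_mul, Complex.norm_natCast, mul_assoc]
    exact mul_le_mul_of_nonneg_left this (by positivity)
  -- the factor `Q` compensates the poles
  have hfac : ∀ β ∈ B', ∃ p : ℂ[X], ∀ w, Q.eval w = (w - β) ^ 3 * p.eval w := by
    intro β hβ
    refine ⟨∏ γ ∈ hB'fin.toFinset.erase β, (X - Polynomial.C γ) ^ 3, fun w => ?_⟩
    rw [hQ, ← Finset.mul_prod_erase _ _ (hB'fin.mem_toFinset.2 hβ), eval_mul]
    simp
  choose! p hp using hfac
  choose Kp hKp0 hKp using fun q : ℂ[X] => q.exists_norm_eval_le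
  -- Sums over `B'` dominate each term, so one bound serves whichever `β` is nearest to `z x`.
  set K₀ : ℝ := ∑ β ∈ hB'fin.toFinset, Kp (p β) with hK₀
  set N₀ : ℕ := ∑ β ∈ hB'fin.toFinset, (p β).natDegree with hN₀
  have hgb : ∀ x, z x ∉ B' → ‖Q.eval (z x) * u x‖ ≤
      infDist (z x) B' * (MM * (1 + infDist (z x) B') * (K₀ * (1 + ‖z x‖) ^ N₀)) := by
    intro x hx
    have hρ : 0 < infDist (z x) B' := (hB'cl.notMem_iff_infDist_pos hB'ne).1 hx
    obtain ⟨β, hβ, hβd⟩ := hB'fin.isCompact.exists_infDist_eq_dist hB'ne (z x)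
    set ρ := infDist (z x) B' with hρdef
    have hK₀0 : 0 ≤ K₀ := Finset.sum_nonneg fun _ _ => hKp0 _
    have hmem : β ∈ hB'fin.toFinset := hB'fin.mem_toFinset.2 hβ
    have h1 : (1 : ℝ) ≤ 1 + ‖z x‖ := by linarith [norm_nonneg (z x)]
    have h2 : ‖(p β).eval (z x)‖ ≤ K₀ * (1 + ‖z x‖) ^ N₀ := by
      refine (hKp (p β) (z x)).trans (mul_le_mul ?_ (pow_le_pow_right₀ h1 ?_) (by positivity)
        (Finset.sum_nonneg fun _ _ => hKp0 _))
      · exact Finset.single_le_sum (f := fun β => Kp (p β)) (fun _ _ => hKp0 _) hmem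
      · exact Finset.single_le_sum (f := fun β => (p β).natDegree) (fun _ _ => Nat.zero_le _) hmem
    rw [hp β hβ, norm_mul, norm_mul, norm_pow, ← dist_eq_norm, ← hβd]
    have h3 := hub x hx
    rw [← hρdef] at h3
    calc ρ ^ 3 * ‖(p β).eval (z x)‖ * ‖u x‖
        ≤ ρ ^ 3 * (K₀ * (1 + ‖z x‖) ^ N₀) * (MM * (ρ⁻¹ + (ρ ^ 2)⁻¹)) := by gcongr
      _ = _ := by field_simp; ring
  refine ⟨fun x => Q.eval (z x) * u x, B', hB'fin, Set.subset_insert b B, ⟨?_, ?_⟩, ?_, ?_, ?_⟩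
  · intro D τ hs hd
    have hbD : b ∉ D := fun h => hd.le_bot ⟨h, Set.mem_insert _ _⟩
    refine ((isTempered_eval (z := z) (B := B') Q).diff D τ hs hd).mul ?_
    simp only [hu]
    refine DifferentiableOn.fun_sum fun i _ => ?_
    exact (hdiff i D τ hs hbD).const_mul _
  · refine ⟨(1 + ‖b‖) * (MM * (2 + ‖b‖) * K₀), N₀ + 2, fun x hx => ?_⟩
    refine (hgb x hx).trans ?_
    have h1 : infDist (z x) B' ≤ ‖z x‖ + ‖b‖ :=
      (infDist_le_dist_of_mem (Set.mem_insert _ _)).trans (by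
        rw [dist_eq_norm]; exact norm_sub_le _ _)
    have h0 : 0 ≤ infDist (z x) B' := infDist_nonneg
    have hK₀0 : 0 ≤ K₀ := Finset.sum_nonneg fun _ _ => hKp0 _
    have h2 : infDist (z x) B' ≤ (1 + ‖b‖) * (1 + ‖z x‖) := by
      nlinarith [norm_nonneg b, norm_nonneg (z x)]
    have h3 : 1 + infDist (z x) B' ≤ (2 + ‖b‖) * (1 + ‖z x‖) := by
      nlinarith [norm_nonneg b, norm_nonneg (z x)]
    calc _ ≤ ((1 + ‖b‖) * (1 + ‖z x‖)) * (MM * ((2 + ‖b‖) * (1 + ‖z x‖)) *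
          (K₀ * (1 + ‖z x‖) ^ N₀)) := by gcongr
      _ = _ := by ring
  · intro x hx
    simp only [hp _ hx]; simp
  · intro β hβ
    have hK₀0 : 0 ≤ K₀ := Finset.sum_nonneg fun _ _ => hKp0 _
    refine ⟨MM * 2 * (K₀ * (2 + ‖β‖) ^ N₀), 1, one_pos, fun x hxδ => ?_⟩
    by_cases hx : z x ∈ B'
    · simp only [hp _ hx, sub_self]
      rw [zero_pow three_ne_zero, zero_mul, zero_mul, norm_zero]; positivity
    · have h1 : infDist (z x) B' ≤ ‖z x - β‖ := by
        rw [← dist_eq_norm]; exact infDist_le_dist_of_mem hβ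
      have h2 : 1 + ‖z x‖ ≤ 2 + ‖β‖ := by
        have := norm_add_le (z x - β) β
        rw [sub_add_cancel] at this
        linarith
      refine (hgb x hx).trans ?_
      have h0 : 0 ≤ infDist (z x) B' := infDist_nonneg
      calc _ ≤ ‖z x - β‖ * (MM * (1 + 1) * (K₀ * (2 + ‖β‖) ^ N₀)) := by
            gcongr; linarith
        _ = _ := by ring
  · -- separation of the points over some `w` near `b`
    have hlim : ∀ j k, Tendsto (fun w => (w - b) ^ 2 * (u (σ j w) - u (σ k w))) (𝓝[≠] b)
        (𝓝 (((j : ℕ) : ℂ) * -bumpMass - ((k : ℕ) : ℂ) * -bumpMass)) := by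
      have hl : ∀ j, Tendsto (fun w => (w - b) ^ 2 * u (σ j w)) (𝓝[≠] b)
          (𝓝 (((j : ℕ) : ℂ) * -bumpMass)) := by
        intro j
        have e1 : ∀ w, (w - b) ^ 2 * u (σ j w) =
            ∑ i : Fin n, ((i : ℕ) : ℂ) * ((w - b) ^ 2 * h i (σ j w)) := by
          intro w; simp only [hu, Finset.mul_sum]
          exact Finset.sum_congr rfl fun i _ => by ring
        have e2 : ((j : ℕ) : ℂ) * -(bumpMass : ℂ) =
            ∑ i : Fin n, ((i : ℕ) : ℂ) * (if i = j then -(bumpMass : ℂ) else 0) := by simp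
        simp_rw [e1]
        rw [e2]
        refine tendsto_finsetSum _ fun i _ => Tendsto.const_mul _ ?_
        split_ifs with hij
        · subst hij; exact hpole i
        · exact hzero i _ (σ j) (hσ j) hbb fun he => hij (hσinj b hbb he).symm
      intro j k
      refine ((hl j).sub (hl k)).congr fun w => by ring
    have hev : ∀ j k, j ≠ k → ∀ᶠ w in 𝓝[≠] b, u (σ j w) ≠ u (σ k w) := by
      intro j k hjk
      have hne : ((j : ℕ) : ℂ) * -(bumpMass : ℂ) - ((k : ℕ) : ℂ) * -(bumpMass : ℂ) ≠ 0 := by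
        rw [← sub_mul]
        refine mul_ne_zero ?_ (neg_ne_zero.2 (by exact_mod_cast bumpMass_pos.ne'))
        rw [sub_ne_zero]
        exact fun h => hjk (Fin.ext (by exact_mod_cast h))
      filter_upwards [(hlim j k).eventually_ne hne] with w hw he
      rw [he, sub_self, mul_zero] at hw
      exact hw rfl
    have hev2 : ∀ᶠ w in 𝓝[≠] b, w ∉ B' := by
      filter_upwards [self_mem_nhdsWithin,
        nhdsWithin_le_nhds (hBcl.isOpen_compl.mem_nhds hb)] with w h1 h2 h3
      exact h3.elim h1 h2
    have hev3 : ∀ᶠ w in 𝓝[≠] b, w ∈ ball b r := nhdsWithin_le_nhds (ball_mem_nhds b hr0)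
    have hev4 : ∀ᶠ w in 𝓝[≠] b, ∀ j k, j ≠ k → u (σ j w) ≠ u (σ k w) := by
      simp only [eventually_all]
      exact hev
    obtain ⟨w, hw2, hw3, hw4⟩ := (hev2.and (hev3.and hev4)).exists
    refine ⟨w, hw2, fun x hx y hy hxy => ?_⟩
    obtain ⟨j, rfl⟩ := hσsurj w hw3 x hx
    obtain ⟨k, rfl⟩ := hσsurj w hw3 y hy
    have hQ0 : Q.eval w ≠ 0 := by
      rw [hQeval]
      refine Finset.prod_ne_zero_iff.2 fun β hβ => pow_ne_zero 3 (sub_ne_zero.2 ?_)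
      rintro rfl
      exact hw2 (hB'fin.mem_toFinset.1 hβ)
    by_contra hne
    have hjk : j ≠ k := fun h => hne (by rw [h])
    have hx' : z (σ j w) = w := hx
    have hy' : z (σ k w) = w := hy
    simp only [hx', hy'] at hxy
    exact hw4 j k hjk (mul_left_cancel₀ hQ0 hxy)

end Tempered

/-! ### Symmetric functions on the fibres are polynomials in `z`. -/

section FiberPolynomials

open Filter Topology Metric Polynomial

/-- Riemann's theorem on removable singularities, applied at each point of `B` separately. -/
theorem exists_differentiable_extension {c : ℂ → ℂ} {B : Set ℂ} (hB : B.Finite)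
    (hc : DifferentiableOn ℂ c Bᶜ)
    (hb : ∀ β ∈ B, ∃ K : ℝ, ∀ᶠ w in 𝓝[≠] β, ‖c w‖ ≤ K) :
    ∃ e : ℂ → ℂ, Differentiable ℂ e ∧ ∀ w ∉ B, e w = c w := by
  classical
  refine ⟨fun w => if w ∈ B then limUnder (𝓝[≠] w) c else c w, fun w => ?_, fun w hw => if_neg hw⟩
  by_cases hw : w ∈ B
  · obtain ⟨K, hK⟩ := hb w hw
    have hB' : IsClosed (B \ {w}) := (hB.subset Set.sdiff_subset).isClosed
    have h1 : (B \ {w})ᶜ ∈ 𝓝 w := hB'.isOpen_compl.mem_nhds (by simp)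
    obtain ⟨s, hs, hsK⟩ : ∃ s ∈ 𝓝 w, ∀ v ∈ s, v ≠ w → ‖c v‖ ≤ K :=
      ⟨_, mem_nhdsWithin_iff_eventually.1 hK |> fun h => h, fun v hv h => hv h⟩
    have hmem : ∀ v ∈ s ∩ (B \ {w})ᶜ, v ≠ w → v ∉ B := fun v hv h h' => hv.2 ⟨h', h⟩
    have key := Complex.differentiableOn_update_limUnder_of_bddAbove (f := c)
      (inter_mem hs h1) (fun v hv => (hc.differentiableAt
        (hB.isClosed.isOpen_compl.mem_nhds (hmem v hv.1 hv.2))).differentiableWithinAt)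
      ⟨K, by rintro _ ⟨v, hv, rfl⟩; exact hsK v hv.1.1 hv.2⟩
    refine (key.differentiableAt (inter_mem hs h1)).congr_of_eventuallyEq ?_
    filter_upwards [inter_mem hs h1] with v hv
    by_cases hvw : v = w
    · subst hvw; simp [hw]
    · simp [hvw, hmem v hv hvw]
  · refine (hc.differentiableAt (hB.isClosed.isOpen_compl.mem_nhds hw)).congr_of_eventuallyEq ?_
    filter_upwards [hB.isClosed.isOpen_compl.mem_nhds hw] with v hv
    exact if_neg hv

/-- A holomorphic function off a finite set which grows polynomially is a polynomial. -/
theorem exists_polynomial_of_growth {c : ℂ → ℂ} {B : Set ℂ} (hB : B.Finite)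
    (hc : DifferentiableOn ℂ c Bᶜ) {K : ℝ} {N : ℕ}
    (hb : ∀ w ∉ B, ‖c w‖ ≤ K * (1 + ‖w‖) ^ N) : ∃ p : ℂ[X], ∀ w ∉ B, c w = p.eval w := by
  obtain ⟨e, he, hec⟩ := exists_differentiable_extension hB hc (by
    intro β _
    have hcont : ContinuousAt (fun w : ℂ => K * (1 + ‖w‖) ^ N) β := by fun_prop
    refine ⟨K * (1 + ‖β‖) ^ N + 1, ?_⟩
    have h2 : ∀ᶠ w in 𝓝[≠] β, w ∉ B := by
      filter_upwards [self_mem_nhdsWithin, nhdsWithin_le_nhds ((hB.subset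
        (Set.sdiff_subset (s := B) (t := {β}))).isClosed.isOpen_compl.mem_nhds (by simp))]
        with w h1 h3 h4
      exact h3 ⟨h4, h1⟩
    filter_upwards [h2, nhdsWithin_le_nhds (hcont.eventually_lt_const (lt_add_one _))] with w h1 h3
    exact (hb w h1).trans h3.le)
  obtain ⟨R₀, hR₀⟩ := hB.isBounded.exists_norm_le
  -- Cauchy's estimate on circles of radius `R` enclosing `B`, with `1 + R ≤ 2 R`; for `n > N` the
  -- bound is `O(1 / R)`.
  have hzero : ∀ n, N < n → iteratedDeriv n e 0 = 0 := by
    intro n hn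
    rw [← norm_le_zero_iff]
    have hlim : Tendsto (fun R : ℝ => n.factorial * (|K| * 2 ^ N) * R⁻¹) atTop (𝓝 0) := by
      simpa using tendsto_inv_atTop_zero.const_mul (n.factorial * (|K| * 2 ^ N) : ℝ)
    refine ge_of_tendsto hlim ?_
    filter_upwards [eventually_gt_atTop R₀, eventually_ge_atTop 1] with R hR hR1
    have hR0 : 0 < R := by linarith
    refine (Complex.norm_iteratedDeriv_le_of_forall_mem_sphere_norm_le n hR0 he.diffContOnCl
      (C := |K| * (2 * R) ^ N) fun w hw => ?_).trans ?_
    · have hw' : ‖w‖ = R := by simpa using hw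
      have hwB : w ∉ B := fun h => by linarith [hR₀ w h]
      rw [hec w hwB]
      refine (hb w hwB).trans ?_
      rw [hw']
      exact mul_le_mul (le_abs_self K) (pow_le_pow_left₀ (by linarith) (by linarith) N)
        (by positivity) (abs_nonneg _)
    · obtain ⟨m, rfl⟩ : ∃ m, n = N + 1 + m := ⟨n - (N + 1), by omega⟩
      rw [div_le_iff₀ (by positivity), mul_pow]
      have : R⁻¹ * R ^ (N + 1 + m) = R ^ N * R ^ m := by field_simp; ring
      calc ((N + 1 + m).factorial : ℝ) * (|K| * (2 ^ N * R ^ N))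
          = (N + 1 + m).factorial * (|K| * 2 ^ N) * (R ^ N * 1) := by ring
        _ ≤ (N + 1 + m).factorial * (|K| * 2 ^ N) * (R ^ N * R ^ m) := by
            gcongr; exact one_le_pow₀ hR1
        _ = _ := by rw [← this]; ring
  refine ⟨∑ n ∈ Finset.range (N + 1),
    Polynomial.C ((n.factorial : ℂ)⁻¹ * iteratedDeriv n e 0) * X ^ n, fun w hw => ?_⟩
  rw [← hec w hw, ← Complex.taylorSeries_eq_of_entire' 0 w he, tsum_eq_sum (s := Finset.range (N + 1))]
  · simp [eval_finsetSum]
  · intro n hn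
    rw [hzero n (by simpa using hn), mul_zero, zero_mul]

/-- If all values of a family of polynomials of bounded degree depend polynomially on the
parameter, then so do the coefficients. -/
theorem exists_coeff_polynomials {B : Set ℂ} {d : ℕ} {H : ℂ → ℂ[X]}
    (hd : ∀ w ∉ B, (H w).natDegree ≤ d)
    (hp : ∀ a : ℂ, ∃ p : ℂ[X], ∀ w ∉ B, (H w).eval a = p.eval w) :
    ∃ c : ℕ → ℂ[X], ∀ w ∉ B, ∀ k, (H w).coeff k = (c k).eval w := by
  choose p hp using hp
  have hinj : Set.InjOn (fun i : ℕ => (i : ℂ)) (Finset.range (d + 1)) := Nat.cast_injective.injOn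
  -- The values at the fixed nodes `0, …, d` determine each coefficient by a linear formula
  -- independent of `w`.
  refine ⟨fun k => ∑ i ∈ Finset.range (d + 1), p i *
    C ((Lagrange.basis (Finset.range (d + 1)) (fun i : ℕ => (i : ℂ)) i).coeff k),
    fun w hw k => ?_⟩
  have hdeg : (H w).degree < (Finset.range (d + 1)).card := by
    rw [Finset.card_range]
    exact (degree_le_of_natDegree_le (hd w hw)).trans_lt (by exact_mod_cast Nat.lt_succ_self d)
  conv_lhs => rw [Lagrange.eq_interpolate hinj hdeg, Lagrange.interpolate_apply, finsetSum_coeff]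
  simp [eval_finsetSum, hp _ w hw]

theorem norm_fiber_prod_le {C : Type*} {z : C → ℂ} {B : Set ℂ} {g : C → ℂ} {K : ℝ} {N : ℕ} (hK : 1 ≤ K)
    (hg : ∀ x, z x ∉ B → ‖g x‖ ≤ K * (1 + ‖z x‖) ^ N) {w : ℂ} (hw : w ∉ B) {s : Finset C}
    (hs : ∀ y ∈ s, z y = w) {d : ℕ} (hd : s.card ≤ d) :
    ‖∏ y ∈ s, g y‖ ≤ K ^ d * (1 + ‖w‖) ^ (N * d) := by
  have h1 : (1 : ℝ) ≤ 1 + ‖w‖ := by linarith [norm_nonneg w]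
  have hb : ∀ y ∈ s, ‖g y‖ ≤ K * (1 + ‖w‖) ^ N := fun y hy => by
    have := hg y (by rwa [hs y hy])
    rwa [hs y hy] at this
  rw [norm_prod]
  calc ∏ y ∈ s, ‖g y‖ ≤ ∏ y ∈ s, (K * (1 + ‖w‖) ^ N) :=
        Finset.prod_le_prod (fun _ _ => norm_nonneg _) hb
    _ = (K * (1 + ‖w‖) ^ N) ^ s.card := Finset.prod_const _
    _ ≤ (K * (1 + ‖w‖) ^ N) ^ d := pow_le_pow_right₀ (one_le_mul_of_one_le_of_one_le hK
        (one_le_pow₀ h1)) hd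
    _ = _ := by rw [mul_pow, pow_mul]

variable {C : Type*} [TopologicalSpace C] {z : C → ℂ} {B : Set ℂ}

open Classical in
theorem exists_sheets (hfin : ∀ w, (z ⁻¹' {w}).Finite) (hB : B.Finite)
    (hz : IsEvenlyCoveredOff z B) {w : ℂ} (hw : w ∉ B) :
    ∃ (D : Set ℂ) (n : ℕ) (σ : Fin n → ℂ → C), D ∈ 𝓝 w ∧ Disjoint D B ∧
      (∀ i, IsSheet z D (σ i)) ∧ (∀ v ∈ D, Function.Injective fun i => σ i v) ∧
      ∀ v ∈ D, (hfin v).toFinset = Finset.univ.image fun i => σ i v := by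
  obtain ⟨r, hr, hrB⟩ := Metric.isOpen_iff.1 hB.isClosed.isOpen_compl w hw
  have hd : Disjoint (ball w r) B := Set.disjoint_left.2 hrB
  obtain ⟨n, σ, hσ, hs, hi⟩ := hz w r hr hd
  refine ⟨ball w r, n, σ, ball_mem_nhds w hr, hd, hσ, hi, fun v hv => ?_⟩
  ext y
  simp only [Set.Finite.mem_toFinset, Set.mem_preimage, Set.mem_singleton_iff, Finset.mem_image,
    Finset.mem_univ, true_and]
  exact ⟨fun h => hs v hv y h, by rintro ⟨i, rfl⟩; exact (hσ i).sec v hv⟩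

/-- Even covering makes the number of points locally constant, and the complement of a finite set in
the plane is connected. -/
theorem exists_card_fiber (hfin : ∀ w, (z ⁻¹' {w}).Finite) (hB : B.Finite)
    (hz : IsEvenlyCoveredOff z B) : ∃ d, ∀ w ∉ B, (hfin w).toFinset.card = d := by
  classical
  obtain ⟨b, hb⟩ : ∃ b, b ∉ B := hB.infinite_compl.nonempty
  have hconn : IsPreconnected Bᶜ := (hB.countable.isPathConnected_compl_of_one_lt_rank (by
    rw [Complex.rank_real_complex]; norm_num)).isConnected.isPreconnected
  refine ⟨(hfin b).toFinset.card, fun w hw => hconn.constant (f := fun w => (hfin w).toFinset.card)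
    (fun v hv => ?_) hw hb⟩
  obtain ⟨D, n, σ, hD, -, hσ, hi, hs⟩ := exists_sheets hfin hB hz hv
  have hn : ∀ u ∈ D, (hfin u).toFinset.card = n := fun u hu => by
    rw [hs u hu, Finset.card_image_of_injective _ (hi u hu), Finset.card_fin]
  have hev : (fun u => (hfin u).toFinset.card) =ᶠ[𝓝 v] fun _ => n := by
    filter_upwards [hD] with u hu using hn u hu
  exact hev.continuousAt.continuousWithinAt

theorem IsTempered.congr {u v : C → ℂ} (h : IsTempered z B u) (huv : ∀ x, u x = v x) :
    IsTempered z B v := by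
  rwa [← funext huv]

theorem IsTempered.exists_one_le {u : C → ℂ} (h : IsTempered z B u) :
    ∃ (K : ℝ) (N : ℕ), 1 ≤ K ∧ ∀ x, z x ∉ B → ‖u x‖ ≤ K * (1 + ‖z x‖) ^ N := by
  obtain ⟨K, N, hK⟩ := h.bound
  refine ⟨max K 1, N, le_max_right _ _, fun x hx => (hK x hx).trans ?_⟩
  have : 0 ≤ 1 + ‖z x‖ := by positivity
  exact mul_le_mul_of_nonneg_right (le_max_left _ _) (pow_nonneg this N)

theorem IsTempered.const_sub {u : C → ℂ} (h : IsTempered z B u) (a : ℂ) :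
    IsTempered z B fun x => a - u x := by
  refine ((isTempered_const a).add ((isTempered_const (-1)).mul h)).congr fun x => ?_
  ring

/-- The product does not depend on the labelling of the sheets, so it is a single-valued holomorphic
function of `w`, with growth inherited from `g`. -/
theorem exists_polynomial_fiber_prod (hfin : ∀ w, (z ⁻¹' {w}).Finite) (hB : B.Finite)
    (hz : IsEvenlyCoveredOff z B) {g : C → ℂ} (hg : IsTempered z B g) :
    ∃ p : ℂ[X], ∀ w ∉ B, ∏ y ∈ (hfin w).toFinset, g y = p.eval w := by
  classical
  obtain ⟨K, N, hK, hgK⟩ := hg.exists_one_le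
  obtain ⟨d, hd⟩ := exists_card_fiber hfin hB hz
  refine exists_polynomial_of_growth hB (K := K ^ d) (N := N * d) (fun w hw => ?_) fun w hw =>
    norm_fiber_prod_le hK hgK hw (fun y hy => by simpa using hy) (hd w hw).le
  obtain ⟨D, n, σ, hD, hDB, hσ, hi, hs⟩ := exists_sheets hfin hB hz hw
  have hdiff : DifferentiableOn ℂ (fun v => ∏ i, g (σ i v)) D :=
    DifferentiableOn.fun_finsetProd fun i _ => hg.diff D _ (hσ i) hDB
  refine ((hdiff.differentiableAt hD).congr_of_eventuallyEq ?_).differentiableWithinAt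
  filter_upwards [hD] with v hv
  rw [hs v hv, Finset.prod_image (hi v hv).injOn]

-- Again a symmetric expression. With `a - g` in place of `g` it gives the value at `a` of the
-- unnormalized Lagrange interpolant of `u`.
open Classical in
theorem exists_polynomial_fiber_sum_erase (hfin : ∀ w, (z ⁻¹' {w}).Finite) (hB : B.Finite)
    (hz : IsEvenlyCoveredOff z B) {u g : C → ℂ} (hu : IsTempered z B u)
    (hg : IsTempered z B g) :
    ∃ p : ℂ[X], ∀ w ∉ B,
      ∑ x ∈ (hfin w).toFinset, u x * ∏ y ∈ (hfin w).toFinset.erase x, g y = p.eval w := by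
  obtain ⟨K, N, hK, hgK⟩ := hg.exists_one_le
  obtain ⟨K', N', hK', huK⟩ := hu.exists_one_le
  obtain ⟨d, hd⟩ := exists_card_fiber hfin hB hz
  refine exists_polynomial_of_growth hB (K := d * (K' * K ^ d)) (N := N' + N * d) (fun w hw => ?_)
    fun w hw => ?_
  · obtain ⟨D, n, σ, hD, hDB, hσ, hi, hs⟩ := exists_sheets hfin hB hz hw
    have hdiff : DifferentiableOn ℂ
        (fun v => ∑ i, u (σ i v) * ∏ j ∈ Finset.univ.erase i, g (σ j v)) D :=
      DifferentiableOn.fun_sum fun i _ => (hu.diff D _ (hσ i) hDB).mul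
        (DifferentiableOn.fun_finsetProd fun j _ => hg.diff D _ (hσ j) hDB)
    refine ((hdiff.differentiableAt hD).congr_of_eventuallyEq ?_).differentiableWithinAt
    filter_upwards [hD] with v hv
    rw [hs v hv, Finset.sum_image (hi v hv).injOn]
    refine Finset.sum_congr rfl fun i _ => ?_
    rw [← Finset.image_erase (hi v hv), Finset.prod_image (hi v hv).injOn]
  · have key : ∀ x ∈ (hfin w).toFinset,
        ‖u x * ∏ y ∈ (hfin w).toFinset.erase x, g y‖ ≤ K' * K ^ d * (1 + ‖w‖) ^ (N' + N * d) := by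
      intro x hx
      have hx' : z x = w := by simpa using hx
      have h1 := huK x (by rwa [hx'])
      have h2 := norm_fiber_prod_le (s := (hfin w).toFinset.erase x) hK hgK hw
        (fun y hy => by simpa using Finset.mem_of_mem_erase hy)
        ((Finset.card_le_card (Finset.erase_subset _ _)).trans (hd w hw).le)
      rw [norm_mul]
      rw [hx'] at h1
      calc _ ≤ (K' * (1 + ‖w‖) ^ N') * (K ^ d * (1 + ‖w‖) ^ (N * d)) := by gcongr
        _ = _ := by ring
    refine (norm_sum_le _ _).trans ((Finset.sum_le_card_nsmul _ _ _ key).trans_eq ?_)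
    rw [hd w hw, nsmul_eq_mul]; ring

/-- The polynomial in `Y` with roots the values of `g` on the fibre has coefficients that are
polynomials. -/
theorem exists_nodal_coeff (hfin : ∀ w, (z ⁻¹' {w}).Finite) (hB : B.Finite)
    (hz : IsEvenlyCoveredOff z B) {g : C → ℂ} (hg : IsTempered z B g) :
    ∃ c : ℕ → ℂ[X], ∀ w ∉ B, ∀ k, (Lagrange.nodal (hfin w).toFinset g).coeff k = (c k).eval w := by
  obtain ⟨d, hd⟩ := exists_card_fiber hfin hB hz
  refine exists_coeff_polynomials (d := d) (fun w hw => by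
    rw [Lagrange.natDegree_nodal, hd w hw]) fun a => ?_
  obtain ⟨p, hp⟩ := exists_polynomial_fiber_prod hfin hB hz (hg.const_sub a)
  exact ⟨p, fun w hw => by rw [Lagrange.eval_nodal, hp w hw]⟩

/-- Lagrange interpolation on the fibres of `z`. -/
theorem exists_interpolation_coeff (hfin : ∀ w, (z ⁻¹' {w}).Finite) (hB : B.Finite)
    (hz : IsEvenlyCoveredOff z B) {d : ℕ} (hd : ∀ w ∉ B, (hfin w).toFinset.card = d)
    {u g : C → ℂ} (hu : IsTempered z B u) (hg : IsTempered z B g) :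
    ∃ l : ℕ → ℂ[X], ∀ x, z x ∉ B →
      u x * (derivative (Lagrange.nodal (hfin (z x)).toFinset g)).eval (g x) =
        ∑ k ∈ Finset.range d, (l k).eval (z x) * g x ^ k := by
  classical
  -- Lagrange's interpolant without its denominators. At `g x` only the summand of `x` survives, and
  -- it equals `u x` times the derivative of the nodal polynomial.
  set H : ℂ → ℂ[X] := fun w => ∑ x ∈ (hfin w).toFinset,
    Polynomial.C (u x) * Lagrange.nodal ((hfin w).toFinset.erase x) g with hH
  have hdeg : ∀ w ∉ B, (H w).natDegree ≤ d - 1 := fun w hw =>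
    natDegree_sum_le_of_forall_le _ _ fun x hx => by
      refine (natDegree_C_mul_le _ _).trans ?_
      rw [Lagrange.natDegree_nodal, Finset.card_erase_of_mem hx, hd w hw]
  obtain ⟨l, hl⟩ := exists_coeff_polynomials hdeg fun a => by
    obtain ⟨p, hp⟩ := exists_polynomial_fiber_sum_erase hfin hB hz hu (hg.const_sub a)
    exact ⟨p, fun w hw => by
      rw [← hp w hw, hH]; simp [eval_finsetSum, Lagrange.eval_nodal]⟩
  refine ⟨l, fun x hx => ?_⟩
  have hxm : x ∈ (hfin (z x)).toFinset := by simp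
  have hd0 : 0 < d := by rw [← hd _ hx]; exact Finset.card_pos.2 ⟨x, hxm⟩
  have h1 : (H (z x)).eval (g x) =
      u x * (derivative (Lagrange.nodal (hfin (z x)).toFinset g)).eval (g x) := by
    rw [Lagrange.eval_nodal_derivative_eval_node_eq hxm, hH, eval_finsetSum,
      Finset.sum_eq_single x]
    · simp
    · intro y _ hyx
      rw [eval_mul, Lagrange.eval_nodal_at_node (Finset.mem_erase.2 ⟨hyx.symm, hxm⟩), mul_zero]
    · exact fun h => (h hxm).elim
  rw [← h1, eval_eq_sum_range' (n := d) (by have := hdeg _ hx; omega)]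
  exact Finset.sum_congr rfl fun k _ => by rw [hl _ hx]

/-- A function which separates one fibre separates almost all fibres. -/
theorem exists_discriminant (hfin : ∀ w, (z ⁻¹' {w}).Finite) (hB : B.Finite)
    (hz : IsEvenlyCoveredOff z B) {g : C → ℂ} (hg : IsTempered z B g) {w₀ : ℂ} (hw₀ : w₀ ∉ B)
    (hinj : Set.InjOn g (z ⁻¹' {w₀})) :
    ∃ B' : Set ℂ, B'.Finite ∧ B ⊆ B' ∧ ∀ w ∉ B', Set.InjOn g (z ⁻¹' {w}) := by
  classical
  obtain ⟨d, hd⟩ := exists_card_fiber hfin hB hz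
  obtain ⟨c, hc⟩ := exists_nodal_coeff hfin hB hz hg
  -- The derivative of the nodal polynomial at `g x`, written through `z` and `g` so that it is
  -- visibly tempered. Its product over a fibre is, up to sign, the discriminant, which is thus a
  -- polynomial in `w`, nonzero at `w₀`.
  set G : C → ℂ := fun x => ∑ k ∈ Finset.range (d + 1), ((c (k + 1)).eval (z x) * (k + 1)) * g x ^ k
    with hG
  have hGt : IsTempered z B G := IsTempered.sum fun k _ =>
    ((isTempered_eval _).mul (isTempered_const _)).mul (hg.pow k)
  have hGx : ∀ x, z x ∉ B → G x = ∏ y ∈ (hfin (z x)).toFinset.erase x, (g x - g y) := by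
    intro x hx
    rw [← Lagrange.eval_nodal, ← Lagrange.eval_nodal_derivative_eval_node_eq (by simp),
      eval_eq_sum_range' (n := d + 1)]
    · exact Finset.sum_congr rfl fun k _ => by rw [coeff_derivative, hc _ hx]
    · refine (natDegree_derivative_le _).trans_lt ?_
      rw [Lagrange.natDegree_nodal, hd _ hx]; omega
  obtain ⟨p, hp⟩ := exists_polynomial_fiber_prod hfin hB hz hGt
  have hp0 : p ≠ 0 := by
    rintro rfl
    have h := hp w₀ hw₀
    rw [eval_zero, Finset.prod_eq_zero_iff] at h
    obtain ⟨x, hx, h⟩ := h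
    have hx' : z x = w₀ := by simpa using hx
    rw [hGx x (by rwa [hx']), Finset.prod_eq_zero_iff] at h
    obtain ⟨y, hy, h⟩ := h
    rw [hx'] at hy
    refine Finset.ne_of_mem_erase hy (hinj (by simpa using Finset.mem_of_mem_erase hy) hx' ?_)
    exact (sub_eq_zero.1 h).symm
  refine ⟨B ∪ {w | p.IsRoot w}, hB.union (finite_setOfPred_isRoot hp0), Set.subset_union_left,
    fun w hw x hx y hy hxy => ?_⟩
  rw [Set.mem_union, not_or] at hw
  by_contra hne
  refine hw.2 ?_
  have hx' : z x = w := hx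
  change p.eval w = 0
  rw [← hp w hw.1]
  refine Finset.prod_eq_zero (i := x) (by simpa using hx) ?_
  rw [hGx x (by rw [hx']; exact hw.1)]
  refine Finset.prod_eq_zero (i := y) (Finset.mem_erase.2 ⟨fun h => hne h.symm, ?_⟩)
    (sub_eq_zero.2 hxy)
  rw [hx']; simpa using hy

end FiberPolynomials

/-! ### Local function theory on the surface and the identity theorem. -/

section Surface

open Filter Topology Metric

theorem finite_of_eventually_nhdsNE {C : Type*} [TopologicalSpace C] [CompactSpace C] {S : Set C}
    (h : ∀ x, ∀ᶠ y in 𝓝[≠] x, y ∉ S) : S.Finite := by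
  by_contra hS
  obtain ⟨x, hx⟩ := Set.Infinite.exists_accPt_principal hS
  rw [accPt_iff_frequently_nhdsNE] at hx
  exact hx (h x)

theorem eventually_nhdsNE_notMem_of_finite {C : Type*} [TopologicalSpace C] [T2Space C] {S : Set C} (hS : S.Finite) (x : C) :
    ∀ᶠ y in 𝓝[≠] x, y ∉ S := by
  have h : (S \ {x})ᶜ ∈ 𝓝 x := (hS.subset Set.sdiff_subset).isClosed.isOpen_compl.mem_nhds (by simp)
  filter_upwards [nhdsWithin_le_nhds h, self_mem_nhdsWithin] with y h1 h2 h3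
  exact h1 ⟨h3, h2⟩

variable {C : Type*} [TopologicalSpace C] [ChartedSpace ℂ C]

theorem map_chartAt_symm_nhdsNE (x : C) :
    map (chartAt ℂ x).symm (𝓝[≠] (chartAt ℂ x x)) = 𝓝[≠] x := by
  have hx := mem_chart_source ℂ x
  have h := (chartAt ℂ x).symm.map_nhdsWithin_eq ((chartAt ℂ x).map_source hx) {chartAt ℂ x x}ᶜ
  rw [(chartAt ℂ x).left_inv hx] at h
  rw [h]
  have : (chartAt ℂ x).symm '' ((chartAt ℂ x).symm.source ∩ {chartAt ℂ x x}ᶜ) =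
      {x}ᶜ ∩ (chartAt ℂ x).source := by
    ext y
    constructor
    · rintro ⟨ζ, ⟨h1, h2⟩, rfl⟩
      refine ⟨fun h3 => h2 ?_, (chartAt ℂ x).map_target h1⟩
      rw [Set.mem_singleton_iff] at h3
      exact ((chartAt ℂ x).right_inv h1).symm.trans (congrArg _ h3)
    · rintro ⟨h1, h2⟩
      refine ⟨chartAt ℂ x y, ⟨(chartAt ℂ x).map_source h2, fun h3 => h1 ?_⟩,
        (chartAt ℂ x).left_inv h2⟩
      exact (chartAt ℂ x).injOn h2 hx h3
  rw [this, Set.inter_comm]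
  exact nhdsWithin_inter_of_mem (nhdsWithin_le_nhds ((chartAt ℂ x).open_source.mem_nhds hx))

theorem eventually_nhdsNE_iff_chartAt {x : C} {p : C → Prop} :
    (∀ᶠ y in 𝓝[≠] x, p y) ↔ ∀ᶠ ζ in 𝓝[≠] (chartAt ℂ x x), p ((chartAt ℂ x).symm ζ) := by
  rw [← map_chartAt_symm_nhdsNE, eventually_map]

theorem tendsto_nhdsNE_iff_chartAt {x : C} {β : Type*} {u : C → β} {l : Filter β} :
    Tendsto u (𝓝[≠] x) l ↔
      Tendsto (u ∘ (chartAt ℂ x).symm) (𝓝[≠] (chartAt ℂ x x)) l := by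
  rw [← map_chartAt_symm_nhdsNE, tendsto_map'_iff]

theorem nhdsNE_neBot_of_chartedSpace (x : C) : (𝓝[≠] x).NeBot := by
  rw [← map_chartAt_symm_nhdsNE]; infer_instance

theorem mdifferentiableAt_iff_chartAt [IsManifold 𝓘(ℂ, ℂ) ω C] {E : Type*}
    [NormedAddCommGroup E] [NormedSpace ℂ E] {u : C → E} {x y : C}
    (hy : y ∈ (chartAt ℂ x).source) :
    MDifferentiableAt 𝓘(ℂ, ℂ) 𝓘(ℂ, E) u y ↔
      DifferentiableAt ℂ (u ∘ (chartAt ℂ x).symm) (chartAt ℂ x y) := by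
  have : IsManifold 𝓘(ℂ, ℂ) 1 C := IsManifold.of_le (n := ω) le_top
  rw [← mdifferentiableAt_iff_differentiableAt]
  constructor
  · intro h
    refine MDifferentiableAt.comp _ ?_
      (mdifferentiableAt_atlas_symm (chart_mem_atlas ℂ x) ((chartAt ℂ x).map_source hy))
    rwa [(chartAt ℂ x).left_inv hy]
  · intro h
    have h2 := MDifferentiableAt.comp y h (mdifferentiableAt_atlas (chart_mem_atlas ℂ x) hy)
    refine h2.congr_of_eventuallyEq ?_
    filter_upwards [(chartAt ℂ x).open_source.mem_nhds hy] with v hv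
    simp [(chartAt ℂ x).left_inv hv]

/-- `u` is meromorphic at `x`; the value at `x` is irrelevant. -/
def IsMeroAt (u : C → ℂ) (x : C) : Prop :=
  MeromorphicAt (u ∘ (chartAt ℂ x).symm) (chartAt ℂ x x)

theorem IsMeroAt.congr {u v : C → ℂ} {x : C} (h : IsMeroAt u x) (huv : ∀ᶠ y in 𝓝[≠] x, u y = v y) :
    IsMeroAt v x :=
  MeromorphicAt.congr h (eventually_nhdsNE_iff_chartAt.1 huv)

theorem IsMeroAt.add {u v : C → ℂ} {x : C} (h : IsMeroAt u x) (h' : IsMeroAt v x) :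
    IsMeroAt (fun y => u y + v y) x := MeromorphicAt.add h h'

theorem IsMeroAt.mul {u v : C → ℂ} {x : C} (h : IsMeroAt u x) (h' : IsMeroAt v x) :
    IsMeroAt (fun y => u y * v y) x := MeromorphicAt.mul h h'

theorem IsMeroAt.div {u v : C → ℂ} {x : C} (h : IsMeroAt u x) (h' : IsMeroAt v x) :
    IsMeroAt (fun y => u y / v y) x := MeromorphicAt.div h h'

theorem IsMeroAt.pow {u : C → ℂ} {x : C} (h : IsMeroAt u x) (n : ℕ) :
    IsMeroAt (fun y => u y ^ n) x := MeromorphicAt.pow h n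

theorem isMeroAt_const (a : ℂ) (x : C) : IsMeroAt (fun _ => a) x := MeromorphicAt.const a _

theorem IsMeroAt.sum {ι : Type*} {s : Finset ι} {u : ι → C → ℂ} {x : C}
    (h : ∀ i ∈ s, IsMeroAt (u i) x) : IsMeroAt (fun y => ∑ i ∈ s, u i y) x :=
  MeromorphicAt.fun_sum h

theorem IsMeroAt.polynomial_eval {u : C → ℂ} {x : C} (h : IsMeroAt u x) (p : Polynomial ℂ) :
    IsMeroAt (fun y => p.eval (u y)) x := by
  simp only [Polynomial.eval_eq_sum_range]
  exact IsMeroAt.sum fun i _ => (isMeroAt_const _ x).mul (h.pow i)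

theorem IsMeroAt.eventually_eq_zero_or {u : C → ℂ} {x : C} (h : IsMeroAt u x) :
    (∀ᶠ y in 𝓝[≠] x, u y = 0) ∨ ∀ᶠ y in 𝓝[≠] x, u y ≠ 0 := by
  exact (MeromorphicAt.eventually_eq_zero_or_eventually_ne_zero h).imp
    eventually_nhdsNE_iff_chartAt.2 eventually_nhdsNE_iff_chartAt.2

theorem analyticAt_chartAt [IsManifold 𝓘(ℂ, ℂ) ω C] {E : Type*} [NormedAddCommGroup E]
    [NormedSpace ℂ E] [CompleteSpace E] {u : C → E} {x : C}
    (h : ∀ᶠ y in 𝓝 x, MDifferentiableAt 𝓘(ℂ, ℂ) 𝓘(ℂ, E) u y) :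
    AnalyticAt ℂ (u ∘ (chartAt ℂ x).symm) (chartAt ℂ x x) := by
  rw [Complex.analyticAt_iff_eventually_differentiableAt]
  have hx := mem_chart_source ℂ x
  have ht : Tendsto (chartAt ℂ x).symm (𝓝 (chartAt ℂ x x)) (𝓝 x) :=
    (chartAt ℂ x).tendsto_symm hx
  filter_upwards [ht.eventually h, ht ((chartAt ℂ x).open_source.mem_nhds hx),
    (chartAt ℂ x).open_target.mem_nhds ((chartAt ℂ x).map_source hx)] with ζ h1 h2 h3
  have h4 := (mdifferentiableAt_iff_chartAt h2).1 h1
  rwa [(chartAt ℂ x).right_inv h3] at h4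

theorem isMeroAt_of_mdifferentiableAt [IsManifold 𝓘(ℂ, ℂ) ω C] {u : C → ℂ} {x : C}
    (h : ∀ᶠ y in 𝓝 x, MDifferentiableAt 𝓘(ℂ, ℂ) 𝓘(ℂ, ℂ) u y) : IsMeroAt u x :=
  (analyticAt_chartAt h).meromorphicAt

/-- Removable singularities. -/
theorem mdifferentiableAt_of_punctured [IsManifold 𝓘(ℂ, ℂ) ω C] {u : C → ℂ} {x : C}
    (hc : Tendsto u (𝓝[≠] x) (𝓝 (u x)))
    (h : ∀ᶠ y in 𝓝[≠] x, MDifferentiableAt 𝓘(ℂ, ℂ) 𝓘(ℂ, ℂ) u y) :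
    MDifferentiableAt 𝓘(ℂ, ℂ) 𝓘(ℂ, ℂ) u x := by
  have hx := mem_chart_source ℂ x
  rw [mdifferentiableAt_iff_chartAt hx]
  refine (Complex.analyticAt_of_differentiable_on_punctured_nhds_of_continuousAt ?_ ?_).differentiableAt
  · have ht : Tendsto (chartAt ℂ x).symm (𝓝 (chartAt ℂ x x)) (𝓝 x) :=
      (chartAt ℂ x).tendsto_symm hx
    filter_upwards [eventually_nhdsNE_iff_chartAt.1 h,
      nhdsWithin_le_nhds (ht ((chartAt ℂ x).open_source.mem_nhds hx)), nhdsWithin_le_nhds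
      ((chartAt ℂ x).open_target.mem_nhds ((chartAt ℂ x).map_source hx))] with ζ h1 h2 h3
    have h4 := (mdifferentiableAt_iff_chartAt h2).1 h1
    rwa [(chartAt ℂ x).right_inv h3] at h4
  · rw [continuousAt_iff_punctured_nhds]
    have := tendsto_nhdsNE_iff_chartAt.1 hc
    simpa [Function.comp_apply, (chartAt ℂ x).left_inv hx] using this

/-- The points with a punctured neighbourhood inside `S` form an open set, and by the dichotomy so
do the others. Connectedness leaves one alternative everywhere, and compactness then gives
finiteness. -/
theorem finite_or_finite_compl [CompactSpace C] [ConnectedSpace C] [T2Space C] {S : Set C}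
    (h : ∀ x, (∀ᶠ y in 𝓝[≠] x, y ∈ S) ∨ ∀ᶠ y in 𝓝[≠] x, y ∉ S) : S.Finite ∨ Sᶜ.Finite := by
  have hopen : ∀ T : Set C, IsOpen {x | ∀ᶠ y in 𝓝[≠] x, y ∈ T} := fun T => by
    rw [isOpen_iff_mem_nhds]
    intro x hx
    have := eventually_eventually_nhdsWithin.2 (show ∀ᶠ y in 𝓝[≠] x, y ∈ T from hx)
    rw [eventually_nhdsWithin_iff] at this
    filter_upwards [this] with y hy
    by_cases hyx : y = x
    · rw [hyx]; exact hx
    · have h2 := hy hyx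
      change ∀ᶠ w in 𝓝[≠] y, w ∈ T
      have h3 : 𝓝[≠] y ≤ 𝓝[≠] x ⊔ 𝓝[≠] y := le_sup_right
      have h4 : {x}ᶜ ∈ 𝓝 y := isOpen_compl_singleton.mem_nhds hyx
      rw [eventually_nhdsWithin_iff] at h2 ⊢
      filter_upwards [h2, h4] with w h5 h6 _ using h5 h6
  have hcompl : {x | ∀ᶠ y in 𝓝[≠] x, y ∈ S}ᶜ = {x | ∀ᶠ y in 𝓝[≠] x, y ∈ Sᶜ} := by
    ext x
    constructor
    · intro hx; exact (h x).resolve_left hx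
    · intro hx hx'
      have := nhdsNE_neBot_of_chartedSpace x
      obtain ⟨y, h1, h2⟩ := ((show ∀ᶠ y in 𝓝[≠] x, y ∈ S from hx').and hx).exists
      exact h2 h1
  have hclopen : IsClopen {x | ∀ᶠ y in 𝓝[≠] x, y ∈ S} :=
    ⟨⟨by rw [hcompl]; exact hopen _⟩, hopen _⟩
  rcases isClopen_iff.1 hclopen with h0 | h0
  · left
    refine finite_of_eventually_nhdsNE fun x => (h x).resolve_left fun hx => ?_
    exact (Set.eq_empty_iff_forall_notMem.1 h0 x) hx
  · right
    refine finite_of_eventually_nhdsNE fun x => ?_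
    have : x ∈ {x | ∀ᶠ y in 𝓝[≠] x, y ∈ S} := h0 ▸ Set.mem_univ x
    filter_upwards [show ∀ᶠ y in 𝓝[≠] x, y ∈ S from this] with y hy using fun h => h hy

/-- The identity theorem. -/
theorem finite_zeros_or_of_isMeroAt [CompactSpace C] [ConnectedSpace C] [T2Space C] {u : C → ℂ}
    (h : ∀ x, IsMeroAt u x) : {x | u x = 0}.Finite ∨ {x | u x ≠ 0}.Finite :=
  finite_or_finite_compl (S := {x | u x = 0}) fun x => (h x).eventually_eq_zero_or

end Surface

/-! ### Maps to the projective line as meromorphic functions. -/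

section MeromorphicFunctions

open Filter Topology Metric

/-- The meromorphic function given by a map to `CP 1`, with the value `0` at the poles. -/
noncomputable def affineValue {C : Type*} (h : C → CP 1) (x : C) : ℂ := (h x).rep 0 / (h x).rep 1

/-- The points which a map to `CP 1` sends to `∞ = [1 : 0]`. -/
def poleSet {C : Type*} (h : C → CP 1) : Set C := {x | (h x).rep 1 = 0}

theorem affineValue_of_mem_poleSet {C : Type*} {h : C → CP 1} {x : C} (hx : x ∈ poleSet h) :
    affineValue h x = 0 := by
  rw [affineValue, show (h x).rep 1 = 0 from hx, div_zero]

variable {C : Type*} [TopologicalSpace C] [ChartedSpace ℂ C]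

theorem IsHolomorphicToCP.exists_coordinates {h : C → CP 1} (hh : IsHolomorphicToCP h) (x : C) :
    ∃ s t : C → ℂ, (∀ᶠ y in 𝓝 x, MDifferentiableAt 𝓘(ℂ, ℂ) 𝓘(ℂ, ℂ) s y) ∧
      (∀ᶠ y in 𝓝 x, MDifferentiableAt 𝓘(ℂ, ℂ) 𝓘(ℂ, ℂ) t y) ∧
      ∀ᶠ y in 𝓝 x, ∃ a : ℂ, a ≠ 0 ∧ (h y).rep 0 = a * s y ∧ (h y).rep 1 = a * t y := by
  obtain ⟨U, hU, hxU, s, hs, hsU⟩ := hh x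
  have hsd : ∀ᶠ y in 𝓝 x, MDifferentiableAt 𝓘(ℂ, ℂ) 𝓘(ℂ, Fin 2 → ℂ) s y := by
    filter_upwards [hU.mem_nhds hxU] with y hy using (hs y hy).mdifferentiableAt (hU.mem_nhds hy)
  have hcoord : ∀ i : Fin 2, ∀ᶠ y in 𝓝 x,
      MDifferentiableAt 𝓘(ℂ, ℂ) 𝓘(ℂ, ℂ) (fun y => s y i) y := fun i => by
    filter_upwards [hsd] with y hy
    exact (ContinuousLinearMap.proj (R := ℂ) (φ := fun _ : Fin 2 => ℂ) i).mdifferentiableAt.comp y hy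
  refine ⟨fun y => s y 0, fun y => s y 1, hcoord 0, hcoord 1, ?_⟩
  filter_upwards [hU.mem_nhds hxU] with y hy
  obtain ⟨hy0, hhy⟩ := hsU y hy
  rw [← (h y).mk_rep, Projectivization.mk_eq_mk_iff'] at hhy
  obtain ⟨a, ha⟩ := hhy
  refine ⟨a, ?_, ?_, ?_⟩
  · rintro rfl
    rw [zero_smul] at ha
    exact (h y).rep_nonzero ha.symm
  · rw [← ha]; simp
  · rw [← ha]; simp

theorem rep_ne_zero_of_one (q : CP 1) (h : q.rep 1 = 0) : q.rep 0 ≠ 0 := fun h0 =>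
  q.rep_nonzero (funext fun i => by fin_cases i <;> simp [h, h0])

/-- In homogeneous coordinates `[s : t]` the inverse is `t / s`, with `t` vanishing at the pole. The
convention `0⁻¹ = 0` matches the default value at poles, so no puncture is needed. -/
theorem IsHolomorphicToCP.tendsto_inv_affineValue {h : C → CP 1} (hh : IsHolomorphicToCP h) {x : C}
    (hx : x ∈ poleSet h) : Tendsto (fun y => (affineValue h y)⁻¹) (𝓝 x) (𝓝 0) := by
  obtain ⟨s, t, hs, ht, hst⟩ := hh.exists_coordinates x
  obtain ⟨a, ha, h0, h1⟩ := hst.self_of_nhds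
  have htx : t x = 0 := by
    have : a * t x = 0 := h1.symm.trans hx
    exact (mul_eq_zero.1 this).resolve_left ha
  have hsx : s x ≠ 0 := fun h => rep_ne_zero_of_one _ hx (by rw [h0, h, mul_zero])
  have key : Tendsto (fun y => t y / s y) (𝓝 x) (𝓝 (t x / s x)) :=
    ht.self_of_nhds.continuousAt.tendsto.div hs.self_of_nhds.continuousAt.tendsto hsx
  rw [htx, zero_div] at key
  refine key.congr' ?_
  filter_upwards [hst] with y ⟨a, ha, h0, h1⟩
  rw [affineValue, inv_div, h0, h1, mul_div_mul_left _ _ ha]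

section

variable [IsManifold 𝓘(ℂ, ℂ) ω C] {h : C → CP 1}

theorem IsHolomorphicToCP.isMeroAt (hh : IsHolomorphicToCP h) (x : C) :
    IsMeroAt (affineValue h) x := by
  obtain ⟨s, t, hs, ht, hst⟩ := hh.exists_coordinates x
  refine ((isMeroAt_of_mdifferentiableAt hs).div (isMeroAt_of_mdifferentiableAt ht)).congr ?_
  filter_upwards [nhdsWithin_le_nhds hst] with y ⟨a, ha, h0, h1⟩
  rw [affineValue, h0, h1, mul_div_mul_left _ _ ha]

theorem IsHolomorphicToCP.eventually_mdifferentiableAt (hh : IsHolomorphicToCP h) {x : C}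
    (hx : x ∉ poleSet h) : ∀ᶠ y in 𝓝 x, y ∉ poleSet h ∧
      MDifferentiableAt 𝓘(ℂ, ℂ) 𝓘(ℂ, ℂ) (affineValue h) y := by
  obtain ⟨s, t, hs, ht, hst⟩ := hh.exists_coordinates x
  have htx : t x ≠ 0 := by
    obtain ⟨a, ha, -, h1⟩ := hst.self_of_nhds
    exact fun h => hx (by rw [poleSet, Set.mem_ofPred_eq, h1, h, mul_zero])
  have htc : ∀ᶠ y in 𝓝 x, t y ≠ 0 := ht.self_of_nhds.continuousAt.eventually_ne htx
  filter_upwards [hs, ht, hst.eventually_nhds, htc] with y h1 h2 h3 h4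
  refine ⟨fun hy => ?_, ?_⟩
  · obtain ⟨a, ha, -, h5⟩ := h3.self_of_nhds
    rw [poleSet, Set.mem_ofPred_eq, h5] at hy
    exact (mul_ne_zero ha h4) hy
  · have hdiv : MDifferentiableAt 𝓘(ℂ, ℂ) 𝓘(ℂ, ℂ) (fun v => s v / t v) y := by
      have hy := mem_chart_source ℂ y
      rw [mdifferentiableAt_iff_chartAt hy] at h1 h2 ⊢
      refine DifferentiableAt.fun_div h1 h2 ?_
      simpa [(chartAt ℂ y).left_inv hy] using h4
    refine hdiv.congr_of_eventuallyEq ?_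
    filter_upwards [h3] with v ⟨a, ha, h0, h1⟩
    rw [affineValue, h0, h1, mul_div_mul_left _ _ ha]

variable [CompactSpace C] [ConnectedSpace C] [T2Space C]

/-- The linear form in local holomorphic coordinates differs from the one in `rep` by a nonzero
factor. Working with linear forms rather than quotients treats poles and finite values alike. -/
theorem IsHolomorphicToCP.finite_or_forall (hh : IsHolomorphicToCP h) (a b : ℂ) :
    {x | a * (h x).rep 0 + b * (h x).rep 1 = 0}.Finite ∨
      ∀ x, a * (h x).rep 0 + b * (h x).rep 1 = 0 := by
  have key : ∀ x, ∃ u : C → ℂ, IsMeroAt u x ∧ ContinuousAt u x ∧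
      ∀ᶠ y in 𝓝 x, a * (h y).rep 0 + b * (h y).rep 1 = 0 ↔ u y = 0 := by
    intro x
    obtain ⟨s, t, hs, ht, hst⟩ := hh.exists_coordinates x
    refine ⟨fun y => a * s y + b * t y,
      ((isMeroAt_const a x).mul (isMeroAt_of_mdifferentiableAt hs)).add
      ((isMeroAt_const b x).mul (isMeroAt_of_mdifferentiableAt ht)),
      (continuousAt_const.mul hs.self_of_nhds.continuousAt).add
      (continuousAt_const.mul ht.self_of_nhds.continuousAt), ?_⟩
    filter_upwards [hst] with y ⟨c, hc, h0, h1⟩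
    rw [h0, h1, show a * (c * s y) + b * (c * t y) = c * (a * s y + b * t y) by ring,
      mul_eq_zero, or_iff_right hc]
  rcases finite_or_finite_compl (S := {x | a * (h x).rep 0 + b * (h x).rep 1 = 0}) (fun x => by
    obtain ⟨u, hu, -, hux⟩ := key x
    refine hu.eventually_eq_zero_or.imp (fun h => ?_) fun h => ?_
    · filter_upwards [h, nhdsWithin_le_nhds hux] with y h1 h2 using h2.2 h1
    · filter_upwards [h, nhdsWithin_le_nhds hux] with y h1 h2 using fun h3 => h1 (h2.1 h3))
    with hfin | hfin
  · exact .inl hfin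
  · refine .inr fun x => ?_
    obtain ⟨u, -, huc, hux⟩ := key x
    rw [hux.self_of_nhds]
    have := nhdsNE_neBot_of_chartedSpace x
    refine tendsto_nhds_unique (huc.tendsto.mono_left nhdsWithin_le_nhds : Tendsto u (𝓝[≠] x) _) ?_
    refine tendsto_const_nhds.congr' ?_
    filter_upwards [eventually_nhdsNE_notMem_of_finite hfin x, nhdsWithin_le_nhds hux] with y h1 h2
    exact (h2.1 (not_not.1 h1)).symm

theorem IsHolomorphicToCP.finite_of_not_const (hh : IsHolomorphicToCP h)
    (hc : ¬ ∃ c : CP 1, ∀ x, h x = c) {a b : ℂ} (hab : a ≠ 0 ∨ b ≠ 0) :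
    {x | a * (h x).rep 0 + b * (h x).rep 1 = 0}.Finite := by
  refine (hh.finite_or_forall a b).resolve_right fun hall => hc ?_
  have hne : ![-b, a] ≠ 0 := fun h => by
    have h0 := congrFun h 0
    have h1 := congrFun h 1
    simp at h0 h1
    exact hab.elim (fun h => h h1) fun h => h h0
  refine ⟨Projectivization.mk ℂ _ hne, fun x => ?_⟩
  have hx := hall x
  rw [← (h x).mk_rep, Projectivization.mk_eq_mk_iff']
  rcases hab with ha | hb
  · refine ⟨(h x).rep 1 / a, funext fun i => ?_⟩
    fin_cases i
    · simp only [Fin.zero_eta, Pi.smul_apply, Matrix.cons_val_zero, smul_eq_mul]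
      field_simp
      linear_combination -hx
    · simp [ha]
  · refine ⟨-(h x).rep 0 / b, funext fun i => ?_⟩
    fin_cases i
    · simp [hb]
    · simp only [Fin.mk_one, Pi.smul_apply, Matrix.cons_val_one, Matrix.cons_val_fin_one, smul_eq_mul]
      field_simp
      linear_combination -hx

theorem IsHolomorphicToCP.finite_poleSet (hh : IsHolomorphicToCP h)
    (hc : ¬ ∃ c : CP 1, ∀ x, h x = c) : (poleSet h).Finite := by
  refine (hh.finite_of_not_const hc (a := 0) (b := 1) (by simp)).subset fun x hx => ?_
  simpa [poleSet] using hx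

theorem IsHolomorphicToCP.finite_fiber (hh : IsHolomorphicToCP h)
    (hc : ¬ ∃ c : CP 1, ∀ x, h x = c) (w : ℂ) : (affineValue h ⁻¹' {w}).Finite := by
  refine ((hh.finite_of_not_const hc (a := 1) (b := -w) (by simp)).union
    (hh.finite_poleSet hc)).subset fun x hx => ?_
  by_cases hp : x ∈ poleSet h
  · exact .inr hp
  · left
    have hx' : (h x).rep 0 / (h x).rep 1 = w := hx
    rw [div_eq_iff hp] at hx'
    rw [Set.mem_ofPred_eq, hx']; ring

end

/-- Near `y` the function `z` is a local coordinate. -/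
def IsRegularAt (z : C → ℂ) (y : C) : Prop :=
  ∃ x, y ∈ (chartAt ℂ x).source ∧ AnalyticAt ℂ (z ∘ (chartAt ℂ x).symm) (chartAt ℂ x y) ∧
    deriv (z ∘ (chartAt ℂ x).symm) (chartAt ℂ x y) ≠ 0

/-- If the derivative vanished on a punctured neighbourhood, `z` would be constant on some disc and
have an infinite fibre. -/
theorem IsMeroAt.eventually_isRegularAt {z : C → ℂ} {x : C} (hz : IsMeroAt z x)
    (hfin : ∀ w, (z ⁻¹' {w}).Finite) : ∀ᶠ y in 𝓝[≠] x, IsRegularAt z y := by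
  set e := chartAt ℂ x with he
  set Z := z ∘ e.symm with hZ
  have hx : x ∈ e.source := mem_chart_source ℂ x
  have hZm : MeromorphicAt Z (e x) := hz
  have htgt : ∀ᶠ ζ in 𝓝[≠] (e x), ζ ∈ e.target :=
    nhdsWithin_le_nhds (e.open_target.mem_nhds (e.map_source hx))
  rcases hZm.deriv.eventually_eq_zero_or_eventually_ne_zero with h0 | h0
  · exfalso
    obtain ⟨ζ, hζ⟩ := (eventually_eventually_nhdsWithin.2
      (h0.and (hZm.eventually_analyticAt.and (htgt.and self_mem_nhdsWithin)))).and
      self_mem_nhdsWithin |>.exists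
    have hζ2 := hζ.1
    rw [IsOpen.nhdsWithin_eq isOpen_compl_singleton hζ.2] at hζ2
    obtain ⟨r, hr, hball⟩ := Metric.eventually_nhds_iff_ball.1 hζ2
    obtain ⟨c, hc⟩ := isOpen_ball.exists_is_const_of_deriv_eq_zero (f := Z)
      (convex_ball ζ r).isPreconnected
      (fun ξ hξ => (hball ξ hξ).2.1.differentiableAt.differentiableWithinAt)
      (fun ξ hξ => (hball ξ hξ).1)
    have hinf : (e.symm '' ball ζ r).Infinite := by
      refine Set.Infinite.image (e.symm.injOn.mono fun ξ hξ => (hball ξ hξ).2.2.1) ?_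
      exact infinite_of_mem_nhds ζ (ball_mem_nhds ζ hr)
    refine hinf ((hfin c).subset ?_)
    rintro _ ⟨ξ, hξ, rfl⟩
    exact hc ξ hξ
  · rw [eventually_nhdsNE_iff_chartAt]
    filter_upwards [h0, hZm.eventually_analyticAt, htgt] with ζ h1 h2 h3
    refine ⟨x, e.map_target h3, ?_, ?_⟩
    · rwa [← he, e.right_inv h3]
    · rwa [← he, e.right_inv h3]

theorem IsRegularAt.exists_openPartialHomeomorph {z : C → ℂ} {y : C} (h : IsRegularAt z y) :
    ∃ e : OpenPartialHomeomorph C ℂ, y ∈ e.source ∧ Set.EqOn z e e.source := by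
  obtain ⟨x, hy, ha, hd⟩ := h
  set c := chartAt ℂ x
  have hs := ha.hasStrictDerivAt
  have hs' := hs.hasStrictFDerivAt_equiv hd
  refine ⟨c.trans (hs'.toOpenPartialHomeomorph _), ?_, fun v hv => ?_⟩
  · rw [OpenPartialHomeomorph.trans_source]
    exact ⟨hy, hs'.mem_toOpenPartialHomeomorph_source⟩
  · rw [OpenPartialHomeomorph.trans_source] at hv
    simp [c.left_inv hv.1]

/-- A continuous section is a local inverse of `z`, hence holomorphic by the inverse function
theorem. -/
theorem IsRegularAt.differentiableAt_comp [IsManifold 𝓘(ℂ, ℂ) ω C] {z u : C → ℂ} {σ : ℂ → C} {w : ℂ}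
    (h : IsRegularAt z (σ w)) (hσ : ContinuousAt σ w) (hsec : ∀ᶠ v in 𝓝 w, z (σ v) = v)
    (hu : MDifferentiableAt 𝓘(ℂ, ℂ) 𝓘(ℂ, ℂ) u (σ w)) : DifferentiableAt ℂ (fun v => u (σ v)) w := by
  obtain ⟨x, hy, ha, hd⟩ := h
  set c := chartAt ℂ x with hc
  have hmem : ∀ᶠ v in 𝓝 w, σ v ∈ c.source := hσ (c.open_source.mem_nhds hy)
  have h1 : HasDerivAt (fun v => c (σ v)) (deriv (z ∘ c.symm) (c (σ w)))⁻¹ w := by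
    refine HasDerivAt.of_local_left_inverse ((c.continuousAt hy).comp hσ)
      ha.differentiableAt.hasDerivAt hd ?_
    filter_upwards [hmem, hsec] with v h2 h3
    simp [c.left_inv h2, h3]
  have h2 : DifferentiableAt ℂ (u ∘ c.symm) (c (σ w)) := (mdifferentiableAt_iff_chartAt hy).1 hu
  refine (h2.comp w h1.differentiableAt).congr_of_eventuallyEq ?_
  filter_upwards [hmem] with v hv
  simp [c.left_inv hv]



end MeromorphicFunctions

/-! ### The map `z` is a covering away from its critical values. -/

section EvenCovering

open Filter Topology Metric OnePoint

variable {C : Type*} [TopologicalSpace C] [T2Space C] {z : C → ℂ} {B : Set ℂ}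

-- Since `0⁻¹ = 0`, a small inverse means a large value only away from the zeros of `z`; finiteness
-- of the zero set excludes these near a pole.
open Classical in
theorem continuous_onePoint_extension {P : Set C} (hP : IsClosed P)
    (hz : ∀ x ∉ P, ContinuousAt z x) (hP' : ∀ x ∈ P, Tendsto (fun y => (z y)⁻¹) (𝓝 x) (𝓝 0))
    (hfin : (z ⁻¹' {0}).Finite) :
    Continuous fun x => if x ∈ P then (∞ : OnePoint ℂ) else (z x : OnePoint ℂ) := by
  rw [continuous_iff_continuousAt]
  intro x
  by_cases hx : x ∈ P
  · rw [ContinuousAt, if_pos hx, Tendsto, le_nhds_infty]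
    intro s _ hs
    obtain ⟨R, hR⟩ := hs.isBounded.exists_norm_le
    have hR' : (0 : ℝ) < (|R| + 1)⁻¹ := by positivity
    have h1 := (hP' x hx).norm
    rw [norm_zero] at h1
    have h2 := eventually_nhdsNE_notMem_of_finite hfin x
    rw [eventually_nhdsWithin_iff] at h2
    rw [← Filter.eventually_mem_set, eventually_map]
    filter_upwards [h1.eventually_lt_const hR', h2] with y h3 h4
    by_cases hy : y ∈ P
    · simp [hy]
    · have hyx : y ≠ x := fun h => hy (h ▸ hx)
      have hzy : z y ≠ 0 := h4 hyx
      have h6 : z y ∉ s := fun h5 => by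
        rw [norm_inv, inv_lt_inv₀ (norm_pos_iff.2 hzy) (by positivity)] at h3
        linarith [hR _ h5, le_abs_self R]
      simpa [hy] using h6
  · have h1 : ContinuousAt (fun y => (z y : OnePoint ℂ)) x :=
      OnePoint.continuous_coe.continuousAt.comp (hz x hx)
    refine h1.congr ?_
    filter_upwards [hP.isOpen_compl.mem_nhds hx] with y hy
    rw [if_neg hy]

/-- Sending the poles to `∞` makes `z` a continuous map on a compact space. Being a local
homeomorphism over `Bᶜ`, it is a covering there, and the inclusion of a disc lifts because a disc is
contractible. -/
theorem exists_isSheet [CompactSpace C] {P : Set C} (hP : IsClosed P)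
    (hz : ∀ x ∉ P, ContinuousAt z x) (hP' : ∀ x ∈ P, Tendsto (fun y => (z y)⁻¹) (𝓝 x) (𝓝 0))
    (hfin : (z ⁻¹' {0}).Finite) (hP0 : ∀ x ∈ P, z x ∈ B)
    (hreg : ∀ y, z y ∉ B → ∃ e : OpenPartialHomeomorph C ℂ, y ∈ e.source ∧ Set.EqOn z e e.source)
    {c : ℂ} {r : ℝ} (hB : Disjoint (ball c r) B) {y : C} (hy : z y ∈ ball c r) :
    ∃ σ, IsSheet z (ball c r) σ ∧ σ (z y) = y := by
  classical
  set Z : C → OnePoint ℂ := fun x => if x ∈ P then ∞ else (z x : OnePoint ℂ) with hZ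
  have hZc : Continuous Z := continuous_onePoint_extension hP hz hP' hfin
  set s : Set (OnePoint ℂ) := (↑) '' Bᶜ with hs
  have hsP : ∀ x, Z x ∈ s → x ∉ P ∧ z x ∉ B := by
    intro x hx
    by_cases hxP : x ∈ P
    · simp [hZ, hs, hxP] at hx
    · refine ⟨hxP, ?_⟩
      simpa [hZ, hs, hxP] using hx
  have hloc : IsLocalHomeomorphOn Z (Z ⁻¹' s) := by
    refine IsLocalHomeomorphOn.mk _ _ fun x hx => ?_
    obtain ⟨hxP, hxB⟩ := hsP x hx
    obtain ⟨e, hxe, he⟩ := hreg x hxB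
    refine ⟨(e.restrOpen Pᶜ hP.isOpen_compl).trans
      (OnePoint.isOpenEmbedding_coe.toOpenPartialHomeomorph _), ?_, fun v hv => ?_⟩
    · simp [hxe, hxP]
    · simp at hv
      have h1 : v ∉ P := hv.2
      simp [hZ, h1, he hv.1]
  have hcov := (IsCoveringMapOn.of_isLocalHomeomorphOn hZc hloc).isCoveringMap_restrictPreimage
  have hne : (ball c r).Nonempty := ⟨_, hy⟩
  have : ContractibleSpace (ball c r) := (convex_ball c r).contractibleSpace hne
  have : LocallyPathConnectedSpace (ball c r) := isOpen_ball.locallyPathConnectedSpace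
  have hmem : ∀ w : ball c r, ((w : ℂ) : OnePoint ℂ) ∈ s := fun w =>
    ⟨w, fun h => hB.le_bot ⟨w.2, h⟩, rfl⟩
  let f : C(ball c r, s) := ⟨fun w => ⟨((w : ℂ) : OnePoint ℂ), hmem w⟩,
    (OnePoint.continuous_coe.comp continuous_subtype_val).subtype_mk _⟩
  have hyP : y ∉ P := fun h => hB.le_bot ⟨hy, hP0 y h⟩
  have hZy : Z y = z y := if_neg hyP
  have hys : Z y ∈ s := by rw [hZy]; exact hmem ⟨_, hy⟩
  obtain ⟨F, ⟨hF0, hF⟩, -⟩ := hcov.existsUnique_continuousMap_lifts f ⟨z y, hy⟩ ⟨y, hys⟩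
    (Subtype.ext hZy)
  have hFz : ∀ w : ball c r, (F w : C) ∉ P ∧ z (F w) = w := by
    intro w
    have h1 : Z (F w) = ((w : ℂ) : OnePoint ℂ) := congrArg Subtype.val (congrFun hF w)
    have h2 := (hsP (F w) (F w).2).1
    refine ⟨h2, ?_⟩
    have h3 : Z (F w) = z (F w) := if_neg h2
    exact OnePoint.coe_injective (h3.symm.trans h1)
  refine ⟨fun w => if h : w ∈ ball c r then F ⟨w, h⟩ else y, ⟨isOpen_ball, convex_ball c r, ?_, ?_, ?_⟩,
    ?_⟩
  · rw [continuousOn_iff_continuous_domRestrict]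
    refine (continuous_subtype_val.comp F.continuous).congr fun w => ?_
    rw [Set.domRestrict_apply, dif_pos w.2]
    rfl
  · intro w hw
    simp only [hw, dif_pos]
    exact (hFz ⟨w, hw⟩).2
  · intro w hw
    simp only [hw, dif_pos]
    obtain ⟨e, he, hez⟩ := hreg (F ⟨w, hw⟩) (by
      rw [(hFz ⟨w, hw⟩).2]; exact fun h => hB.le_bot ⟨hw, h⟩)
    exact ⟨e.source, e.open_source.mem_nhds he, fun a ha b hb hab =>
      e.injOn ha hb (by rw [← hez ha, ← hez hb, hab])⟩
  · simp only [hy, dif_pos, hF0]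

/-- Sheets are indexed by the fibre over the centre; by `IsSheet.agree` they are disjoint and every
point lies on one of them. -/
theorem isEvenlyCoveredOff_of_regular [CompactSpace C] {P : Set C} (hP : IsClosed P)
    (hz : ∀ x ∉ P, ContinuousAt z x) (hP' : ∀ x ∈ P, Tendsto (fun y => (z y)⁻¹) (𝓝 x) (𝓝 0))
    (hfin : ∀ w, (z ⁻¹' {w}).Finite) (hP0 : ∀ x ∈ P, z x ∈ B)
    (hreg : ∀ y, z y ∉ B → ∃ e : OpenPartialHomeomorph C ℂ, y ∈ e.source ∧ Set.EqOn z e e.source) :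
    IsEvenlyCoveredOff z B := by
  intro c r hr hB
  have hc : c ∈ ball c r := mem_ball_self hr
  have hsheet : ∀ y, z y ∈ ball c r → ∃ σ, IsSheet z (ball c r) σ ∧ σ (z y) = y := fun y hy =>
    exists_isSheet hP hz hP' (hfin 0) hP0 hreg hB hy
  set S := (hfin c).toFinset
  have hS : ∀ x ∈ S, z x = c := fun x hx => by simpa [S] using hx
  choose σ hσ hσc using fun i : Fin S.card =>
    hsheet (S.equivFin.symm i : C) (by rw [hS _ (S.equivFin.symm i).2]; exact hc)
  have hσc' : ∀ i, σ i c = S.equivFin.symm i := fun i => by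
    have := hσc i
    rwa [hS _ (S.equivFin.symm i).2] at this
  refine ⟨S.card, σ, hσ, fun w hw y hy => ?_, fun w hw i j hij => ?_⟩
  · obtain ⟨τ, hτ, hτy⟩ := hsheet y (by rwa [hy])
    have hmem : τ c ∈ S := by simpa [S] using hτ.sec c hc
    refine ⟨S.equivFin ⟨τ c, hmem⟩, ?_⟩
    rw [← hτy, hy]
    refine (hσ _).agree hτ ⟨hc, hc⟩ ?_ w ⟨hw, hw⟩
    rw [hσc', Equiv.symm_apply_apply]
  · have := (hσ i).agree (hσ j) ⟨hw, hw⟩ hij c ⟨hc, hc⟩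
    rw [hσc', hσc'] at this
    exact S.equivFin.symm.injective (Subtype.ext this)

end EvenCovering

/-! ### A meromorphic function that separates the fibres of `f`. -/

section PrimitiveElement

open Filter Topology Metric

theorem isTempered_of_mdifferentiableAt {C : Type*} [TopologicalSpace C] [ChartedSpace ℂ C]
    [IsManifold 𝓘(ℂ, ℂ) ω C] {z u : C → ℂ} {B : Set ℂ}
    (hreg : ∀ y, z y ∉ B → IsRegularAt z y)
    (hu : ∀ y, z y ∉ B → MDifferentiableAt 𝓘(ℂ, ℂ) 𝓘(ℂ, ℂ) u y)
    (hb : ∃ (K : ℝ) (N : ℕ), ∀ x, z x ∉ B → ‖u x‖ ≤ K * (1 + ‖z x‖) ^ N) : IsTempered z B u := by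
  refine ⟨fun D σ hσ hd w hw => ?_, hb⟩
  have hB : z (σ w) ∉ B := by rw [hσ.sec w hw]; exact fun h => hd.le_bot ⟨hw, h⟩
  have hD : D ∈ 𝓝 w := hσ.isOpen.mem_nhds hw
  exact ((hreg _ hB).differentiableAt_comp (hσ.cont.continuousAt hD)
    (by filter_upwards [hD] with v hv using hσ.sec v hv) (hu _ hB)).differentiableWithinAt

variable {C : Type*} [TopologicalSpace C] [ChartedSpace ℂ C]

/-- Near `y` the function `u` is `u ∘ σ` composed with `z`, where `σ` is the sheet through `y`. -/
theorem IsTempered.mdifferentiableAt {z u : C → ℂ} {B : Set ℂ} (hu : IsTempered z B u)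
    (hB : B.Finite) (hz : IsEvenlyCoveredOff z B) {y : C} (hy : z y ∉ B)
    (hzy : MDifferentiableAt 𝓘(ℂ, ℂ) 𝓘(ℂ, ℂ) z y) : MDifferentiableAt 𝓘(ℂ, ℂ) 𝓘(ℂ, ℂ) u y := by
  obtain ⟨r, hr, hrB⟩ := Metric.isOpen_iff.1 hB.isClosed.isOpen_compl _ hy
  have hd : Disjoint (ball (z y) r) B := Set.disjoint_left.2 hrB
  obtain ⟨n, σ, hσ, hs, -⟩ := hz (z y) r hr hd
  have hmem : z y ∈ ball (z y) r := mem_ball_self hr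
  obtain ⟨i, hi⟩ := hs _ hmem y rfl
  have h1 : DifferentiableAt ℂ (fun w => u (σ i w)) (z y) :=
    (hu.diff _ _ (hσ i) hd).differentiableAt (isOpen_ball.mem_nhds hmem)
  refine (h1.mdifferentiableAt.comp y hzy).congr_of_eventuallyEq ?_
  obtain ⟨U, hU, hinj⟩ := (hσ i).inj _ hmem
  have hcont : ContinuousAt (fun v => σ i (z v)) y :=
    ContinuousAt.comp (((hσ i).cont).continuousAt (isOpen_ball.mem_nhds hmem)) hzy.continuousAt
  have hU' : U ∈ 𝓝 y := hi ▸ hU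
  filter_upwards [hU', hzy.continuousAt (isOpen_ball.mem_nhds hmem),
    hcont hU] with v h2 h3 h4
  exact congrArg u (hinj h4 h2 ((hσ i).sec _ h3)).symm

variable [IsManifold 𝓘(ℂ, ℂ) ω C] [T2Space C] [CompactSpace C] [ConnectedSpace C]

/-- A non-constant meromorphic function is a branched covering. -/
theorem IsHolomorphicToCP.exists_isEvenlyCoveredOff {f : C → CP 1} (hf : IsHolomorphicToCP f)
    (hc : ¬ ∃ c : CP 1, ∀ x, f x = c) : ∃ B : Set ℂ, B.Finite ∧ 0 ∈ B ∧
      IsEvenlyCoveredOff (affineValue f) B ∧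
      ∀ y, affineValue f y ∉ B → IsRegularAt (affineValue f) y := by
  have hfin := hf.finite_fiber hc
  have hram : {y | ¬ IsRegularAt (affineValue f) y}.Finite := finite_of_eventually_nhdsNE fun x => by
    simpa using (hf.isMeroAt x).eventually_isRegularAt hfin
  -- The value `0` is added to the critical values because `affineValue` is `0` at the poles, which
  -- must lie over `B`.
  have hreg : ∀ y, affineValue f y ∉ insert 0 (affineValue f '' {y | ¬ IsRegularAt (affineValue f) y}) →
      IsRegularAt (affineValue f) y := fun y hy => by
    by_contra h
    exact hy (Set.mem_insert_of_mem _ ⟨y, h, rfl⟩)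
  refine ⟨_, (hram.image _).insert 0, Set.mem_insert _ _, ?_, hreg⟩
  refine isEvenlyCoveredOff_of_regular (hf.finite_poleSet hc).isClosed
    (fun x hx => (hf.eventually_mdifferentiableAt hx).self_of_nhds.2.continuousAt)
    (fun x hx => hf.tendsto_inv_affineValue hx) hfin
    (fun x hx => by rw [affineValue_of_mem_poleSet hx]; exact Set.mem_insert _ _)
    fun y hy => (hreg y hy).exists_openPartialHomeomorph

/-- The function `g` is meromorphic with poles only at the poles of `f`, of higher order, and
separates the points of the fibres of `f` outside the finite set `B`. -/
structure IsPrimitiveFor (f : C → CP 1) (B : Set ℂ) (g : C → ℂ) : Prop where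
  finite : B.Finite
  zero_mem : 0 ∈ B
  covered : IsEvenlyCoveredOff (affineValue f) B
  regular : ∀ y, affineValue f y ∉ B → IsRegularAt (affineValue f) y
  tempered : IsTempered (affineValue f) B g
  injOn : ∀ w ∉ B, Set.InjOn g (affineValue f ⁻¹' {w})
  mdifferentiableAt : ∀ x ∉ poleSet f, MDifferentiableAt 𝓘(ℂ, ℂ) 𝓘(ℂ, ℂ) g x
  eventually_ne : ∀ x ∈ poleSet f, ∀ᶠ y in 𝓝[≠] x, g y ≠ 0
  tendsto_inv : ∀ x ∈ poleSet f, Tendsto (fun y => (g y)⁻¹) (𝓝[≠] x) (𝓝 0)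
  tendsto_div : ∀ x ∈ poleSet f, Tendsto (fun y => affineValue f y / g y) (𝓝[≠] x) (𝓝 0)

theorem IsHolomorphicToCP.exists_primitive {f : C → CP 1} (hf : IsHolomorphicToCP f)
    (hc : ¬ ∃ c : CP 1, ∀ x, f x = c) : ∃ (g : C → ℂ) (B : Set ℂ), IsPrimitiveFor f B g := by
  obtain ⟨B, hB, h0B, hcov, hreg⟩ := hf.exists_isEvenlyCoveredOff hc
  set z := affineValue f with hz
  have hfin : ∀ w, (z ⁻¹' {w}).Finite := hf.finite_fiber hc
  obtain ⟨g, B', hB', hBB', hg, hg0, hgb, w₀, hw₀, hinj⟩ :=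
    exists_separating hfin hB ⟨0, h0B⟩ hcov
  obtain ⟨K, N, hK1, hK⟩ := hg.exists_one_le
  have hK' : ∀ x, ‖g x‖ ≤ K * (1 + ‖z x‖) ^ N := fun x => by
    by_cases hx : z x ∈ B'
    · rw [hg0 x hx, norm_zero]; positivity
    · exact hK x hx
  -- A power of `z` is constant on fibres, so separation is kept. At a pole it dominates `g`, which
  -- grows at most like `z ^ N`, and its exponent is at least `2`, so the pole of `G` has higher
  -- order than that of `z`.
  set G : C → ℂ := fun x => z x ^ (N + 2) + g x with hG
  have hGt : IsTempered z B' G := by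
    simpa using (isTempered_eval (z := z) (B := B') (Polynomial.X ^ (N + 2))).add hg
  have hGinj : Set.InjOn G (z ⁻¹' {w₀}) := by
    intro x hx y hy hxy
    have hx' : z x = w₀ := hx
    have hy' : z y = w₀ := hy
    exact hinj hx hy (by simpa [hG, hx', hy'] using hxy)
  obtain ⟨B'', hB'', hBB'', hsep⟩ :=
    exists_discriminant hfin hB' (hcov.mono hBB') hGt hw₀ hGinj
  have hz0 : ∀ x ∈ poleSet f, z x = 0 := fun x hx => affineValue_of_mem_poleSet hx
  have hzd : ∀ x ∉ poleSet f, MDifferentiableAt 𝓘(ℂ, ℂ) 𝓘(ℂ, ℂ) z x := fun x hx =>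
    (hf.eventually_mdifferentiableAt hx).self_of_nhds.2
  have hgd : ∀ x, z x ∉ B' → MDifferentiableAt 𝓘(ℂ, ℂ) 𝓘(ℂ, ℂ) g x := fun x hx =>
    hg.mdifferentiableAt hB' (hcov.mono hBB') hx
      (hzd x fun h => hx (by rw [hz0 x h]; exact hBB' h0B))
  have hpre : (z ⁻¹' B').Finite := by
    rw [← Set.biUnion_preimage_singleton]
    exact hB'.biUnion fun w _ => hfin w
  have hgd' : ∀ x ∉ poleSet f, MDifferentiableAt 𝓘(ℂ, ℂ) 𝓘(ℂ, ℂ) g x := by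
    intro x hx
    by_cases hxB : z x ∈ B'
    -- Over `B'` the function `g` was given the value `0`, which is its limit by `hgb`, so the
    -- singularity is removable.
    · refine mdifferentiableAt_of_punctured ?_ ?_
      · rw [hg0 x hxB]
        obtain ⟨M, δ, hδ, hM⟩ := hgb _ hxB
        have h1 : Tendsto (fun y => ‖z y - z x‖) (𝓝[≠] x) (𝓝 0) := by
          have : Tendsto (fun y => ‖z y - z x‖) (𝓝 x) (𝓝 ‖z x - z x‖) :=
            ((hzd x hx).continuousAt.sub continuousAt_const).norm
          rw [sub_self, norm_zero] at this
          exact this.mono_left nhdsWithin_le_nhds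
        refine squeeze_zero_norm' ?_ (by simpa using h1.const_mul M)
        filter_upwards [h1.eventually_lt_const hδ] with y hy using hM y hy
      · filter_upwards [eventually_nhdsNE_notMem_of_finite hpre x] with y hy using hgd y hy
    · exact hgd x hxB
  have hGd : ∀ x ∉ poleSet f, MDifferentiableAt 𝓘(ℂ, ℂ) 𝓘(ℂ, ℂ) G x := fun x hx => by
    have h1 := hzd x hx
    have h2 := hgd' x hx
    have hx' := mem_chart_source ℂ x
    rw [mdifferentiableAt_iff_chartAt hx'] at h1 h2 ⊢
    exact (h1.pow (N + 2)).add h2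
  have hpole : ∀ x ∈ poleSet f, (∀ᶠ y in 𝓝[≠] x, G y ≠ 0) ∧
      Tendsto (fun y => (G y)⁻¹) (𝓝[≠] x) (𝓝 0) ∧ Tendsto (fun y => z y / G y) (𝓝[≠] x) (𝓝 0) := by
    intro x hx
    set t : C → ℂ := fun y => (z y)⁻¹ with ht
    have ht0 : Tendsto t (𝓝[≠] x) (𝓝 0) :=
      (hf.tendsto_inv_affineValue hx).mono_left nhdsWithin_le_nhds
    have hzne : ∀ᶠ y in 𝓝[≠] x, z y ≠ 0 := eventually_nhdsNE_notMem_of_finite (hfin 0) x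
    have h1 : Tendsto (fun y => g y * t y ^ (N + 2)) (𝓝[≠] x) (𝓝 0) := by
      have h2 : Tendsto (fun y => K * 2 ^ N * ‖t y‖ ^ 2) (𝓝[≠] x) (𝓝 0) := by
        simpa using (ht0.norm.pow 2).const_mul (K * 2 ^ N)
      refine squeeze_zero_norm' ?_ h2
      have h3 := ht0.norm
      rw [norm_zero] at h3
      filter_upwards [hzne, h3.eventually_lt_const one_pos] with y h4 h5
      have h6 : 1 < ‖z y‖ := by
        rwa [ht, norm_inv, inv_lt_one₀ (norm_pos_iff.2 h4)] at h5
      have h7 : ‖z y‖ * ‖t y‖ = 1 := by rw [← norm_mul, ht, mul_inv_cancel₀ h4, norm_one]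
      rw [norm_mul, norm_pow]
      calc ‖g y‖ * ‖t y‖ ^ (N + 2) ≤ K * (2 * ‖z y‖) ^ N * ‖t y‖ ^ (N + 2) := by
            refine mul_le_mul_of_nonneg_right ((hK' y).trans ?_) (by positivity)
            gcongr; linarith
        _ = K * 2 ^ N * ‖t y‖ ^ 2 * (‖z y‖ * ‖t y‖) ^ N := by ring
        _ = _ := by rw [h7, one_pow, mul_one]
    have h2 : Tendsto (fun y => 1 + g y * t y ^ (N + 2)) (𝓝[≠] x) (𝓝 1) := by
      simpa using h1.const_add 1
    have h3 : ∀ᶠ y in 𝓝[≠] x, G y = (1 + g y * t y ^ (N + 2)) * z y ^ (N + 2) := by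
      filter_upwards [hzne] with y hy
      have : t y ^ (N + 2) * z y ^ (N + 2) = 1 := by
        rw [← mul_pow, ht, inv_mul_cancel₀ hy, one_pow]
      rw [add_mul, mul_assoc, this]; simp [hG]
    refine ⟨?_, ?_, ?_⟩
    · filter_upwards [h3, hzne, h2.eventually_ne one_ne_zero] with y h4 h5 h6
      rw [h4]
      exact mul_ne_zero h6 (pow_ne_zero _ h5)
    · have h4 : Tendsto (fun y => (1 + g y * t y ^ (N + 2))⁻¹ * t y ^ (N + 2)) (𝓝[≠] x) (𝓝 0) := by
        simpa using (h2.inv₀ one_ne_zero).mul (ht0.pow (N + 2))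
      refine h4.congr' ?_
      filter_upwards [h3] with y hy
      rw [hy, mul_inv, ht, inv_pow]
    · have h4 : Tendsto (fun y => (1 + g y * t y ^ (N + 2))⁻¹ * t y ^ (N + 1)) (𝓝[≠] x) (𝓝 0) := by
        simpa using (h2.inv₀ one_ne_zero).mul (ht0.pow (N + 1))
      refine h4.congr' ?_
      filter_upwards [h3, hzne] with y hy hy'
      have h5 : t y ^ (N + 1) * z y ^ (N + 1) = 1 := by
        rw [← mul_pow, ht, inv_mul_cancel₀ hy', one_pow]
      have h6 : t y ^ (N + 1) = (z y ^ (N + 1))⁻¹ := eq_inv_of_mul_eq_one_left h5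
      rw [hy, h6, pow_succ (z y) (N + 1), ← mul_assoc, div_mul_cancel_right₀ hy', mul_inv]
  exact ⟨G, B'', hB'', hBB'' (hBB' h0B), hcov.mono (hBB'.trans hBB''),
    fun y hy => hreg y fun h => hy (hBB'' (hBB' h)), hGt.mono hBB'', hsep, hGd,
    fun x hx => (hpole x hx).1, fun x hx => (hpole x hx).2.1, fun x hx => (hpole x hx).2.2⟩

end PrimitiveElement

/-! ### Homogenization of polynomials in two variables and its irreducibility. -/

section Cone

open Polynomial

/-- The coefficients of `y ^ k * x ^ j` vanish for `k + j > n`. -/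
def HasTotalDegreeLE (n : ℕ) (p : ℂ[X][X]) : Prop := ∀ k j, n < k + j → (p.coeff k).coeff j = 0

/-- The homogeneous polynomial of degree `n` in three variables with `p (x, y) = F (y, x, 1)`. -/
noncomputable def coneForm (n : ℕ) (p : ℂ[X][X]) : MvPolynomial (Fin 3) ℂ :=
  ∑ k ∈ Finset.range (n + 1), ∑ j ∈ Finset.range (n - k + 1),
    MvPolynomial.C ((p.coeff k).coeff j) *
      (MvPolynomial.X 0 ^ k * MvPolynomial.X 1 ^ j * MvPolynomial.X 2 ^ (n - k - j))

theorem isHomogeneous_coneForm (n : ℕ) (p : ℂ[X][X]) : (coneForm n p).IsHomogeneous n := by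
  refine MvPolynomial.IsHomogeneous.sum _ _ _ fun k hk => ?_
  refine MvPolynomial.IsHomogeneous.sum _ _ _ fun j hj => ?_
  have h1 := Finset.mem_range.1 hk
  have h2 := Finset.mem_range.1 hj
  have h := (((MvPolynomial.isHomogeneous_X_pow (R := ℂ) (0 : Fin 3) k).mul
    (MvPolynomial.isHomogeneous_X_pow (1 : Fin 3) j)).mul
    (MvPolynomial.isHomogeneous_X_pow (2 : Fin 3) (n - k - j))).C_mul ((p.coeff k).coeff j)
  convert! h using 1
  omega

theorem eval_coneForm' (n : ℕ) (p : ℂ[X][X]) (a b c : ℂ) :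
    MvPolynomial.eval ![a, b, c] (coneForm n p) = ∑ k ∈ Finset.range (n + 1),
      ∑ j ∈ Finset.range (n - k + 1), (p.coeff k).coeff j * (a ^ k * b ^ j * c ^ (n - k - j)) := by
  simp [coneForm]

theorem HasTotalDegreeLE.evalEval {n : ℕ} {p : ℂ[X][X]} (h : HasTotalDegreeLE n p) (z y : ℂ) :
    p.evalEval z y = ∑ k ∈ Finset.range (n + 1),
      ∑ j ∈ Finset.range (n - k + 1), (p.coeff k).coeff j * (y ^ k * z ^ j) := by
  have h1 : p.natDegree < n + 1 := Nat.lt_succ_of_le <| natDegree_le_iff_coeff_eq_zero.2 fun k hk =>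
    Polynomial.ext fun j => by rw [h k j (by omega), coeff_zero]
  rw [Polynomial.evalEval, eval_eq_sum_range' h1, eval_finsetSum]
  refine Finset.sum_congr rfl fun k hk => ?_
  have hk' := Finset.mem_range.1 hk
  have h2 : (p.coeff k).natDegree < n - k + 1 := Nat.lt_succ_of_le <|
    natDegree_le_iff_coeff_eq_zero.2 fun j hj => h k j (by omega)
  rw [eval_mul, eval_pow, eval_C, eval_eq_sum_range' h2, Finset.sum_mul]
  exact Finset.sum_congr rfl fun j _ => by ring

theorem HasTotalDegreeLE.eval_coneForm {n : ℕ} {p : ℂ[X][X]} (h : HasTotalDegreeLE n p)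
    (z y t : ℂ) : MvPolynomial.eval ![t * y, t * z, t] (coneForm n p) =
      t ^ n * p.evalEval z y := by
  rw [eval_coneForm', h.evalEval, Finset.mul_sum]
  refine Finset.sum_congr rfl fun k hk => ?_
  rw [Finset.mul_sum]
  refine Finset.sum_congr rfl fun j hj => ?_
  have h1 := Finset.mem_range.1 hk
  have h2 := Finset.mem_range.1 hj
  have h3 : t ^ n = t ^ k * t ^ j * t ^ (n - k - j) := by rw [← pow_add, ← pow_add]; congr 1; omega
  rw [h3, mul_pow, mul_pow]; ring

theorem eval_coneForm_infinity (n : ℕ) (p : ℂ[X][X]) (a b : ℂ) :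
    MvPolynomial.eval ![a, b, 0] (coneForm n p) =
      ∑ k ∈ Finset.range (n + 1), (p.coeff k).coeff (n - k) * (a ^ k * b ^ (n - k)) := by
  rw [eval_coneForm']
  refine Finset.sum_congr rfl fun k hk => ?_
  rw [Finset.sum_eq_single (n - k)]
  · simp
  · intro j hj hjk
    have := Finset.mem_range.1 hj
    rw [zero_pow (by omega), mul_zero, mul_zero]
  · simp

theorem exists_hasTotalDegreeLE (p : ℂ[X][X]) : ∃ n, HasTotalDegreeLE n p := by
  refine ⟨p.natDegree + p.support.sup fun k => (p.coeff k).natDegree, fun k j hkj => ?_⟩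
  by_cases hk : k ∈ p.support
  · have h1 := Finset.le_sup (f := fun k => (p.coeff k).natDegree) hk
    have h2 := le_natDegree_of_mem_supp k hk
    exact coeff_eq_zero_of_natDegree_lt (by omega)
  · rw [notMem_support_iff.1 hk, coeff_zero]

theorem HasTotalDegreeLE.mono {n m : ℕ} {p : ℂ[X][X]} (h : HasTotalDegreeLE n p) (hnm : n ≤ m) :
    HasTotalDegreeLE m p := fun k j hkj => h k j (by omega)

/-- With the least bound `n` the part of degree `n` is nonzero, so the line at infinity is not a
component of the cone. -/
theorem exists_totalDegree {p : ℂ[X][X]} (hp : p ≠ 0) :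
    ∃ n, HasTotalDegreeLE n p ∧ ∃ k ≤ n, (p.coeff k).coeff (n - k) ≠ 0 := by
  classical
  refine ⟨Nat.find (exists_hasTotalDegreeLE p), Nat.find_spec (exists_hasTotalDegreeLE p), ?_⟩
  set n := Nat.find (exists_hasTotalDegreeLE p) with hn
  have hle : HasTotalDegreeLE n p := Nat.find_spec (exists_hasTotalDegreeLE p)
  by_contra! hzero
  rcases Nat.eq_zero_or_pos n with h0 | h0
  · refine hp (Polynomial.ext fun k => Polynomial.ext fun j => ?_)
    rw [coeff_zero, coeff_zero]
    rcases Nat.eq_zero_or_pos (k + j) with h1 | h1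
    · have := hzero 0 (Nat.zero_le _)
      rw [h0] at this
      obtain ⟨rfl, rfl⟩ : k = 0 ∧ j = 0 := by omega
      exact this
    · exact hle k j (by omega)
  · refine Nat.find_min (exists_hasTotalDegreeLE p) (Nat.sub_lt h0 one_pos) fun k j hkj => ?_
    rw [← hn] at hkj
    rcases Nat.lt_or_ge n (k + j) with h1 | h1
    · exact hle k j h1
    · have h2 : j = n - k := by omega
      rw [h2]; exact hzero k (by omega)

theorem eq_of_evalEval_eq {p q : ℂ[X][X]} (h : ∀ z y, p.evalEval z y = q.evalEval z y) : p = q := by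
  rw [← sub_eq_zero]
  by_contra hne
  set r := p - q
  have hr : ∀ z y, r.evalEval z y = 0 := fun z y => by rw [evalEval_sub, h, sub_self]
  have h1 : ∀ y, r.eval (C y) = 0 := fun y => Polynomial.funext fun z => by
    simpa [Polynomial.evalEval] using hr z y
  refine (Set.infinite_range_of_injective (C_injective (R := ℂ))).mono ?_ (finite_setOfPred_isRoot hne)
  rintro _ ⟨y, rfl⟩
  exact h1 y

/-- Substitution of `(t * y, t * x, t)`. -/
noncomputable def coneSubst (t : ℂ) : MvPolynomial (Fin 3) ℂ →+* ℂ[X][X] :=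
  MvPolynomial.eval₂Hom (C.comp C) ![C (C t) * X, C (C t * X), C (C t)]

theorem evalEval_coneSubst (t z y : ℂ) (A : MvPolynomial (Fin 3) ℂ) :
    (coneSubst t A).evalEval z y = MvPolynomial.eval ![t * y, t * z, t] A := by
  have : (evalEvalRingHom z y).comp (coneSubst t) = MvPolynomial.eval ![t * y, t * z, t] := by
    refine MvPolynomial.ringHom_ext (fun c => ?_) fun i => ?_
    · simp [coneSubst]
    · fin_cases i <;> simp [coneSubst]
  exact DFunLike.congr_fun this A

/-- A unit of `ℂ[X][X]` is a constant, so `B` is constant on infinitely many of the planes where the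
third coordinate is a fixed `t ≠ 0`. Hence `B` depends on that coordinate alone. -/
theorem isUnit_of_isUnit_coneSubst {A B : MvPolynomial (Fin 3) ℂ} {n : ℕ} {p : ℂ[X][X]}
    (hp : p ≠ 0) (hn : HasTotalDegreeLE n p) (htop : ∃ a b, MvPolynomial.eval ![a, b, 0] (coneForm n p) ≠ 0)
    (hAB : coneForm n p = A * B) (hinf : {t | IsUnit (coneSubst t B)}.Infinite) : IsUnit B := by
  have heval : ∀ (q : Fin 3 → ℂ[X]) (t : ℂ), (MvPolynomial.aeval q B).eval t =
      MvPolynomial.eval (fun i => (q i).eval t) B := by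
    intro q t
    have : (evalRingHom t).comp (MvPolynomial.aeval q).toRingHom =
        MvPolynomial.eval (fun i => (q i).eval t) := by
      refine MvPolynomial.ringHom_ext (fun c => ?_) fun i => ?_ <;> simp
    exact DFunLike.congr_fun this B
  have hconst : ∀ t ∈ {t | IsUnit (coneSubst t B)}, ∀ z y,
      MvPolynomial.eval ![t * y, t * z, t] B = MvPolynomial.eval ![0, 0, t] B := by
    intro t ht z y
    obtain ⟨r, hr, hrC⟩ := Polynomial.isUnit_iff.1 ht
    obtain ⟨s, -, rfl⟩ := Polynomial.isUnit_iff.1 hr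
    have h1 := evalEval_coneSubst t z y B
    have h2 := evalEval_coneSubst t 0 0 B
    rw [← hrC, evalEval_C, eval_C] at h1 h2
    rw [← h1, h2, mul_zero]
  set β : ℂ[X] := MvPolynomial.aeval ![0, 0, X] B with hβ
  have hβe : ∀ t, β.eval t = MvPolynomial.eval ![0, 0, t] B := fun t => by
    rw [hβ, heval]; congr 2; funext i; fin_cases i <;> simp
  have hall : ∀ t z y, MvPolynomial.eval ![t * y, t * z, t] B = β.eval t := by
    intro t z y
    have h1 : MvPolynomial.aeval ![C y * X, C z * X, X] B = β := by
      refine Polynomial.eq_of_infinite_eval_eq _ _ (hinf.mono fun s hs => ?_)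
      rw [Set.mem_ofPred_eq, heval, hβe, ← hconst s hs z y]
      congr 2; funext i; fin_cases i <;> simp <;> ring
    rw [← h1, heval]
    congr 2; funext i; fin_cases i <;> simp <;> ring
  have hB : ∀ a b v, MvPolynomial.eval ![a, b, v] B = β.eval v := by
    have hne : ∀ a b v, v ≠ 0 → MvPolynomial.eval ![a, b, v] B = β.eval v := fun a b v hv => by
      rw [← hall v (b / v) (a / v), mul_div_cancel₀ _ hv, mul_div_cancel₀ _ hv]
    intro a b v
    have h1 : MvPolynomial.aeval ![C a, C b, X] B = β := by
      refine Polynomial.eq_of_infinite_eval_eq _ _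
        ((Set.finite_singleton (0 : ℂ)).infinite_compl.mono fun s hs => ?_)
      rw [Set.mem_ofPred_eq, heval, ← hne a b s hs]
      congr 2; funext i; fin_cases i <;> simp
    rw [← h1, heval]
    congr 2; funext i; fin_cases i <;> simp
  -- At a root `v` the form would vanish on a whole plane: for `v = 0` this contradicts `htop`, and
  -- for `v ≠ 0` it contradicts `p ≠ 0`.
  have hroot : ∀ v, β.eval v ≠ 0 := by
    intro v hv
    have hF : ∀ a b, MvPolynomial.eval ![a, b, v] (coneForm n p) = 0 := fun a b => by
      rw [hAB, map_mul, hB, hv, mul_zero]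
    rcases eq_or_ne v 0 with rfl | hv0
    · obtain ⟨a, b, hab⟩ := htop
      exact hab (hF a b)
    · refine hp (eq_of_evalEval_eq fun z y => ?_)
      have := hF (v * y) (v * z)
      rw [hn.eval_coneForm] at this
      rw [evalEval_zero]
      exact (mul_eq_zero.1 this).resolve_left (pow_ne_zero n hv0)
  have hdeg : β.degree = 0 := by
    by_contra h
    obtain ⟨v, hv⟩ := IsAlgClosed.exists_root β h
    exact hroot v hv
  rw [Polynomial.eq_C_of_degree_eq_zero hdeg] at hB hroot
  have hBC : B = MvPolynomial.C (β.coeff 0) := by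
    refine MvPolynomial.funext fun x => ?_
    have h1 := hB (x 0) (x 1) (x 2)
    rw [eval_C] at h1
    rw [MvPolynomial.eval_C, ← h1]
    congr 2; funext i; fin_cases i <;> rfl
  rw [hBC]
  exact (IsUnit.mk0 _ (by simpa using hroot 0)).map MvPolynomial.C

/-- For each `t ≠ 0` the substitution turns the form into a unit times `p`, so one of the two
factors becomes a unit; one of them does so for infinitely many `t`. -/
theorem irreducible_coneForm {n : ℕ} {p : ℂ[X][X]} (hp : Irreducible p)
    (hn : HasTotalDegreeLE n p)
    (htop : ∃ a b, MvPolynomial.eval ![a, b, 0] (coneForm n p) ≠ 0) :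
    Irreducible (coneForm n p) := by
  have hcone : ∀ t, coneSubst t (coneForm n p) = C (C (t ^ n)) * p := fun t =>
    eq_of_evalEval_eq fun z y => by
      rw [evalEval_coneSubst, hn.eval_coneForm, evalEval_mul, evalEval_C, eval_C]
  refine ⟨fun h => hp.not_isUnit ?_, fun A B hAB => ?_⟩
  · have := h.map (coneSubst 1)
    rwa [hcone, one_pow, C_1, C_1, one_mul] at this
  · have hor : ∀ t ∈ ({0}ᶜ : Set ℂ), t ∈ {t | IsUnit (coneSubst t A)} ∪ {t | IsUnit (coneSubst t B)} := by
      intro t ht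
      have hu : IsUnit (C (C (t ^ n)) : ℂ[X][X]) :=
        (((IsUnit.mk0 _ (pow_ne_zero n ht)).map C).map C)
      have hirr : Irreducible (C (C (t ^ n)) * p) := (irreducible_isUnit_mul hu).2 hp
      exact hirr.isUnit_or_isUnit (by rw [← hcone, hAB, map_mul])
    rcases Set.infinite_union.1 ((Set.finite_singleton (0 : ℂ)).infinite_compl.mono hor) with h | h
    · exact .inl (isUnit_of_isUnit_coneSubst hp.ne_zero hn htop (hAB.trans (mul_comm _ _)) h)
    · exact .inr (isUnit_of_isUnit_coneSubst hp.ne_zero hn htop hAB h)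

/-- Since `p` is monic, the leading coefficient of `A` is a unit and specialization at `w` preserves
its degree. As many roots as `deg p` force `A` to take up the whole degree. -/
theorem isUnit_of_card_roots {p A B : ℂ[X][X]} (hp : p.Monic) (hAB : p = A * B) {w : ℂ}
    {s : Finset ℂ} (hs : s.card = p.natDegree) (hA : ∀ y ∈ s, A.evalEval w y = 0) : IsUnit B := by
  have hlc : A.leadingCoeff * B.leadingCoeff = 1 := by rw [← leadingCoeff_mul, ← hAB]; exact hp
  have hA0 : A ≠ 0 := by rintro rfl; simp at hlc
  have hB0 : B ≠ 0 := by rintro rfl; simp at hlc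
  have hne : evalRingHom w A.leadingCoeff ≠ 0 :=
    ((IsUnit.of_mul_eq_one _ hlc).map (evalRingHom w)).ne_zero
  have hdeg : (A.map (evalRingHom w)).natDegree = A.natDegree :=
    natDegree_map_of_leadingCoeff_ne_zero _ hne
  have hm0 : A.map (evalRingHom w) ≠ 0 := fun h => hne (by
    rw [← coeff_natDegree, ← coeff_map, h, coeff_zero])
  have hle : s.card ≤ A.natDegree := by
    rw [← hdeg]
    refine card_le_degree_of_subset_roots fun y hy => ?_
    rw [mem_roots hm0, IsRoot, map_evalRingHom_eval]
    exact hA y hy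
  have hadd : p.natDegree = A.natDegree + B.natDegree := by rw [hAB, natDegree_mul hA0 hB0]
  have hB1 : B.natDegree = 0 := by omega
  rw [eq_C_of_natDegree_eq_zero hB1]
  refine IsUnit.map C ?_
  rw [show B.leadingCoeff = B.coeff 0 by rw [leadingCoeff, hB1]] at hlc
  exact IsUnit.of_mul_eq_one_right _ hlc

end Cone

/-! ### The affine equation of the curve and its zero set. -/

section CurveEquation

open Filter Topology Metric Polynomial

theorem exists_notMem_of_finite {C : Type*} [TopologicalSpace C] [ChartedSpace ℂ C]
    [T2Space C] [Nonempty C] {S : Set C} (hS : S.Finite) : ∃ x, x ∉ S := by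
  obtain ⟨x⟩ := ‹Nonempty C›
  have := nhdsNE_neBot_of_chartedSpace x
  exact (eventually_nhdsNE_notMem_of_finite hS x).exists

/-- A property that holds near the poles of `f` holds for large values of `f`. -/
theorem IsHolomorphicToCP.exists_forall_of_eventually {C : Type*} [TopologicalSpace C]
    [ChartedSpace ℂ C] [IsManifold 𝓘(ℂ, ℂ) ω C] [CompactSpace C] {f : C → CP 1}
    (hf : IsHolomorphicToCP f) {φ : C → Prop}
    (h : ∀ x ∈ poleSet f, ∀ᶠ y in 𝓝[≠] x, φ y) : ∃ R : ℝ, ∀ y, R < ‖affineValue f y‖ → φ y := by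
  suffices ∃ R : ℝ, ∀ y ∈ Set.univ, R < ‖affineValue f y‖ → φ y by simpa using this
  refine isCompact_univ.induction_on (p := fun s => ∃ R : ℝ, ∀ y ∈ s, R < ‖affineValue f y‖ → φ y)
    ⟨0, by simp⟩ (fun s t hst ⟨R, hR⟩ => ⟨R, fun y hy => hR y (hst hy)⟩)
    (fun s t ⟨R, hR⟩ ⟨R', hR'⟩ => ⟨max R R', fun y hy hRy => hy.elim
      (fun hy => hR y hy ((le_max_left _ _).trans_lt hRy))
      fun hy => hR' y hy ((le_max_right _ _).trans_lt hRy)⟩) fun x _ => ?_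
  suffices ∃ R : ℝ, ∀ᶠ y in 𝓝 x, R < ‖affineValue f y‖ → φ y by
    obtain ⟨R, hR⟩ := this
    exact ⟨{y | R < ‖affineValue f y‖ → φ y}, by rw [nhdsWithin_univ]; exact hR, R, fun y hy => hy⟩
  by_cases hx : x ∈ poleSet f
  · refine ⟨0, ?_⟩
    filter_upwards [eventually_nhdsWithin_iff.1 (h x hx)] with y hy hy0
    refine hy fun hyx => ?_
    rw [Set.mem_singleton_iff.1 hyx, affineValue_of_mem_poleSet hx, norm_zero] at hy0
    exact lt_irrefl _ hy0
  · refine ⟨‖affineValue f x‖ + 1, ?_⟩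
    have hcont := (hf.eventually_mdifferentiableAt hx).self_of_nhds.2.continuousAt.norm
    filter_upwards [hcont.eventually_lt_const (lt_add_one _)] with y hy hy'
    exact (lt_asymm hy hy').elim

theorem continuous_evalEval (p : ℂ[X][X]) : Continuous fun q : ℂ × ℂ => p.evalEval q.1 q.2 := by
  simp only [Polynomial.evalEval, eval_eq_sum_range (p := p), eval_finsetSum, eval_mul, eval_pow,
    eval_C]
  exact continuous_finsetSum _ fun k _ =>
    ((p.coeff k).continuous.comp continuous_fst).mul (continuous_snd.pow k)

/-- The equation of the curve `(f, g)`. -/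
theorem IsPrimitiveFor.exists_equation {C : Type*} [TopologicalSpace C] [ChartedSpace ℂ C]
    {f : C → CP 1} {B : Set ℂ} {g : C → ℂ} (hg : IsPrimitiveFor f B g)
    (hfin : ∀ w, (affineValue f ⁻¹' {w}).Finite) :
    ∃ p : ℂ[X][X], p.Monic ∧ ∀ w ∉ B, (hfin w).toFinset.card = p.natDegree ∧
      ∀ y, p.evalEval w y = ∏ x ∈ (hfin w).toFinset, (y - g x) := by
  obtain ⟨d, hd⟩ := exists_card_fiber hfin hg.finite hg.covered
  obtain ⟨c, hc⟩ := exists_nodal_coeff hfin hg.finite hg.covered hg.tempered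
  have hlt : (∑ k ∈ Finset.range d, Polynomial.C (c k) * X ^ k : ℂ[X][X]).degree < d := by
    refine (degree_sum_le _ _).trans_lt ?_
    refine (Finset.sup_lt_iff (WithBot.bot_lt_coe d)).2 fun k hk => ?_
    exact (degree_C_mul_X_pow_le k _).trans_lt (WithBot.coe_lt_coe.2 (Finset.mem_range.1 hk))
  refine ⟨X ^ d + ∑ k ∈ Finset.range d, Polynomial.C (c k) * X ^ k, monic_X_pow_add hlt,
    fun w hw => ⟨?_, fun y => ?_⟩⟩
  · rw [hd w hw, natDegree_eq_of_degree_eq_some (n := d)]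
    rw [degree_add_eq_left_of_degree_lt (by rwa [degree_X_pow]), degree_X_pow]
  · rw [← Lagrange.eval_nodal, (Lagrange.nodal_monic (s := (hfin w).toFinset) (v := g)).as_sum, Lagrange.natDegree_nodal,
      hd w hw]
    simp [Polynomial.evalEval, eval_finsetSum, hc w hw]

variable {C : Type*} [TopologicalSpace C] [ChartedSpace ℂ C]
  [IsManifold 𝓘(ℂ, ℂ) ω C] [T2Space C] [CompactSpace C] [ConnectedSpace C]

/-- Without poles `f` would be a holomorphic function on a compact connected surface, hence
constant. This is needed to reach the point `[1 : 0 : 0]` of the curve. -/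
theorem IsHolomorphicToCP.poleSet_nonempty {f : C → CP 1} (hf : IsHolomorphicToCP f)
    (hc : ¬ ∃ c : CP 1, ∀ x, f x = c) : (poleSet f).Nonempty := by
  rw [Set.nonempty_iff_ne_empty]
  intro h
  have hd : MDifferentiable 𝓘(ℂ, ℂ) 𝓘(ℂ, ℂ) (affineValue f) := fun x =>
    (hf.eventually_mdifferentiableAt (by rw [h]; exact Set.notMem_empty x)).self_of_nhds.2
  obtain ⟨c, hcx⟩ := hd.exists_eq_const_of_compactSpace
  have hfin := hf.finite_fiber hc c
  rw [hcx, show (Function.const C c) ⁻¹' {c} = Set.univ by ext; simp] at hfin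
  obtain ⟨x⟩ := (inferInstance : Nonempty C)
  have := nhdsNE_neBot_of_chartedSpace x
  obtain ⟨y, hy⟩ := (eventually_nhdsNE_notMem_of_finite hfin x).exists
  exact hy (Set.mem_univ y)

variable {f : C → CP 1}

theorem IsHolomorphicToCP.finite_preimage (hf : IsHolomorphicToCP f)
    (hc : ¬ ∃ c : CP 1, ∀ x, f x = c) {B : Set ℂ} (hB : B.Finite) :
    (affineValue f ⁻¹' B).Finite := by
  rw [← Set.biUnion_preimage_singleton]
  exact hB.biUnion fun w _ => hf.finite_fiber hc w

theorem IsPrimitiveFor.evalEval_eq_zero {B : Set ℂ} {g : C → ℂ} (hg : IsPrimitiveFor f B g)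
    (hf : IsHolomorphicToCP f) (hc : ¬ ∃ c : CP 1, ∀ x, f x = c)
    {p : ℂ[X][X]} (hp : ∀ w ∉ B, ∀ y,
      p.evalEval w y = ∏ x ∈ (hf.finite_fiber hc w).toFinset, (y - g x)) {x : C} (hx : x ∉ poleSet f) :
    p.evalEval (affineValue f x) (g x) = 0 := by
  have hz : ContinuousAt (affineValue f) x :=
    (hf.eventually_mdifferentiableAt hx).self_of_nhds.2.continuousAt
  have hgc : ContinuousAt g x := (hg.mdifferentiableAt x hx).continuousAt
  have hcont : ContinuousAt (fun y => p.evalEval (affineValue f y) (g y)) x :=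
    (continuous_evalEval p).continuousAt.comp (hz.prodMk hgc)
  have := nhdsNE_neBot_of_chartedSpace x
  refine tendsto_nhds_unique (hcont.tendsto.mono_left nhdsWithin_le_nhds :
    Tendsto _ (𝓝[≠] x) _) (tendsto_const_nhds.congr' ?_)
  filter_upwards [eventually_nhdsNE_notMem_of_finite (hf.finite_preimage hc hg.finite) x] with y hy
  rw [hp _ hy]
  exact (Finset.prod_eq_zero (i := y) (by simp) (sub_self _)).symm

/-- Over `B` the product formula for `p` is not available, so compactness is used. If `(b, a)` were
not attained, `g` would stay away from `a` over a neighbourhood of `b`, and the product formula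
would bound `p (w, a)` below as `w` tends to `b`. -/
theorem IsPrimitiveFor.exists_point {B : Set ℂ} {g : C → ℂ} (hg : IsPrimitiveFor f B g)
    (hf : IsHolomorphicToCP f) (hc : ¬ ∃ c : CP 1, ∀ x, f x = c)
    {p : ℂ[X][X]} (hp : ∀ w ∉ B, ∀ y,
      p.evalEval w y = ∏ x ∈ (hf.finite_fiber hc w).toFinset, (y - g x))
    {d : ℕ} (hd : ∀ w ∉ B, (hf.finite_fiber hc w).toFinset.card = d)
    {b a : ℂ} (hab : p.evalEval b a = 0) : ∃ x ∉ poleSet f, affineValue f x = b ∧ g x = a := by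
  by_contra! hno
  set z := affineValue f with hz
  have hzc : ∀ x ∉ poleSet f, ContinuousAt z x := fun x hx =>
    (hf.eventually_mdifferentiableAt hx).self_of_nhds.2.continuousAt
  -- One parameter governs both distances, so that bounds on two sets combine by taking the larger
  -- `n`.
  have key : ∃ n : ℕ, ∀ y ∈ Set.univ, y ∉ poleSet f → ‖z y - b‖ < 1 / ((n : ℝ) + 1) →
      1 / ((n : ℝ) + 1) ≤ ‖a - g y‖ := by
    have hmono : ∀ {m n : ℕ}, m ≤ n → 1 / ((n : ℝ) + 1) ≤ 1 / ((m : ℝ) + 1) := fun h =>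
      one_div_le_one_div_of_le (by positivity) (by gcongr)
    refine isCompact_univ.induction_on (p := fun s => ∃ n : ℕ, ∀ y ∈ s, y ∉ poleSet f →
      ‖z y - b‖ < 1 / ((n : ℝ) + 1) → 1 / ((n : ℝ) + 1) ≤ ‖a - g y‖) ⟨0, by simp⟩
      (fun s t hst ⟨n, hn⟩ => ⟨n, fun y hy => hn y (hst hy)⟩)
      (fun s t ⟨m, hm⟩ ⟨n, hn⟩ => ⟨max m n, fun y hy hyP hyb => hy.elim
        (fun hy => (hmono (le_max_left m n)).trans (hm y hy hyP (hyb.trans_le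
          (hmono (le_max_left m n)))))
        fun hy => (hmono (le_max_right m n)).trans (hn y hy hyP (hyb.trans_le
          (hmono (le_max_right m n))))⟩) fun x _ => ?_
    suffices ∃ n : ℕ, ∀ᶠ y in 𝓝 x, y ∉ poleSet f → ‖z y - b‖ < 1 / ((n : ℝ) + 1) →
        1 / ((n : ℝ) + 1) ≤ ‖a - g y‖ by
      obtain ⟨n, hn⟩ := this
      exact ⟨{y | y ∉ poleSet f → ‖z y - b‖ < 1 / ((n : ℝ) + 1) → 1 / ((n : ℝ) + 1) ≤ ‖a - g y‖},
        by rw [nhdsWithin_univ]; exact hn, n, fun y hy => hy⟩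
    by_cases hx : x ∈ poleSet f
    · refine ⟨0, ?_⟩
      have h1 := (hf.tendsto_inv_affineValue hx).norm
      rw [norm_zero] at h1
      have h2 := eventually_nhdsWithin_iff.1
        (eventually_nhdsNE_notMem_of_finite (hf.finite_fiber hc 0) x)
      filter_upwards [h1.eventually_lt_const (u := (‖b‖ + 1)⁻¹) (by positivity), h2]
        with y h3 h4 hyP hyb
      exfalso
      have h5 : z y ≠ 0 := h4 fun h => hyP (by rw [Set.mem_singleton_iff.1 h]; exact hx)
      rw [norm_inv, inv_lt_inv₀ (norm_pos_iff.2 h5) (by positivity)] at h3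
      have h6 := norm_sub_norm_le (z y) b
      norm_num at hyb
      linarith
    · by_cases hxb : z x = b
      · have h1 : 0 < ‖a - g x‖ := norm_pos_iff.2 (sub_ne_zero.2 fun h => hno x hx hxb h.symm)
        obtain ⟨n, hn⟩ := exists_nat_one_div_lt h1
        refine ⟨n, ?_⟩
        have h2 : ContinuousAt (fun y => ‖a - g y‖) x :=
          (continuousAt_const.sub (hg.mdifferentiableAt x hx).continuousAt).norm
        filter_upwards [h2.eventually_const_lt hn] with y hy _ _ using hy.le
      · have h1 : 0 < ‖z x - b‖ := norm_pos_iff.2 (sub_ne_zero.2 hxb)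
        obtain ⟨n, hn⟩ := exists_nat_one_div_lt h1
        refine ⟨n, ?_⟩
        have h2 : ContinuousAt (fun y => ‖z y - b‖) x := ((hzc x hx).sub continuousAt_const).norm
        filter_upwards [h2.eventually_const_lt hn] with y hy _ hyb using (lt_asymm hy hyb).elim
  obtain ⟨n, hn⟩ := key
  set δ : ℝ := 1 / ((n : ℝ) + 1) with hδ
  have hδ0 : 0 < δ := by positivity
  have hcont : ContinuousAt (fun w => ‖p.evalEval w a‖) b :=
    ((continuous_evalEval p).comp (continuous_id.prodMk continuous_const)).norm.continuousAt
  have hlow : δ ^ d ≤ ‖p.evalEval b a‖ := by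
    refine ge_of_tendsto (hcont.tendsto.mono_left nhdsWithin_le_nhds :
      Tendsto _ (𝓝[≠] b) _) ?_
    filter_upwards [eventually_nhdsNE_notMem_of_finite hg.finite b,
      nhdsWithin_le_nhds (ball_mem_nhds b hδ0)] with w hwB hwb
    rw [hp w hwB, norm_prod, ← hd w hwB, ← Finset.prod_const]
    refine Finset.prod_le_prod (fun _ _ => hδ0.le) fun x hx => ?_
    have hx' : z x = w := by simpa using hx
    refine hn x (Set.mem_univ x) (fun hxP => hwB ?_) ?_
    · rw [← hx', hz, affineValue_of_mem_poleSet hxP]; exact hg.zero_mem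
    · rw [hx', ← dist_eq_norm]; exact hwb
  rw [hab, norm_zero] at hlow
  exact (pow_pos hδ0 d).not_ge hlow

end CurveEquation

/-! ### Behaviour at infinity and irreducibility of the equation. -/

section PlaneCurve

open Filter Topology Metric Polynomial

variable {C : Type*} [TopologicalSpace C] [ChartedSpace ℂ C] {f : C → CP 1}
  {B : Set ℂ} {g : C → ℂ}

theorem IsMeroAt.evalEval {u v : C → ℂ} {x : C} (hu : IsMeroAt u x) (hv : IsMeroAt v x)
    (p : ℂ[X][X]) : IsMeroAt (fun y => p.evalEval (u y) (v y)) x := by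
  simp only [Polynomial.evalEval, eval_eq_sum_range (p := p), eval_finsetSum, eval_mul, eval_pow,
    eval_C]
  exact IsMeroAt.sum fun k _ => (hu.polynomial_eval _).mul (hv.pow k)

variable [IsManifold 𝓘(ℂ, ℂ) ω C]

theorem IsPrimitiveFor.eventually_mdifferentiableAt (hg : IsPrimitiveFor f B g)
    (hf : IsHolomorphicToCP f) {x : C} (hx : x ∉ poleSet f) :
    ∀ᶠ y in 𝓝 x, MDifferentiableAt 𝓘(ℂ, ℂ) 𝓘(ℂ, ℂ) g y := by
  filter_upwards [hf.eventually_mdifferentiableAt hx] with y hy using hg.mdifferentiableAt y hy.1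

variable [T2Space C]

theorem mdifferentiableAt_extend_zero {P : Set C} (hP : P.Finite) {u : C → ℂ} {x : C}
    (h0 : Tendsto u (𝓝[≠] x) (𝓝 0)) (hx : x ∈ P)
    (hu : ∀ᶠ y in 𝓝[≠] x, MDifferentiableAt 𝓘(ℂ, ℂ) 𝓘(ℂ, ℂ) u y) (v : C → ℂ)
    (hv : ∀ y ∈ P, v y = 0) (huv : ∀ y ∉ P, v y = u y) :
    ∀ᶠ y in 𝓝 x, MDifferentiableAt 𝓘(ℂ, ℂ) 𝓘(ℂ, ℂ) v y := by
  have hPx : ∀ᶠ y in 𝓝[≠] x, y ∉ P := eventually_nhdsNE_notMem_of_finite hP x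
  have h1 : ∀ᶠ y in 𝓝[≠] x, MDifferentiableAt 𝓘(ℂ, ℂ) 𝓘(ℂ, ℂ) v y := by
    filter_upwards [hPx, hu] with y h2 h3
    refine h3.congr_of_eventuallyEq ?_
    filter_upwards [hP.isClosed.isOpen_compl.mem_nhds h2] with w hw using huv w hw
  have h2 : MDifferentiableAt 𝓘(ℂ, ℂ) 𝓘(ℂ, ℂ) v x := by
    refine mdifferentiableAt_of_punctured ?_ h1
    rw [hv x hx]
    refine h0.congr' ?_
    filter_upwards [hPx] with y hy using (huv y hy).symm
  rw [eventually_nhdsWithin_iff] at h1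
  filter_upwards [h1] with y hy
  by_cases hyx : y = x
  · rwa [hyx]
  · exact hy hyx

variable [CompactSpace C] [ConnectedSpace C]

/-- At infinity, the curve passes only through `[1 : 0 : 0]`. -/
theorem IsPrimitiveFor.eval_coneForm_infinity (hg : IsPrimitiveFor f B g)
    (hf : IsHolomorphicToCP f) (hc : ¬ ∃ c : CP 1, ∀ x, f x = c)
    {p : ℂ[X][X]} (hp : ∀ w ∉ B, ∀ y,
      p.evalEval w y = ∏ x ∈ (hf.finite_fiber hc w).toFinset, (y - g x))
    {d : ℕ} (hd : ∀ w ∉ B, (hf.finite_fiber hc w).toFinset.card = d)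
    {n : ℕ} (hn : HasTotalDegreeLE n p) (a : ℂ) :
    MvPolynomial.eval ![a, 1, 0] (coneForm n p) = MvPolynomial.eval ![0, 1, 0] (coneForm n p) := by
  set z := affineValue f with hz
  set l : Filter ℂ := Bornology.cobounded ℂ with hl
  have hlim : ∀ a : ℂ, Tendsto (fun w : ℂ => MvPolynomial.eval ![a, 1, w⁻¹] (coneForm n p)) l
      (𝓝 (MvPolynomial.eval ![a, 1, 0] (coneForm n p))) := by
    intro a
    have h1 : Tendsto (fun w : ℂ => w⁻¹) l (𝓝 0) := tendsto_inv₀_cobounded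
    simp only [eval_coneForm']
    exact tendsto_finsetSum _ fun k _ => tendsto_finsetSum _ fun j _ =>
      (((h1.pow _).const_mul _).const_mul _)
  have hlB : ∀ᶠ w in l, w ∉ B := hg.finite.isBounded
  have hl0 : ∀ᶠ w in l, w ≠ 0 := by
    exact (Set.finite_singleton (0 : ℂ)).isBounded
  have hval : ∀ a w : ℂ, w ≠ 0 → w ∉ B → MvPolynomial.eval ![a, 1, w⁻¹] (coneForm n p) =
      w⁻¹ ^ n * ∏ x ∈ (hf.finite_fiber hc w).toFinset, (a * w - g x) := by
    intro a w hw hwB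
    rw [← hp w hwB, ← hn.eval_coneForm, inv_mul_cancel₀ hw, mul_comm a w, inv_mul_cancel_left₀ hw]
  have hsmall : ∀ ε > 0, ∀ᶠ w in l, ∀ x, z x = w → g x ≠ 0 ∧ ‖z x / g x‖ < ε := by
    intro ε hε
    obtain ⟨R, hR⟩ := hf.exists_forall_of_eventually (φ := fun x => g x ≠ 0 ∧ ‖z x / g x‖ < ε)
      fun x hx => by
        have h1 := (hg.tendsto_div x hx).norm
        rw [norm_zero] at h1
        filter_upwards [hg.eventually_ne x hx, h1.eventually_lt_const hε] with y h2 h3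
        exact ⟨h2, h3⟩
    filter_upwards [tendsto_norm_cobounded_atTop.eventually_gt_atTop R] with w hw x hx
    exact hR x (by rw [← hz, hx]; exact hw)
  -- Dividing the form at `[a : 1 : 1 / w]` by the same with `a = 0` leaves this product. It has the
  -- fixed number `d` of factors, each near `1` for large `w` because `z / g` tends to `0` at the
  -- poles.
  have hratio : Tendsto (fun w => ∏ x ∈ (hf.finite_fiber hc w).toFinset, (1 + -(a * (z x / g x))))
      l (𝓝 1) := by
    rw [tendsto_iff_norm_sub_tendsto_zero]
    have hbound : ∀ ε > 0, ∀ᶠ w in l,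
        ‖(∏ x ∈ (hf.finite_fiber hc w).toFinset, (1 + -(a * (z x / g x)))) - 1‖ ≤
          Real.exp (d * (‖a‖ * ε)) - 1 := by
      intro ε hε
      filter_upwards [hsmall ε hε, hlB] with w h1 hwB
      refine (Finset.norm_prod_one_add_sub_one_le _ _).trans ?_
      gcongr
      refine (Finset.sum_le_card_nsmul _ _ (‖a‖ * ε) fun x hx => ?_).trans_eq ?_
      · have hx' : z x = w := by simpa using hx
        rw [norm_neg, norm_mul]
        exact mul_le_mul_of_nonneg_left (h1 x hx').2.le (norm_nonneg _)
      · rw [hd w hwB, nsmul_eq_mul]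
    rw [Metric.tendsto_nhds]
    intro δ hδ
    have hcont : Tendsto (fun ε : ℝ => Real.exp (d * (‖a‖ * ε)) - 1) (𝓝[>] 0) (𝓝 0) := by
      have : Continuous fun ε : ℝ => Real.exp (d * (‖a‖ * ε)) - 1 := by fun_prop
      have h := this.tendsto 0
      simp only [mul_zero, Real.exp_zero, sub_self] at h
      exact h.mono_left nhdsWithin_le_nhds
    obtain ⟨ε, hε, hε0⟩ := ((hcont.eventually_lt_const hδ).and self_mem_nhdsWithin).exists
    filter_upwards [hbound ε hε0] with w hw
    rw [Real.dist_eq, sub_zero, abs_norm]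
    exact hw.trans_lt hε
  have hprod : Tendsto (fun w : ℂ => MvPolynomial.eval ![a, 1, w⁻¹] (coneForm n p)) l
      (𝓝 (MvPolynomial.eval ![0, 1, 0] (coneForm n p) * 1)) := by
    refine ((hlim 0).mul hratio).congr' ?_
    filter_upwards [hl0, hlB, hsmall 1 one_pos] with w h1 h2 h3
    rw [hval _ w h1 h2, hval _ w h1 h2, mul_assoc, ← Finset.prod_mul_distrib]
    refine congrArg _ (Finset.prod_congr rfl fun x hx => ?_)
    have hx' : z x = w := by simpa using hx
    have := (h3 x hx').1
    rw [hx']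
    field_simp
    ring
  have := tendsto_nhds_unique (hlim a) hprod
  rwa [mul_one] at this

-- The functions `1 / g` and `f / g` are the affine coordinates of the plane map near `[1 : 0 : 0]`;
-- both have removable singularities with value `0`.
open Classical in
theorem IsPrimitiveFor.mdifferentiableAt_at_pole (hg : IsPrimitiveFor f B g)
    (hf : IsHolomorphicToCP f) (hc : ¬ ∃ c : CP 1, ∀ x, f x = c) {x : C} (hx : x ∈ poleSet f) :
    (∀ᶠ y in 𝓝 x, MDifferentiableAt 𝓘(ℂ, ℂ) 𝓘(ℂ, ℂ)
        (fun y => if y ∈ poleSet f then 0 else (g y)⁻¹) y) ∧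
      ∀ᶠ y in 𝓝 x, MDifferentiableAt 𝓘(ℂ, ℂ) 𝓘(ℂ, ℂ)
        (fun y => if y ∈ poleSet f then 0 else affineValue f y / g y) y := by
  have hP := hf.finite_poleSet hc
  have hPx : ∀ᶠ y in 𝓝[≠] x, y ∉ poleSet f := eventually_nhdsNE_notMem_of_finite hP x
  constructor
  · refine mdifferentiableAt_extend_zero hP (hg.tendsto_inv x hx) hx ?_ _
      (fun y hy => if_pos hy) fun y hy => if_neg hy
    filter_upwards [hPx, hg.eventually_ne x hx] with y h1 h2
    have h3 := hg.mdifferentiableAt y h1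
    have hy := mem_chart_source ℂ y
    rw [mdifferentiableAt_iff_chartAt hy] at h3 ⊢
    refine DifferentiableAt.fun_inv h3 ?_
    simpa [(chartAt ℂ y).left_inv hy] using h2
  · refine mdifferentiableAt_extend_zero hP (hg.tendsto_div x hx) hx ?_ _
      (fun y hy => if_pos hy) fun y hy => if_neg hy
    filter_upwards [hPx, hg.eventually_ne x hx] with y h1 h2
    have h3 := hg.mdifferentiableAt y h1
    have h4 := (hf.eventually_mdifferentiableAt h1).self_of_nhds.2
    have hy := mem_chart_source ℂ y
    rw [mdifferentiableAt_iff_chartAt hy] at h3 h4 ⊢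
    refine DifferentiableAt.fun_div h4 h3 ?_
    simpa [(chartAt ℂ y).left_inv hy] using h2

theorem IsPrimitiveFor.isMeroAt (hg : IsPrimitiveFor f B g)
    (hf : IsHolomorphicToCP f) (hc : ¬ ∃ c : CP 1, ∀ x, f x = c) (x : C) : IsMeroAt g x := by
  classical
  by_cases hx : x ∈ poleSet f
  · have h := (isMeroAt_const 1 x).div
      (isMeroAt_of_mdifferentiableAt (hg.mdifferentiableAt_at_pole hf hc hx).1)
    refine h.congr ?_
    filter_upwards [eventually_nhdsNE_notMem_of_finite (hf.finite_poleSet hc) x] with y hy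
    rw [if_neg hy, one_div, inv_inv]
  · exact isMeroAt_of_mdifferentiableAt (hg.eventually_mdifferentiableAt hf hx)

/-- For `p = A * D` the meromorphic functions `A (f, g)` and `D (f, g)` have product zero, so one of
them vanishes off a finite set. Over a general `w` that factor has all the distinct values of `g` as
roots, and the other factor is a unit. -/
theorem IsPrimitiveFor.irreducible (hg : IsPrimitiveFor f B g)
    (hf : IsHolomorphicToCP f) (hc : ¬ ∃ c : CP 1, ∀ x, f x = c)
    {p : ℂ[X][X]} (hpm : p.Monic) (hp : ∀ w ∉ B, ∀ y,
      p.evalEval w y = ∏ x ∈ (hf.finite_fiber hc w).toFinset, (y - g x))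
    (hd : ∀ w ∉ B, (hf.finite_fiber hc w).toFinset.card = p.natDegree) : Irreducible p := by
  classical
  have hunit : ∀ A D : ℂ[X][X], p = A * D →
      {x | A.evalEval (affineValue f x) (g x) ≠ 0}.Finite → IsUnit D := by
    intro A D hAD hfin
    obtain ⟨w, hw⟩ := (hg.finite.union (hfin.image (affineValue f))).infinite_compl.nonempty
    rw [Set.mem_compl_iff, Set.mem_union, not_or] at hw
    have hmem : ∀ x, x ∈ (hf.finite_fiber hc w).toFinset ↔ affineValue f x = w := fun x => by simp
    refine isUnit_of_card_roots hpm hAD (w := w)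
      (s := (hf.finite_fiber hc w).toFinset.image g) ?_ ?_
    · rw [Finset.card_image_of_injOn, hd w hw.1]
      exact fun x hx y hy => hg.injOn w hw.1 ((hmem x).1 hx) ((hmem y).1 hy)
    · intro y hy
      obtain ⟨x, hx, rfl⟩ := Finset.mem_image.1 hy
      by_contra hne
      refine hw.2 ⟨x, ?_, (hmem x).1 hx⟩
      rw [Set.mem_ofPred_eq, (hmem x).1 hx]
      exact hne
  refine ⟨fun h => ?_, fun A D hAD => ?_⟩
  · have h0 : p.natDegree = 0 := by rw [(hpm.isUnit_iff).1 h, natDegree_one]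
    obtain ⟨x, hx⟩ := exists_notMem_of_finite (hf.finite_preimage hc hg.finite)
    have := hd _ hx
    rw [h0, Finset.card_eq_zero] at this
    exact Finset.notMem_empty x (this ▸ by simp)
  · have hmero : ∀ x, ∀ A : ℂ[X][X], IsMeroAt (fun y => A.evalEval (affineValue f y) (g y)) x :=
      fun x A => (hf.isMeroAt x).evalEval (hg.isMeroAt hf hc x) A
    rcases finite_zeros_or_of_isMeroAt fun x => hmero x A with hA | hA
    · rcases finite_zeros_or_of_isMeroAt fun x => hmero x D with hD | hD
      · exfalso
        obtain ⟨x, hx⟩ := exists_notMem_of_finite ((hA.union hD).union (hf.finite_poleSet hc))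
        rw [Set.mem_union, Set.mem_union, not_or, not_or] at hx
        have h0 := hg.evalEval_eq_zero hf hc hp hx.2
        rw [hAD, evalEval_mul] at h0
        exact (mul_eq_zero.1 h0).elim hx.1.1 hx.1.2
      · exact .inl (hunit D A (hAD.trans (mul_comm _ _)) hD)
    · exact .inr (hunit A D hAD hA)

end PlaneCurve

/-! ### The plane map `[g : f : 1]` and its image. -/

section PlaneMap

open Filter Topology Metric Polynomial

/-- The point `[1 : 0 : 0]`. -/
noncomputable def planeCenter : CP 2 :=
  Projectivization.mk ℂ ![1, 0, 0] fun h => one_ne_zero (congrFun h 0)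

/-- The point `[a : b : 1]`. -/
noncomputable def planePoint (a b : ℂ) : CP 2 :=
  Projectivization.mk ℂ ![a, b, 1] fun h => one_ne_zero (congrFun h 2)

open Classical in
/-- The map `[g : f : 1]`, with the value `[1 : 0 : 0]` at the poles of `f`. -/
noncomputable def planeMap {C : Type*} (f : C → CP 1) (g : C → ℂ) (x : C) : CP 2 :=
  if x ∈ poleSet f then planeCenter else planePoint (g x) (affineValue f x)

theorem exists_rep_eq {n : ℕ} {v : Fin (n + 1) → ℂ} (hv : v ≠ 0) :
    ∃ a : ℂ, a ≠ 0 ∧ (Projectivization.mk ℂ v hv).rep = a • v := by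
  obtain ⟨a, ha⟩ := Projectivization.exists_smul_eq_mk_rep ℂ v hv
  exact ⟨a, a.ne_zero, ha.symm⟩

theorem exists_rep_planeCenter : ∃ a : ℂ, a ≠ 0 ∧ planeCenter.rep = ![a, 0, 0] := by
  obtain ⟨a, ha, h⟩ := exists_rep_eq (n := 2) (v := ![1, 0, 0]) fun h => one_ne_zero (congrFun h 0)
  exact ⟨a, ha, by rw [planeCenter, h]; simp⟩

theorem exists_rep_planePoint (a b : ℂ) :
    ∃ t : ℂ, t ≠ 0 ∧ (planePoint a b).rep = ![t * a, t * b, t] := by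
  obtain ⟨t, ht, h⟩ := exists_rep_eq (n := 2) (v := ![a, b, 1]) fun h => one_ne_zero (congrFun h 2)
  exact ⟨t, ht, by rw [planePoint, h]; simp⟩

theorem planePoint_ne_planeCenter (a b : ℂ) : planePoint a b ≠ planeCenter := by
  intro h
  rw [planePoint, planeCenter, Projectivization.mk_eq_mk_iff'] at h
  obtain ⟨t, ht⟩ := h
  simpa using congrFun ht 2

theorem planePoint_inj {a b a' b' : ℂ} (h : planePoint a b = planePoint a' b') : a = a' ∧ b = b' := by
  rw [planePoint, planePoint, Projectivization.mk_eq_mk_iff'] at h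
  obtain ⟨t, ht⟩ := h
  have h2 := congrFun ht 2
  have h0 := congrFun ht 0
  have h1 := congrFun ht 1
  simp at h0 h1 h2
  rw [h2, one_mul] at h0 h1
  exact ⟨h0.symm, h1.symm⟩

theorem eq_planeCenter {q : CP 2} (h1 : q.rep 1 = 0) (h2 : q.rep 2 = 0) : q = planeCenter := by
  rw [← q.mk_rep, planeCenter, Projectivization.mk_eq_mk_iff']
  refine ⟨q.rep 0, funext fun i => ?_⟩
  fin_cases i <;> simp [h1, h2]

theorem eq_planePoint {q : CP 2} (h2 : q.rep 2 ≠ 0) :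
    q = planePoint (q.rep 0 / q.rep 2) (q.rep 1 / q.rep 2) := by
  conv_lhs => rw [← q.mk_rep]
  rw [planePoint, Projectivization.mk_eq_mk_iff']
  refine ⟨q.rep 2, funext fun i => ?_⟩
  fin_cases i <;> simp [mul_div_cancel₀ _ h2]

section

variable {C : Type*} {f : C → CP 1} {g : C → ℂ}

theorem planeMap_of_mem {x : C} (hx : x ∈ poleSet f) : planeMap f g x = planeCenter := if_pos hx

theorem planeMap_of_notMem {x : C} (hx : x ∉ poleSet f) :
    planeMap f g x = planePoint (g x) (affineValue f x) := if_neg hx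

theorem planeMap_eq_planeCenter_iff {x : C} : planeMap f g x = planeCenter ↔ x ∈ poleSet f := by
  refine ⟨fun h => ?_, planeMap_of_mem⟩
  by_contra hx
  rw [planeMap_of_notMem hx] at h
  exact planePoint_ne_planeCenter _ _ h

theorem planeMap_eq_of_notMem {x y : C} (hx : x ∉ poleSet f) (h : planeMap f g y = planeMap f g x) :
    y ∉ poleSet f ∧ g y = g x ∧ affineValue f y = affineValue f x := by
  have hy : y ∉ poleSet f := fun hy =>
    hx (planeMap_eq_planeCenter_iff.1 (h.symm.trans (planeMap_of_mem hy)))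
  rw [planeMap_of_notMem hx, planeMap_of_notMem hy] at h
  exact ⟨hy, planePoint_inj h⟩

/-- Projection from `[1 : 0 : 0]` sends `[g : f : 1]` to `[f : 1]`. -/
theorem factorsThroughProjection_planeMap (hfin : (poleSet f).Finite) :
    FactorsThroughProjection f planeCenter (planeMap f g) := by
  refine ⟨hfin.subset fun x hx => planeMap_eq_planeCenter_iff.1 hx, ?_⟩
  -- Forgetting the first coordinate has the line of `planeCenter` as kernel, so it identifies the
  -- pencil with `CP 1`.
  set π : (Fin 3 → ℂ) →ₗ[ℂ] (Fin 2 → ℂ) := LinearMap.funLeft ℂ ℂ Fin.succ with hπ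
  have hsurj : Function.Surjective π :=
    LinearMap.funLeft_surjective_of_injective ℂ ℂ _ (Fin.succ_injective 2)
  have hker : planeCenter.submodule = LinearMap.ker π := by
    rw [planeCenter, Projectivization.submodule_mk]
    ext v
    rw [Submodule.mem_span_singleton, LinearMap.mem_ker]
    constructor
    · rintro ⟨a, rfl⟩
      funext i
      fin_cases i <;> simp [hπ, LinearMap.funLeft_apply]
    · intro h
      have h0 : v 1 = 0 := congrFun h 0
      have h1 : v 2 = 0 := congrFun h 1
      refine ⟨v 0, funext fun i => ?_⟩
      fin_cases i <;> simp [h0, h1]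
  refine ⟨(Submodule.quotEquivOfEq _ _ hker).trans (π.quotKerEquivOfSurjective hsurj), fun x hx => ?_⟩
  have hxP : x ∉ poleSet f := fun h => hx (planeMap_of_mem h)
  rw [projectFrom, Projectivization.map_mk, ← (f x).mk_rep, Projectivization.mk_eq_mk_iff']
  obtain ⟨t, ht, hrep⟩ := exists_rep_planePoint (g x) (affineValue f x)
  have hval : ((Submodule.quotEquivOfEq _ _ hker).trans
      (π.quotKerEquivOfSurjective hsurj)).toLinearMap (planeCenter.submodule.mkQ
        (planeMap f g x).rep) = π (planeMap f g x).rep := rfl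
  rw [hval, planeMap_of_notMem hxP, hrep]
  have h1 : (f x).rep 1 ≠ 0 := hxP
  refine ⟨(f x).rep 1 / t, funext fun i => ?_⟩
  fin_cases i
  · simp only [hπ, affineValue, Fin.zero_eta, Pi.smul_apply, LinearMap.funLeft_apply, smul_eq_mul]
    simp
    field_simp
  · simp only [hπ, Fin.mk_one, Pi.smul_apply, LinearMap.funLeft_apply, smul_eq_mul]
    simp
    field_simp

end

variable {C : Type*} [TopologicalSpace C] [ChartedSpace ℂ C]
  [IsManifold 𝓘(ℂ, ℂ) ω C] {f : C → CP 1} {B : Set ℂ} {g : C → ℂ}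

theorem mdifferentiableAt_vec3 {u v w : C → ℂ} {x : C} (hu : MDifferentiableAt 𝓘(ℂ, ℂ) 𝓘(ℂ, ℂ) u x)
    (hv : MDifferentiableAt 𝓘(ℂ, ℂ) 𝓘(ℂ, ℂ) v x) (hw : MDifferentiableAt 𝓘(ℂ, ℂ) 𝓘(ℂ, ℂ) w x) :
    MDifferentiableAt 𝓘(ℂ, ℂ) 𝓘(ℂ, Fin 3 → ℂ) (fun y => ![u y, v y, w y]) x := by
  have hx := mem_chart_source ℂ x
  rw [mdifferentiableAt_iff_chartAt hx] at hu hv hw ⊢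
  rw [differentiableAt_pi]
  intro i
  fin_cases i
  exacts [hu, hv, hw]

variable [T2Space C] [CompactSpace C] [ConnectedSpace C]

theorem IsPrimitiveFor.isHolomorphicToCP_planeMap (hg : IsPrimitiveFor f B g)
    (hf : IsHolomorphicToCP f) (hc : ¬ ∃ c : CP 1, ∀ x, f x = c) :
    IsHolomorphicToCP (planeMap f g) := by
  classical
  have hone : ∀ x, MDifferentiableAt 𝓘(ℂ, ℂ) 𝓘(ℂ, ℂ) (fun _ : C => (1 : ℂ)) x := fun x =>
    mdifferentiableAt_const
  intro x
  by_cases hx : x ∈ poleSet f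
  · obtain ⟨h1, h2⟩ := hg.mdifferentiableAt_at_pole hf hc hx
    have h3 : ∀ᶠ y in 𝓝 x, y ∈ poleSet f ∨ g y ≠ 0 := by
      filter_upwards [eventually_nhdsWithin_iff.1 (hg.eventually_ne x hx)] with y hy
      by_cases hyx : y = x
      · exact .inl (hyx ▸ hx)
      · exact .inr (hy hyx)
    obtain ⟨U, hU, hUo, hxU⟩ := eventually_nhds_iff.1 (h1.and (h2.and h3))
    refine ⟨U, hUo, hxU, fun y => ![1, if y ∈ poleSet f then 0 else affineValue f y / g y,
      if y ∈ poleSet f then 0 else (g y)⁻¹], fun y hy => ?_, fun y hy =>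
      ⟨fun h => one_ne_zero (congrFun h 0), ?_⟩⟩
    · exact (mdifferentiableAt_vec3 (hone y) (hU y hy).2.1
        (hU y hy).1).mdifferentiableWithinAt
    · by_cases hyP : y ∈ poleSet f
      · simp only [planeMap_of_mem hyP, hyP, if_true, planeCenter]
      · have hgy := (hU y hy).2.2.resolve_left hyP
        simp only [planeMap_of_notMem hyP, hyP, if_false, planePoint]
        rw [Projectivization.mk_eq_mk_iff']
        refine ⟨g y, funext fun i => ?_⟩
        fin_cases i <;> simp [mul_div_cancel₀ _ hgy, hgy]
  · refine ⟨(poleSet f)ᶜ, (hf.finite_poleSet hc).isClosed.isOpen_compl, hx,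
      fun y => ![g y, affineValue f y, 1], fun y hy => ?_, fun y hy =>
      ⟨fun h => one_ne_zero (congrFun h 2), planeMap_of_notMem hy⟩⟩
    exact (mdifferentiableAt_vec3 (hg.mdifferentiableAt y hy)
      (hf.eventually_mdifferentiableAt hy).self_of_nhds.2 (hone y)).mdifferentiableWithinAt

theorem IsPrimitiveFor.isIrreduciblePlaneCurve (hg : IsPrimitiveFor f B g)
    (hf : IsHolomorphicToCP f) (hc : ¬ ∃ c : CP 1, ∀ x, f x = c) :
    IsIrreduciblePlaneCurve (Set.range (planeMap f g)) := by
  obtain ⟨p, hpm, hp'⟩ := hg.exists_equation (hf.finite_fiber hc)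
  have hp := fun w hw => (hp' w hw).2
  have hd := fun w hw => (hp' w hw).1
  have hirr := hg.irreducible hf hc hpm hp hd
  obtain ⟨n, hn, k, hkn, hk⟩ := exists_totalDegree hirr.ne_zero
  have hn0 : n ≠ 0 := by
    rintro rfl
    refine hirr.not_isUnit ?_
    have h0 : p.natDegree = 0 := Nat.le_zero.1 <| natDegree_le_iff_coeff_eq_zero.2 fun k hk =>
      Polynomial.ext fun j => by rw [hn k j (by omega), coeff_zero]
    rw [hpm.natDegree_eq_zero.1 h0]
    exact isUnit_one
  have hinf := hg.eval_coneForm_infinity hf hc hp hd hn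
  set c := MvPolynomial.eval ![0, 1, 0] (coneForm n p) with hcdef
  -- Independence of `a` on the line `b = 1` kills every top-degree coefficient that involves the
  -- first variable. The line at infinity thus meets the curve only where `b = 0`.
  have hval : ∀ a b, MvPolynomial.eval ![a, b, 0] (coneForm n p) = c * b ^ n := by
    set q : ℂ[X] := ∑ k ∈ Finset.range (n + 1), Polynomial.C ((p.coeff k).coeff (n - k)) * X ^ k
      with hq
    have hqe : q = Polynomial.C c := Polynomial.funext fun a => by
      rw [eval_C, ← hinf a, _root_.eval_coneForm_infinity, hq]
      simp [eval_finsetSum]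
    have hcoeff : ∀ k ∈ Finset.range (n + 1), k ≠ 0 → (p.coeff k).coeff (n - k) = 0 := by
      intro k hk hk0
      have h1 : q.coeff k = 0 := by rw [hqe, coeff_C_of_ne_zero hk0]
      rw [hq, finsetSum_coeff] at h1
      simpa [coeff_C_mul, coeff_X_pow, Finset.mem_range.1 hk] using h1
    have hsum : ∀ a b, MvPolynomial.eval ![a, b, 0] (coneForm n p) =
        (p.coeff 0).coeff n * b ^ n := by
      intro a b
      rw [_root_.eval_coneForm_infinity, Finset.sum_eq_single 0]
      · simp
      · intro k hk hk0
        rw [hcoeff k hk hk0, zero_mul]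
      · simp
    intro a b
    rw [hcdef, hsum, hsum, one_pow, mul_one]
  -- Otherwise the whole part of degree `n` would vanish, against the choice of `n`.
  have hc0 : c ≠ 0 := by
    intro h0
    have hq : (∑ k ∈ Finset.range (n + 1),
        Polynomial.C ((p.coeff k).coeff (n - k)) * X ^ k : ℂ[X]) = 0 := Polynomial.funext fun a => by
      have := hval a 1
      rw [_root_.eval_coneForm_infinity, h0, zero_mul] at this
      simpa [eval_finsetSum] using this
    have h1 := congrArg (fun q => q.coeff k) hq
    simp only [finsetSum_coeff, coeff_C_mul, coeff_X_pow, coeff_zero] at h1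
    refine hk ?_
    simpa [Nat.lt_succ_iff.2 hkn] using h1
  refine ⟨n, coneForm n p, isHomogeneous_coneForm n p, irreducible_coneForm hirr hn
    ⟨0, 1, by rw [hval]; simpa using hc0⟩, ?_⟩
  ext q
  constructor
  · rintro ⟨x, rfl⟩
    change MvPolynomial.eval (planeMap f g x).rep (coneForm n p) = 0
    by_cases hx : x ∈ poleSet f
    · obtain ⟨a, -, ha⟩ := exists_rep_planeCenter
      rw [planeMap_of_mem hx, ha, hval, zero_pow hn0, mul_zero]
    · obtain ⟨t, -, ht⟩ := exists_rep_planePoint (g x) (affineValue f x)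
      rw [planeMap_of_notMem hx, ht, hn.eval_coneForm, hg.evalEval_eq_zero hf hc hp hx, mul_zero]
  · intro hq
    have hrep : q.rep = ![q.rep 0, q.rep 1, q.rep 2] := by
      funext i; fin_cases i <;> rfl
    have hq0 : MvPolynomial.eval q.rep (coneForm n p) = 0 := hq
    by_cases h2 : q.rep 2 = 0
    · rw [hrep, h2, hval] at hq0
      have h1 : q.rep 1 = 0 :=
        (pow_eq_zero_iff hn0).1 ((mul_eq_zero.1 hq0).resolve_left hc0)
      obtain ⟨x, hx⟩ := hf.poleSet_nonempty hc
      exact ⟨x, by rw [planeMap_of_mem hx, eq_planeCenter h1 h2]⟩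
    · have hrep2 : q.rep = ![q.rep 2 * (q.rep 0 / q.rep 2), q.rep 2 * (q.rep 1 / q.rep 2),
          q.rep 2] := by
        rw [mul_div_cancel₀ _ h2, mul_div_cancel₀ _ h2]; exact hrep
      rw [hrep2, hn.eval_coneForm] at hq0
      obtain ⟨x, hx, hzx, hgx⟩ := hg.exists_point hf hc hp hd
        ((mul_eq_zero.1 hq0).resolve_left (pow_ne_zero n h2))
      exact ⟨x, by rw [planeMap_of_notMem hx, hzx, hgx, ← eq_planePoint h2]⟩

end PlaneMap

/-! ### Every meromorphic function is rational in `f` and `g`. -/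

section FunctionField

open Filter Topology Metric Polynomial

variable {C : Type*} [TopologicalSpace C] [ChartedSpace ℂ C]

/-- A high power of a function that vanishes at `x` cancels a pole at `x`. -/
theorem IsMeroAt.exists_bounded_pow_mul {h t : C → ℂ} {x : C} (hh : IsMeroAt h x)
    (ht : IsMeroAt t x) (ht0 : Tendsto t (𝓝[≠] x) (𝓝 0)) :
    ∃ (m : ℕ) (M : ℝ), 0 ≤ M ∧ ∀ᶠ y in 𝓝[≠] x, ‖t y ^ m * h y‖ ≤ M := by
  rw [tendsto_nhdsNE_iff_chartAt] at ht0
  obtain ⟨m, hm⟩ : ∃ m : ℕ, 0 ≤ meromorphicOrderAt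
      ((t ∘ (chartAt ℂ x).symm) ^ m * (h ∘ (chartAt ℂ x).symm)) (chartAt ℂ x x) := by
    have hpos := (tendsto_zero_iff_meromorphicOrderAt_pos ht).1 ht0
    -- The numbers `a` and `b` stand for the orders of `t` and `h`. For finite orders `a ≥ 1`, so `m
    -- = |b|` suffices.
    have key : ∀ a b : WithTop ℤ, 0 < a → ∃ m : ℕ, 0 ≤ m * a + b := by
      intro a b ha
      induction b using WithTop.recTopCoe with
      | top => exact ⟨0, by simp⟩
      | coe b =>
        induction a using WithTop.recTopCoe with
        | top => exact ⟨1, by simp⟩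
        | coe a =>
          have ha' : 1 ≤ a := by exact_mod_cast ha
          obtain ⟨n, hn⟩ : ∃ n : ℕ, 0 ≤ (n : ℤ) * a + b := by
            refine ⟨b.natAbs, ?_⟩
            have h2 : (b.natAbs : ℤ) = |b| := Int.natCast_natAbs b
            have h3 := neg_abs_le b
            nlinarith [abs_nonneg b]
          exact ⟨n, by exact_mod_cast hn⟩
    obtain ⟨m, hm⟩ := key _ (meromorphicOrderAt (h ∘ (chartAt ℂ x).symm) (chartAt ℂ x x)) hpos
    exact ⟨m, by rwa [meromorphicOrderAt_mul (MeromorphicAt.pow ht m) hh, meromorphicOrderAt_pow ht]⟩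
  obtain ⟨c, hc⟩ := (tendsto_nhds_iff_meromorphicOrderAt_nonneg
    (MeromorphicAt.mul (MeromorphicAt.pow ht m) hh)).2 hm
  refine ⟨m, ‖c‖ + 1, by positivity, eventually_nhdsNE_iff_chartAt.2 ?_⟩
  exact (hc.norm.eventually (gt_mem_nhds (lt_add_one _))).mono fun ζ hζ => hζ.le

/-- Over a point outside `B` the equation specializes to the nodal polynomial, whose roots are
simple because `g` separates the fibre. -/
theorem IsPrimitiveFor.derivative_evalEval_ne_zero {f : C → CP 1} {B : Set ℂ} {g : C → ℂ}
    (hg : IsPrimitiveFor f B g) (hfin : ∀ w, (affineValue f ⁻¹' {w}).Finite) {p : ℂ[X][X]}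
    (hp : ∀ w ∉ B, ∀ y, p.evalEval w y = ∏ x ∈ (hfin w).toFinset, (y - g x)) {x : C}
    (hx : affineValue f x ∉ B) :
    (derivative p).evalEval (affineValue f x) (g x) =
      (derivative (Lagrange.nodal (hfin (affineValue f x)).toFinset g)).eval (g x) ∧
    (derivative p).evalEval (affineValue f x) (g x) ≠ 0 := by
  classical
  set w := affineValue f x
  have hmem : x ∈ (hfin w).toFinset := (hfin w).mem_toFinset.2 rfl
  have h1 : p.map (evalRingHom w) = Lagrange.nodal (hfin w).toFinset g :=
    Polynomial.funext fun y => by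
      rw [map_evalRingHom_eval, hp w hx, Lagrange.eval_nodal]
  have h2 : (derivative p).evalEval w (g x) =
      (derivative (Lagrange.nodal (hfin w).toFinset g)).eval (g x) := by
    rw [← h1, derivative_map, map_evalRingHom_eval]
  refine ⟨h2, ?_⟩
  rw [h2, Lagrange.eval_nodal_derivative_eval_node_eq hmem, Lagrange.eval_nodal,
    Finset.prod_ne_zero_iff]
  intro y hy
  obtain ⟨hyx, hy⟩ := Finset.mem_erase.1 hy
  rw [sub_ne_zero]
  exact fun h => hyx (hg.injOn w hx ((hfin w).mem_toFinset.1 hy) rfl h.symm)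

variable [IsManifold 𝓘(ℂ, ℂ) ω C] [T2Space C] [CompactSpace C] [ConnectedSpace C] {f : C → CP 1}

/-- The denominators of a meromorphic function can be cleared by a polynomial in `f`, up to
polynomial growth at the poles of `f`. -/
theorem IsHolomorphicToCP.exists_growth_bound (hf : IsHolomorphicToCP f)
    (hc : ¬ ∃ c : CP 1, ∀ x, f x = c) {u : C → ℂ} (hu : ∀ x, IsMeroAt u x) :
    ∃ Q : ℂ[X], Q ≠ 0 ∧ ∃ (K : ℝ) (N : ℕ), ∀ x,
      ‖Q.eval (affineValue f x) * u x‖ ≤ K * (1 + ‖affineValue f x‖) ^ N := by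
  set z := affineValue f with hz
  suffices H : ∃ Q : ℂ[X], Q ≠ 0 ∧ ∃ (K : ℝ) (N : ℕ), ∀ x ∈ (Set.univ : Set C),
      ‖Q.eval (z x) * u x‖ ≤ K * (1 + ‖z x‖) ^ N by
    obtain ⟨Q, hQ, K, N, h⟩ := H
    exact ⟨Q, hQ, K, N, fun x => h x trivial⟩
  refine isCompact_univ.induction_on (p := fun s => ∃ Q : ℂ[X], Q ≠ 0 ∧ ∃ (K : ℝ) (N : ℕ), ∀ x ∈ s,
      ‖Q.eval (z x) * u x‖ ≤ K * (1 + ‖z x‖) ^ N) ?_ ?_ ?_ ?_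
  · exact ⟨1, one_ne_zero, 0, 0, fun x hx => hx.elim⟩
  · rintro s t hst ⟨Q, hQ, K, N, h⟩
    exact ⟨Q, hQ, K, N, fun x hx => h x (hst hx)⟩
  · rintro s s' ⟨Q, hQ, K, N, h⟩ ⟨Q', hQ', K', N', h'⟩
    obtain ⟨L, hL0, hL⟩ := Q.exists_norm_eval_le
    obtain ⟨L', hL0', hL'⟩ := Q'.exists_norm_eval_le
    -- The product clears the denominators on both sets; on each one the superfluous factor costs
    -- only its own polynomial growth.
    refine ⟨Q * Q', mul_ne_zero hQ hQ', |L' * K| + |L * K'|,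
      (Q'.natDegree + N) + (Q.natDegree + N'), fun x hx => ?_⟩
    have h1 : (1 : ℝ) ≤ 1 + ‖z x‖ := by linarith [norm_nonneg (z x)]
    have h0 : (0 : ℝ) ≤ 1 + ‖z x‖ := by linarith
    rw [eval_mul]
    rcases hx with hx | hx
    · calc ‖Q.eval (z x) * Q'.eval (z x) * u x‖
          = ‖Q'.eval (z x)‖ * ‖Q.eval (z x) * u x‖ := by rw [← norm_mul]; ring_nf
        _ ≤ (L' * (1 + ‖z x‖) ^ Q'.natDegree) * (K * (1 + ‖z x‖) ^ N) :=
          mul_le_mul (hL' _) (h x hx) (norm_nonneg _) (mul_nonneg hL0' (pow_nonneg h0 _))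
        _ = L' * K * (1 + ‖z x‖) ^ (Q'.natDegree + N) := by ring
        _ ≤ _ := mul_le_mul ((le_abs_self _).trans (le_add_of_nonneg_right (abs_nonneg _)))
          (pow_le_pow_right₀ h1 (Nat.le_add_right _ _)) (pow_nonneg h0 _) (by positivity)
    · calc ‖Q.eval (z x) * Q'.eval (z x) * u x‖
          = ‖Q.eval (z x)‖ * ‖Q'.eval (z x) * u x‖ := by rw [← norm_mul]; ring_nf
        _ ≤ (L * (1 + ‖z x‖) ^ Q.natDegree) * (K' * (1 + ‖z x‖) ^ N') :=
          mul_le_mul (hL _) (h' x hx) (norm_nonneg _) (mul_nonneg hL0 (pow_nonneg h0 _))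
        _ = L * K' * (1 + ‖z x‖) ^ (Q.natDegree + N') := by ring
        _ ≤ _ := mul_le_mul ((le_abs_self _).trans (le_add_of_nonneg_left (abs_nonneg _)))
          (pow_le_pow_right₀ h1 (Nat.le_add_left _ _)) (pow_nonneg h0 _) (by positivity)
  · intro x _
    suffices H : ∃ Q : ℂ[X], Q ≠ 0 ∧ ∃ (K : ℝ) (N : ℕ), 0 ≤ K ∧ ∀ᶠ y in 𝓝[≠] x,
        ‖Q.eval (z y) * u y‖ ≤ K * (1 + ‖z y‖) ^ N by
      obtain ⟨Q, hQ, K, N, hK, h⟩ := H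
      -- The arbitrary value at `x` itself is absorbed into the constant.
      refine ⟨{y | y ≠ x → ‖Q.eval (z y) * u y‖ ≤ K * (1 + ‖z y‖) ^ N}, ?_, Q, hQ,
        K + ‖Q.eval (z x) * u x‖, N, fun y hy => ?_⟩
      · rw [nhdsWithin_univ]
        exact eventually_nhdsWithin_iff.1 h
      · have h1 : (1 : ℝ) ≤ (1 + ‖z y‖) ^ N := one_le_pow₀ (by linarith [norm_nonneg (z y)])
        by_cases hyx : y = x
        · subst hyx
          nlinarith [norm_nonneg (Q.eval (z y) * u y)]
        · refine (hy hyx).trans (mul_le_mul_of_nonneg_right ?_ (by positivity))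
          exact le_add_of_nonneg_right (norm_nonneg _)
    by_cases hx : x ∈ poleSet f
    · obtain ⟨m, M, hM, h⟩ := (hu x).exists_bounded_pow_mul
        (t := fun y => 1 / z y) ((isMeroAt_const 1 x).div (hf.isMeroAt x))
        (by simpa using (hf.tendsto_inv_affineValue hx).mono_left nhdsWithin_le_nhds)
      -- At a pole of `f` no denominator is needed: a power of `z` already dominates the pole of
      -- `u`.
      refine ⟨1, one_ne_zero, M, m, hM, ?_⟩
      filter_upwards [h, eventually_nhdsNE_notMem_of_finite (hf.finite_fiber hc 0) x] with y hy hy0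
      have hzy : z y ≠ 0 := hy0
      rw [eval_one, one_mul]
      calc ‖u y‖ = ‖(1 / z y) ^ m * u y‖ * ‖z y‖ ^ m := by
            rw [← norm_pow, ← norm_mul, mul_right_comm, ← mul_pow, one_div_mul_cancel hzy, one_pow,
              one_mul]
        _ ≤ M * (1 + ‖z y‖) ^ m := mul_le_mul hy
            (pow_le_pow_left₀ (norm_nonneg _) (by linarith) _) (by positivity) hM
    · have hd := (hf.eventually_mdifferentiableAt hx).self_of_nhds.2
      have hs : MDifferentiableAt 𝓘(ℂ, ℂ) 𝓘(ℂ, ℂ) (fun y => z y - z x) x :=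
        hd.sub mdifferentiableAt_const
      obtain ⟨m, M, hM, h⟩ := (hu x).exists_bounded_pow_mul
        (t := fun y => z y - z x) (((hf.isMeroAt x).add (isMeroAt_const (-z x) x)).congr
          (Eventually.of_forall fun y => by rw [sub_eq_add_neg]))
        (by simpa using (hs.continuousAt.tendsto.mono_left nhdsWithin_le_nhds :
          Tendsto _ (𝓝[≠] x) _))
      refine ⟨(X - Polynomial.C (z x)) ^ m, pow_ne_zero _ (X_sub_C_ne_zero _), M, 0, hM, ?_⟩
      filter_upwards [h] with y hy
      simpa using hy

/-- After multiplication by a polynomial `Q` in `f` the function `h` is tempered, and interpolation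
on the fibres gives `h = L (f, g) / (Q (f) * p' (f, g))`, where `p'` is the derivative in the second
variable. -/
theorem IsPrimitiveFor.isPullbackOfRational {B : Set ℂ} {g : C → ℂ} (hg : IsPrimitiveFor f B g)
    (hf : IsHolomorphicToCP f) (hc : ¬ ∃ c : CP 1, ∀ x, f x = c) {h : C → CP 1}
    (hh : IsHolomorphicToCP h) : IsPullbackOfRational (planeMap f g) h := by
  rcases (hh.finite_or_forall 0 1) with hfinh | hall
  swap
  -- When `h` is identically `∞` it is the pullback of `1 / 0`.
  · refine ⟨0, 1, 0, MvPolynomial.isHomogeneous_one _ _, MvPolynomial.isHomogeneous_zero _ _ _,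
      ∅, Set.finite_empty, fun x _ => ⟨fun h0 => one_ne_zero (α := ℂ) ?_, ?_⟩⟩
    · simpa using congrFun h0 0
    · rw [← (h x).mk_rep, Projectivization.mk_eq_mk_iff']
      refine ⟨(h x).rep 0, funext fun i => ?_⟩
      have := hall x
      fin_cases i
      · simp
      · simpa using this.symm
  have hhP : (poleSet h).Finite := hfinh.subset fun x hx => by
    have : (h x).rep 1 = 0 := hx
    simp [this]
  have hfin := hf.finite_fiber hc
  obtain ⟨p, -, hp'⟩ := hg.exists_equation hfin
  obtain ⟨Q, hQ, K, N, hb⟩ := hf.exists_growth_bound hc fun x => hh.isMeroAt x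
  set B' := B ∪ affineValue f '' poleSet h with hB'
  have hBB' : B ⊆ B' := Set.subset_union_left
  have hB'fin : B'.Finite := hg.finite.union (hhP.image _)
  have hnB : ∀ {x}, affineValue f x ∉ B' → affineValue f x ∉ B := fun hx h => hx (hBB' h)
  have hnh : ∀ {x}, affineValue f x ∉ B' → x ∉ poleSet h := fun hx h => hx (.inr ⟨_, h, rfl⟩)
  have hnf : ∀ {x}, affineValue f x ∉ B' → x ∉ poleSet f := fun hx h =>
    hnB hx (by rw [affineValue_of_mem_poleSet h]; exact hg.zero_mem)
  have hu : IsTempered (affineValue f) B' fun x => Q.eval (affineValue f x) * affineValue h x := by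
    refine isTempered_of_mdifferentiableAt (fun y hy => hg.regular y (hnB hy)) (fun y hy => ?_)
      ⟨K, N, fun x _ => hb x⟩
    have h1 := (hf.eventually_mdifferentiableAt (hnf hy)).self_of_nhds.2
    have h2 := (hh.eventually_mdifferentiableAt (hnh hy)).self_of_nhds.2
    rw [mdifferentiableAt_iff_chartAt (mem_chart_source ℂ y)] at h1 h2 ⊢
    exact (Q.differentiableAt.comp _ h1).mul h2
  obtain ⟨l, hl⟩ := exists_interpolation_coeff hfin hB'fin (hg.covered.mono hBB')
    (fun w hw => (hp' w fun h => hw (hBB' h)).1) hu (hg.tempered.mono hBB')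
  set L : ℂ[X][X] := ∑ k ∈ Finset.range p.natDegree, Polynomial.C (l k) * X ^ k with hL
  set D : ℂ[X][X] := Polynomial.C Q * derivative p with hD
  obtain ⟨n₁, hn₁⟩ := exists_hasTotalDegreeLE L
  obtain ⟨n₂, hn₂⟩ := exists_hasTotalDegreeLE D
  have hLn := hn₁.mono (le_max_left n₁ n₂)
  have hDn := hn₂.mono (le_max_right n₁ n₂)
  -- Homogenizing both in a common degree makes the powers of the third coordinate cancel in the
  -- quotient.
  refine ⟨_, coneForm (max n₁ n₂) L, coneForm (max n₁ n₂) D, isHomogeneous_coneForm _ _,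
    isHomogeneous_coneForm _ _, affineValue f ⁻¹' (B' ∪ {w | Q.IsRoot w}),
    hf.finite_preimage hc (hB'fin.union (finite_setOfPred_isRoot hQ)), fun x hx => ?_⟩
  have hxB : affineValue f x ∉ B' := fun h => hx (.inl h)
  have hQx : Q.eval (affineValue f x) ≠ 0 := fun h => hx (.inr h)
  obtain ⟨h1, h2⟩ := hg.derivative_evalEval_ne_zero hfin (fun w hw => (hp' w hw).2) (hnB hxB)
  obtain ⟨t, ht, hrep⟩ := exists_rep_planePoint (g x) (affineValue f x)
  have hDx : D.evalEval (affineValue f x) (g x) =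
      Q.eval (affineValue f x) * (derivative p).evalEval (affineValue f x) (g x) := by
    rw [hD, evalEval_mul, evalEval_C]
  have hLx : L.evalEval (affineValue f x) (g x) =
      affineValue h x * D.evalEval (affineValue f x) (g x) := by
    rw [hDx, h1, hL, evalEval_finsetSum]
    simp only [evalEval_mul, evalEval_C, evalEval_pow, evalEval_X]
    rw [← hl x hxB]
    ring
  have hD0 : t ^ max n₁ n₂ * D.evalEval (affineValue f x) (g x) ≠ 0 :=
    mul_ne_zero (pow_ne_zero _ ht) (hDx ▸ mul_ne_zero hQx h2)
  rw [planeMap_of_notMem (hnf hxB), hrep, hLn.eval_coneForm, hDn.eval_coneForm, hLx]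
  refine ⟨fun h0 => hD0 (by simpa using congrFun h0 1), ?_⟩
  have hh1 : (h x).rep 1 ≠ 0 := hnh hxB
  conv_lhs => rw [← (h x).mk_rep]
  rw [Projectivization.mk_eq_mk_iff']
  refine ⟨(h x).rep 1 / (t ^ max n₁ n₂ * D.evalEval (affineValue f x) (g x)), funext fun i => ?_⟩
  have hDx0 := right_ne_zero_of_mul hD0
  have hval : affineValue h x * (h x).rep 1 = (h x).rep 0 := div_mul_cancel₀ _ hh1
  fin_cases i
  · simp [-mul_eq_mul_left_iff, -mul_eq_mul_right_iff]
    rw [← hval]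
    field_simp
  · simp
    field_simp

theorem IsPrimitiveFor.isBirationalOntoPlaneCurve {B : Set ℂ} {g : C → ℂ}
    (hg : IsPrimitiveFor f B g) (hf : IsHolomorphicToCP f) (hc : ¬ ∃ c : CP 1, ∀ x, f x = c) :
    IsBirationalOntoPlaneCurve (planeMap f g) where
  holomorphic := hg.isHolomorphicToCP_planeMap hf hc
  image_curve := hg.isIrreduciblePlaneCurve hf hc
  generically_injective := by
    refine ⟨affineValue f ⁻¹' B, hf.finite_preimage hc hg.finite, fun x hx y hxy => ?_⟩
    have hxf : x ∉ poleSet f := fun h =>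
      hx (by rw [Set.mem_preimage, affineValue_of_mem_poleSet h]; exact hg.zero_mem)
    obtain ⟨-, h1, h2⟩ := planeMap_eq_of_notMem hxf hxy
    exact hg.injOn _ hx h2 rfl h1
  function_field := fun _ hh => hg.isPullbackOfRational hf hc hh

end FunctionField

theorem mainTheorem11 {C : Type*} [TopologicalSpace C] [T2Space C] [CompactSpace C]
    [ConnectedSpace C] [ChartedSpace ℂ C] [IsManifold 𝓘(ℂ, ℂ) ω C]
    (f : C → CP 1) (hf : IsHolomorphicToCP f) (hf_nonconst : ¬ ∃ c : CP 1, ∀ x, f x = c) :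
    ∃ (p : CP 2) (ν : C → CP 2),
      IsBirationalOntoPlaneCurve ν ∧ FactorsThroughProjection f p ν := by
  obtain ⟨g, B, hg⟩ := hf.exists_primitive hf_nonconst
  exact ⟨planeCenter, planeMap f g, hg.isBirationalOntoPlaneCurve hf hf_nonconst,
    factorsThroughProjection_planeMap (hf.finite_poleSet hf_nonconst)⟩
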